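/- Let $k$ be a field and let $(H,\cdot,1,\Delta,\varepsilon,S)$ be a quasitriangular Hopf algebra over $k$ with invertible antipode $S$ and universal $R$-matrix $R=\sum R_{(1)}\otimes R_{(2)}\in H\otimes H$; that is, $R$ is invertible, $R\,\Delta(h)=\Delta^{\mathrm{op}}(h)\,R$ for all $h\in H$, $(\Delta\otimes\mathrm{id})(R)=R_{13}R_{23}$ and $(\mathrm{id}\otimes\Delta)(R)=R_{13}R_{12}$. Write $\Delta(h)=\sum h_{(1)}\otimes h_{(2)}$ and $R'=\sum R_{(2)}\otimes R_{(1)}$; superscripts distinguish several copies of $R$. *Notation.* Let $H^\circ\subset H^*$ be the span of the matrix coefficients of the finite-dimensional $H$-modules, with the product $(\varphi\star\psi)(h)=\sum\varphi(h_{(1)})\psi(h_{(2)})$ and unit $\varepsilon$, and put $(x\rhd\varphi\lhd y)(h)=\varphi(yhx)$. Then $H\otimes H$ acts on the right of $H^\circ$ by $\varphi\cdot(x\otimes y)=S(y)\rhd\varphi\lhd x$, and $H$ acts by $\mathrm{coad}^r(h)(\varphi)=\varphi\cdot\Delta(h)=\sum S(h_{(2)})\rhd\varphi\lhd h_{(1)}$.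 *The graph algebras.* $\mathcal L_{0,1}(H)$ is the vector space $H^\circ$ with the product $\varphi\psi=\sum(\varphi\cdot F_{(1)})\star(\psi\cdot F_{(2)})$, where $F=R_{32}R_{42}\in(H\otimes H)^{\otimes 2}$, with unit $\varepsilon$ and right $H$-action $\mathrm{coad}^r$. $\mathcal L_{1,0}(H)$ is the vector space $\mathcal L_{0,1}(H)\otimes\mathcal L_{0,1}(H)$ with the product $$(\beta\otimes\alpha)(\beta'\otimes\alpha')=\sum\beta\,(\beta'\cdot\gamma_{(2)})\otimes(\alpha\cdot\gamma_{(1)})\,\alpha',\qquad \gamma=R_{32}R_{31}R_{42}R_{14}^{-1}\in(H\otimes H)^{\otimes 2},$$ unit $\varepsilon\otimes\varepsilon$ and action $\mathrm{coad}^r(h)(\beta\otimes\alpha)=\sum\mathrm{coad}^r(h_{(1)})(\beta)\otimes\mathrm{coad}^r(h_{(2)})(\alpha)$. For right $H$-module algebras $M,N$ the braided tensor product $M\,\widetilde\otimes\,N$ is $M\otimes N$ with the diagonal $H$-action and the product $(m\otimes n)(m'\otimes n')=\sum m\,(m'\cdot R_{(1)})\otimes(n\cdot R_{(2)})\,n'$.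 For $g,n\ge0$, $$\mathcal L_{g,n}(H)=\mathcal L_{1,0}(H)^{\widetilde\otimes g}\,\widetilde\otimes\,\mathcal L_{0,1}(H)^{\widetilde\otimes n},$$ an empty product being $k$. Let $j_i:\mathcal L_{1,0}(H)\to\mathcal L_{g,n}(H)$ ($1\le i\le g$) and $j_{g+l}:\mathcal L_{0,1}(H)\to\mathcal L_{g,n}(H)$ ($1\le l\le n$) be the embeddings of the tensor factors (with units in all the other factors). *The two-sided Heisenberg double.* $\mathcal{HH}(H^\circ)$ is the smash product $H^\circ\#(H\otimes H^{\mathrm{cop}})$ for the left action $(x\otimes y)\to\varphi=x\rhd\varphi\lhd S^{-1}(y)$, i.e. the vector space $H^\circ\otimes(H\otimes H)$ with the product $$\bigl(\varphi\#(x\otimes y)\bigr)\bigl(\psi\#(z\otimes t)\bigr)=\sum\varphi\star\bigl(x_{(1)}\rhd\psi\lhd S^{-1}(y_{(2)})\bigr)\#\bigl(x_{(2)}z\otimes y_{(1)}t\bigr).$$ Write $\varphi$ for $\varphi\#(1\otimes1)$, $h$ for $\varepsilon\#(h\otimes1)$ and $\widetilde h$ for $\varepsilon\#(1\otimes h)$.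 The algebra $\mathcal{HH}(H^\circ)^{\otimes g}\otimes H^{\otimes n}$ has the usual product of a tensor product of algebras. *The maps.* Define $\Phi_{0,1}:\mathcal L_{0,1}(H)\to H$ by $\Phi_{0,1}(\varphi)=(\varphi\otimes\mathrm{id})(RR')$, define $\Phi_{1,0}:\mathcal L_{1,0}(H)\to\mathcal{HH}(H^\circ)$ by $$\Phi_{1,0}(\beta\otimes\alpha)=\sum\bigl(R^1_{(2)}R^2_{(2)}\rhd\beta\lhd R^3_{(1)}R^1_{(1)}\bigr)\,R^3_{(2)}R^2_{(1)}\,\Phi_{0,1}(\alpha),$$ and define $\mathsf D_{g,n}:H\to\mathcal{HH}(H^\circ)^{\otimes g}\otimes H^{\otimes n}$ by $\mathsf D_{0,0}=\varepsilon$ and $$\mathsf D_{g,n}(h)=\sum\widetilde{h_{(1)}}\,h_{(2)}\otimes\cdots\otimes\widetilde{h_{(2g-1)}}\,h_{(2g)}\otimes h_{(2g+1)}\otimes\cdots\otimes h_{(2g+n)}.$$ **Theorem.** For all $g,n\ge0$ there is a unique morphism of algebras $$\Phi_{g,n}:\mathcal L_{g,n}(H)\to\mathcal{HH}(H^\circ)^{\otimes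 g}\otimes H^{\otimes n}$$ such that $$\Phi_{g,n}\bigl(j_{g+l}(\varphi)\bigr)=\sum 1^{\otimes g}\otimes1^{\otimes(l-1)}\otimes\Phi_{0,1}\bigl(\mathrm{coad}^r(R_{(1)})(\varphi)\bigr)\otimes\mathsf D_{0,n-l}(R_{(2)}),$$ $$\Phi_{g,n}\bigl(j_i(x)\bigr)=\sum 1^{\otimes(i-1)}\otimes\Phi_{1,0}\bigl(\mathrm{coad}^r(R_{(1)})(x)\bigr)\otimes\mathsf D_{g-i,n}(R_{(2)})$$ for all $\varphi\in\mathcal L_{0,1}(H)$, $1\le l\le n$, $x\in\mathcal L_{1,0}(H)$ and $1\le i\le g$. -/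

import Mathlib

open scoped TensorProduct
noncomputable section

namespace GraphAlgebra

universe u v w

section Cop
variable (k : Type u) (H : Type v) [Field k] [Ring H]

/-- The underlying algebra of `H^cop`. -/
def Cop (H : Type v) : Type v := H

instance : Ring (Cop H) := inferInstanceAs (Ring H)
instance [Algebra k H] : Algebra k (Cop H) := inferInstanceAs (Algebra k H)

instance [Bialgebra k H] : CoalgebraStruct k (Cop H) where
  comul := (TensorProduct.comm k H H).toLinearMap ∘ₗ (Coalgebra.comul : H →ₗ[k] H ⊗[k] H)
  counit := (Coalgebra.counit : H →ₗ[k] k)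

variable [Bialgebra k H]

def rev3 : H ⊗[k] (H ⊗[k] H) →ₗ[k] H ⊗[k] (H ⊗[k] H) :=
  (TensorProduct.assoc k H H H).toLinearMap ∘ₗ
    (TensorProduct.comm k H H).toLinearMap.rTensor H ∘ₗ
      (TensorProduct.comm k H (H ⊗[k] H)).toLinearMap

theorem cop_left (t : H ⊗[k] H) :
    TensorProduct.assoc k H H H
      (((TensorProduct.comm k H H).toLinearMap ∘ₗ (Coalgebra.comul : H →ₗ[k] H ⊗[k] H)).rTensor H
        (TensorProduct.comm k H H t)) =
      rev3 k H ((Coalgebra.comul : H →ₗ[k] H ⊗[k] H).lTensor H t) := by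
  induction t with
  | zero => simp
  | add x y hx hy => simp only [map_add, hx, hy]
  | tmul x y =>
    simp only [TensorProduct.comm_tmul, LinearMap.rTensor_tmul, LinearMap.lTensor_tmul,
      LinearMap.comp_apply, LinearEquiv.coe_coe]
    induction (Coalgebra.comul y : H ⊗[k] H) with
    | zero => simp
    | add a b ha hb => simp only [map_add, TensorProduct.add_tmul, TensorProduct.tmul_add, ha, hb]
    | tmul a b => simp [rev3]

theorem cop_right (t : H ⊗[k] H) :
    ((TensorProduct.comm k H H).toLinearMap ∘ₗ (Coalgebra.comul : H →ₗ[k] H ⊗[k] H)).lTensor H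
        (TensorProduct.comm k H H t) =
      rev3 k H (TensorProduct.assoc k H H H
        ((Coalgebra.comul : H →ₗ[k] H ⊗[k] H).rTensor H t)) := by
  induction t with
  | zero => simp
  | add x y hx hy => simp only [map_add, hx, hy]
  | tmul x y =>
    simp only [TensorProduct.comm_tmul, LinearMap.rTensor_tmul, LinearMap.lTensor_tmul,
      LinearMap.comp_apply, LinearEquiv.coe_coe]
    induction (Coalgebra.comul x : H ⊗[k] H) with
    | zero => simp
    | add a b ha hb => simp only [map_add, TensorProduct.add_tmul, TensorProduct.tmul_add, ha, hb]
    | tmul a b => simp [rev3]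

/-- `H^cop`: the algebra `H` with the opposite coproduct. -/
instance : Bialgebra k (Cop H) where
  coassoc := by
    refine LinearMap.ext fun h => ?_
    refine (cop_left k H (Coalgebra.comul h)).trans ?_
    refine Eq.trans ?_ (cop_right k H (Coalgebra.comul h)).symm
    exact congrArg (rev3 k H) (Coalgebra.coassoc_apply (R := k) (A := H) h).symm
  rTensor_counit_comp_comul := by
    refine LinearMap.ext fun h => ?_
    have h1 := congrArg (TensorProduct.comm k H k) (Coalgebra.lTensor_counit_comul (R := k) (A := H) h)
    refine Eq.trans ?_ h1
    change (Coalgebra.counit : H →ₗ[k] k).rTensor H (TensorProduct.comm k H H (Coalgebra.comul h)) = _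
    induction (Coalgebra.comul h : H ⊗[k] H) with
    | zero => simp
    | add a b ha hb => simp only [map_add, ha, hb]
    | tmul a b => simp
  lTensor_counit_comp_comul := by
    refine LinearMap.ext fun h => ?_
    have h1 := congrArg (TensorProduct.comm k k H) (Coalgebra.rTensor_counit_comul (R := k) (A := H) h)
    refine Eq.trans ?_ h1
    change (Coalgebra.counit : H →ₗ[k] k).lTensor H (TensorProduct.comm k H H (Coalgebra.comul h)) = _
    induction (Coalgebra.comul h : H ⊗[k] H) with
    | zero => simp
    | add a b ha hb => simp only [map_add, ha, hb]
    | tmul a b => simp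
  counit_one := Bialgebra.counit_one (R := k) (A := H)
  mul_compr₂_counit := Bialgebra.mul_compr₂_counit (R := k) (A := H)
  comul_one := by
    change TensorProduct.comm k H H (Coalgebra.comul (1 : H)) = (1 : H) ⊗ₜ[k] (1 : H)
    rw [Bialgebra.comul_one, Algebra.TensorProduct.one_def, TensorProduct.comm_tmul]
  mul_compr₂_comul := by
    refine LinearMap.ext₂ fun a b => ?_
    exact (congrArg (Algebra.TensorProduct.comm k H H)
      (Bialgebra.comul_mul (R := k) (A := H) a b)).trans
        (map_mul (Algebra.TensorProduct.comm k H H) _ _)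

variable {k H}

/-- The identity map `H → H^cop`. -/
def toCop : H ≃ₐ[k] Cop H := (AlgEquiv.refl : H ≃ₐ[k] H)

theorem counit_toCop (h : H) :
    Coalgebra.counit (R := k) (toCop (k := k) h) = Coalgebra.counit (R := k) h := rfl

theorem comul_toCop (h : H) : (Coalgebra.comul (toCop (k := k) h) : Cop H ⊗[k] Cop H) =
    TensorProduct.map (toCop (k := k)).toLinearMap (toCop (k := k)).toLinearMap
      (TensorProduct.comm k H H (Coalgebra.comul h)) := by
  have : TensorProduct.map (toCop (k := k) (H := H)).toLinearMap
      (toCop (k := k) (H := H)).toLinearMap = (LinearMap.id : H ⊗[k] H →ₗ[k] H ⊗[k] H) :=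
    TensorProduct.map_id
  rw [this]
  rfl

end Cop

section Smash
variable (k : Type*) (K A : Type*) [Field k] [Ring K] [Bialgebra k K] [Ring A] [Algebra k A]

/-- A left `K`-module algebra structure on the algebra `A`: an action of the algebra `K` with
`x · 1 = ε(x) 1` and `x · (a b) = ∑ (x₁ · a) (x₂ · b)`. -/
structure ModuleAlgebra where
  act : K →ₐ[k] Module.End k A
  act_one : ∀ x : K, act x 1 = Coalgebra.counit (R := k) x • (1 : A)
  act_mul : ∀ (x : K) (a b : A), act x (a * b) =
    LinearMap.mul' k A (TensorProduct.map₂ act.toLinearMap act.toLinearMap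
      (Coalgebra.comul x) (a ⊗ₜ b))

variable {k K A}

/-- The smash product `A # K`: the vector space `A ⊗ K` with the product
`(a # x) (b # y) = ∑ a (x₁ · b) # x₂ y`. -/
def Smash (_α : ModuleAlgebra k K A) : Type _ := A ⊗[k] K

namespace Smash
variable (α : ModuleAlgebra k K A)

instance : AddCommGroup (Smash α) := inferInstanceAs (AddCommGroup (A ⊗[k] K))
instance : Module k (Smash α) := inferInstanceAs (Module k (A ⊗[k] K))

/-- The identity map `A ⊗ K → A # K`, sending `a ⊗ x` to `a # x`. -/
def ofTensor : A ⊗[k] K →ₗ[k] Smash α := (LinearMap.id : A ⊗[k] K →ₗ[k] A ⊗[k] K)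

/-- The multiplication of the smash product:
`(a # x) (b # y) = ∑ a (x₁ · b) # x₂ y`. -/
def mulLin : A ⊗[k] K →ₗ[k] A ⊗[k] K →ₗ[k] A ⊗[k] K :=
  TensorProduct.lift <| LinearMap.mk₂ k
    (fun a x => (LinearMap.mul k A a).rTensor K ∘ₗ
      TensorProduct.map₂ α.act.toLinearMap (LinearMap.mul k K) (Coalgebra.comul x))
    (fun a a' x => by simp [LinearMap.rTensor_add, LinearMap.add_comp])
    (fun c a x => by simp [LinearMap.rTensor_smul, LinearMap.smul_comp])
    (fun a x x' => by simp [LinearMap.comp_add])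
    (fun c a x => by simp [LinearMap.comp_smul])

theorem mulLin_repr {ι : Type*} (a b : A) (x y : K) (r : Coalgebra.Repr k x ι) :
    mulLin α (a ⊗ₜ x) (b ⊗ₜ y) =
      ∑ i ∈ r.index, (a * α.act (r.left i) b) ⊗ₜ[k] (r.right i * y) := by
  simp [mulLin, ← r.eq]

theorem one_mulLin (u : A ⊗[k] K) : mulLin α (1 ⊗ₜ 1) u = u := by
  induction u with
  | zero => simp
  | add u v hu hv => simp only [map_add, hu, hv]
  | tmul b y => simp [mulLin, Algebra.TensorProduct.one_def]

theorem mulLin_one (u : A ⊗[k] K) : mulLin α u (1 ⊗ₜ 1) = u := by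
  induction u with
  | zero => simp
  | add u v hu hv => simp only [map_add, LinearMap.add_apply, hu, hv]
  | tmul a x =>
    rw [mulLin_repr α a 1 x 1 (Coalgebra.Repr.arbitrary k x)]
    simp only [α.act_one, mul_one, mul_smul_comm, TensorProduct.smul_tmul,
      ← TensorProduct.tmul_sum, Coalgebra.sum_counit_smul]

theorem act_mul_repr {ι : Type*} (x : K) (a b : A) (r : Coalgebra.Repr k x ι) :
    α.act x (a * b) = ∑ i ∈ r.index, α.act (r.left i) a * α.act (r.right i) b := by
  simp [α.act_mul, ← r.eq]

theorem comul_repr_mul {ι κ : Type*} (x y : K) (r : Coalgebra.Repr k x ι)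
    (s : Coalgebra.Repr k y κ) : (Coalgebra.comul (x * y) : K ⊗[k] K) =
      ∑ i ∈ r.index, ∑ j ∈ s.index, (r.left i * s.left j) ⊗ₜ (r.right i * s.right j) := by
  rw [Bialgebra.comul_mul, ← r.eq, ← s.eq]
  simp [Finset.sum_mul_sum]

theorem mulLin_assoc (u v w : A ⊗[k] K) :
    mulLin α (mulLin α u v) w = mulLin α u (mulLin α v w) := by
  induction u with
  | zero => simp
  | add u u' hu hu' => simp only [map_add, LinearMap.add_apply, hu, hu']
  | tmul a x =>
  induction v with
  | zero => simp
  | add u u' hu hu' => simp only [map_add, LinearMap.add_apply, hu, hu']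
  | tmul b y =>
  induction w with
  | zero => simp
  | add u u' hu hu' => simp only [map_add, hu, hu']
  | tmul c z =>
    let r := Coalgebra.Repr.arbitrary k x
    let s := Coalgebra.Repr.arbitrary k y
    let r1 := fun i => Coalgebra.Repr.arbitrary k (r.left i)
    let r2 := fun i => Coalgebra.Repr.arbitrary k (r.right i)
    have key := Coalgebra.sum_tmul_tmul_eq r r1 r2
    have L : mulLin α (mulLin α (a ⊗ₜ x) (b ⊗ₜ y)) (c ⊗ₜ z) =
        ∑ j ∈ s.index, ∑ i ∈ r.index, ∑ l ∈ (r2 i).index,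
          (a * α.act (r.left i) b * α.act ((r2 i).left l * s.left j) c) ⊗ₜ[k]
            ((r2 i).right l * s.right j * z) := by
      rw [mulLin_repr α a b x y r, map_sum, LinearMap.sum_apply, Finset.sum_comm]
      refine Finset.sum_congr rfl fun i _ => ?_
      rw [mulLin, TensorProduct.lift.tmul, LinearMap.mk₂_apply,
        comul_repr_mul _ _ (r2 i) s]
      simp only [map_sum, LinearMap.comp_apply, LinearMap.sum_apply,
        TensorProduct.map₂_apply_tmul, TensorProduct.map_tmul,
        LinearMap.rTensor_tmul, LinearMap.mul_apply', AlgHom.toLinearMap_apply]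
      rw [Finset.sum_comm]
    have Rr : mulLin α (a ⊗ₜ x) (mulLin α (b ⊗ₜ y) (c ⊗ₜ z)) =
        ∑ j ∈ s.index, ∑ i ∈ r.index, ∑ l ∈ (r1 i).index,
          (a * α.act ((r1 i).left l) b * α.act ((r1 i).right l * s.left j) c) ⊗ₜ[k]
            (r.right i * s.right j * z) := by
      rw [mulLin_repr α b c y z s, map_sum]
      refine Finset.sum_congr rfl fun j _ => ?_
      rw [mulLin_repr α a _ x _ r]
      refine Finset.sum_congr rfl fun i _ => ?_
      rw [act_mul_repr α _ _ _ (r1 i), Finset.mul_sum, TensorProduct.sum_tmul]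
      refine Finset.sum_congr rfl fun l _ => ?_
      rw [map_mul, Module.End.mul_apply, mul_assoc, mul_assoc]
    rw [L, Rr]
    refine Finset.sum_congr rfl fun j _ => ?_
    have := congrArg (TensorProduct.lift (LinearMap.mk₂ k
      (fun (p : K) (t : K ⊗[k] K) => TensorProduct.map
        ((LinearMap.mul k A (a * α.act p b)) ∘ₗ (α.act.toLinearMap.flip c) ∘ₗ
          LinearMap.mulRight k (s.left j)) (LinearMap.mulRight k (s.right j * z)) t)
      (fun p q t => by simp [mul_add, LinearMap.add_comp, TensorProduct.map_add_left])
      (fun d p t => by simp [LinearMap.smul_comp, TensorProduct.map_smul_left])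
      (fun p t t' => by simp) (fun d p t => by simp))) key
    simpa [mul_assoc] using this.symm

instance : Ring (Smash α) :=
  { (inferInstance : AddCommGroup (Smash α)) with
    mul := fun u v => mulLin α u v
    one := (1 : A) ⊗ₜ[k] (1 : K)
    left_distrib := fun u v w => map_add (mulLin α u) v w
    right_distrib := fun u v w => LinearMap.map_add₂ (mulLin α) u v w
    zero_mul := fun u => LinearMap.map_zero₂ (mulLin α) u
    mul_zero := fun u => map_zero (mulLin α u)
    mul_assoc := mulLin_assoc α
    one_mul := one_mulLin α
    mul_one := mulLin_one α }

instance : Algebra k (Smash α) :=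
  Algebra.ofModule (fun c u v => LinearMap.map_smul₂ (mulLin α) c u v)
    (fun c u v => map_smul (mulLin α u) c v)

end Smash
end Smash

section RestrictedDual
variable (k : Type u) (H : Type v) [Field k] [Ring H]

/-- The matrix coefficient `h ↦ f (h · v)` of the representation `ρ` of `H` on `V`. -/
def matrixCoeff {k : Type u} {H : Type v} [Field k] [Ring H] [Algebra k H]
    {V : Type*} [AddCommGroup V] [Module k V]
    (ρ : H →ₐ[k] Module.End k V) (f : Module.Dual k V) (x : V) : H →ₗ[k] k :=
  f ∘ₗ ρ.toLinearMap.flip x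

/-- The span of all matrix coefficients of the finite-dimensional `H`-modules (every such module
is isomorphic to a module structure on some `Fin n → k`). -/
def restrictedDualSubmodule [Algebra k H] : Submodule k (H →ₗ[k] k) :=
  Submodule.span k {φ | ∃ (n : ℕ) (ρ : H →ₐ[k] Module.End k (Fin n → k))
    (f : Module.Dual k (Fin n → k)) (x : Fin n → k), φ = matrixCoeff ρ f x}

variable {k H}

theorem matrixCoeff_mem [Algebra k H] {V : Type*} [AddCommGroup V] [Module k V]
    [FiniteDimensional k V] (ρ : H →ₐ[k] Module.End k V) (f : Module.Dual k V) (x : V) :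
    matrixCoeff ρ f x ∈ restrictedDualSubmodule k H := by
  let e : V ≃ₗ[k] (Fin (Module.finrank k V) → k) := (Module.finBasis k V).equivFun
  refine Submodule.subset_span ⟨Module.finrank k V, (e.conjAlgEquiv k).toAlgHom.comp ρ,
    f ∘ₗ e.symm.toLinearMap, e x, ?_⟩
  ext h
  simp [matrixCoeff, LinearEquiv.conjAlgEquiv]

/-- `x ▷ φ ◁ y`, that is `h ↦ φ (y h x)`. -/
def coregFun [Algebra k H] (x y : H) : (H →ₗ[k] k) →ₗ[k] (H →ₗ[k] k) where
  toFun φ := φ ∘ₗ LinearMap.mulLeft k y ∘ₗ LinearMap.mulRight k x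
  map_add' _ _ := rfl
  map_smul' _ _ := rfl

theorem coregFun_mem [Algebra k H] (x y : H) {φ : H →ₗ[k] k}
    (hφ : φ ∈ restrictedDualSubmodule k H) : coregFun x y φ ∈ restrictedDualSubmodule k H := by
  induction hφ using Submodule.span_induction with
  | mem φ h =>
    obtain ⟨n, ρ, f, v, rfl⟩ := h
    have : coregFun x y (matrixCoeff ρ f v) = matrixCoeff ρ (f ∘ₗ ρ y) (ρ x v) := by
      ext h
      simp [coregFun, matrixCoeff]
    rw [this]
    exact matrixCoeff_mem _ _ _
  | zero => simp
  | add a b _ _ ha hb => rw [map_add]; exact add_mem ha hb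
  | smul c a _ ha => rw [map_smul]; exact Submodule.smul_mem _ c ha

variable [Bialgebra k H]

theorem convMul_mem {φ ψ : WithConv (H →ₗ[k] k)}
    (hφ : φ.ofConv ∈ restrictedDualSubmodule k H) (hψ : ψ.ofConv ∈ restrictedDualSubmodule k H) :
    (φ * ψ).ofConv ∈ restrictedDualSubmodule k H := by
  let m : (H →ₗ[k] k) →ₗ[k] (H →ₗ[k] k) →ₗ[k] (H →ₗ[k] k) :=
    LinearMap.mk₂ k (fun a b => (WithConv.toConv a * WithConv.toConv b).ofConv)
      (fun a a' b => by simp [WithConv.toConv_add, add_mul])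
      (fun c a b => by rw [WithConv.toConv_smul, smul_mul_assoc]; rfl)
      (fun a b b' => by simp [WithConv.toConv_add, mul_add])
      (fun c a b => by rw [WithConv.toConv_smul, mul_smul_comm]; rfl)
  suffices h : ∀ a ∈ restrictedDualSubmodule k H, ∀ b ∈ restrictedDualSubmodule k H,
      m a b ∈ restrictedDualSubmodule k H from h _ hφ _ hψ
  intro a ha b hb
  induction ha using Submodule.span_induction with
  | zero => simp
  | add x y _ _ hx hy => rw [map_add]; exact add_mem hx hy
  | smul c x _ hx => rw [map_smul]; exact Submodule.smul_mem _ c hx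
  | mem a h =>
  induction hb using Submodule.span_induction with
  | zero => simp
  | add x y _ _ hx hy => rw [map_add]; exact add_mem hx hy
  | smul c x _ hx => rw [map_smul]; exact Submodule.smul_mem _ c hx
  | mem b h' =>
  obtain ⟨n, ρ, f, v, rfl⟩ := h
  obtain ⟨n', ρ', f', v', rfl⟩ := h'
  have : m (matrixCoeff ρ f v) (matrixCoeff ρ' f' v') =
      matrixCoeff ((Module.endTensorEndAlgHom (R := k) (S := k) (A := k)).comp
        ((Algebra.TensorProduct.map ρ ρ').comp (Bialgebra.comulAlgHom k H)))
        (LinearMap.mul' k k ∘ₗ TensorProduct.map f f') (v ⊗ₜ[k] v') := by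
    ext h
    let r := Coalgebra.Repr.arbitrary k h
    simp [m, matrixCoeff, r.convMul_apply, ← r.eq, Module.endTensorEndAlgHom_apply]
  rw [this]
  exact matrixCoeff_mem _ _ _

theorem convOne_mem : (1 : WithConv (H →ₗ[k] k)).ofConv ∈ restrictedDualSubmodule k H := by
  have : (1 : WithConv (H →ₗ[k] k)).ofConv =
      matrixCoeff ((Algebra.ofId k (Module.End k k)).comp (Bialgebra.counitAlgHom k H))
        LinearMap.id (1 : k) := by
    ext h
    simp [matrixCoeff, Algebra.ofId_apply]
  rw [this]
  exact matrixCoeff_mem _ _ _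

variable (k H)

/-- The restricted dual `H°` with its product `φ ⋆ ψ = (φ ⊗ ψ) ∘ Δ` and unit `ε`, as a
subalgebra of the convolution algebra of linear forms. -/
def restrictedDualSubalgebra : Subalgebra k (WithConv (H →ₗ[k] k)) where
  carrier := {φ | φ.ofConv ∈ restrictedDualSubmodule k H}
  mul_mem' := convMul_mem
  one_mem' := convOne_mem
  add_mem' ha hb := (restrictedDualSubmodule k H).add_mem ha hb
  zero_mem' := (restrictedDualSubmodule k H).zero_mem
  algebraMap_mem' c := by
    rw [Algebra.algebraMap_eq_smul_one]
    exact Submodule.smul_mem _ c convOne_mem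

/-- The restricted dual `H°` with the product `⋆`. -/
def RestrictedDual : Type (max u v) := restrictedDualSubalgebra k H

instance : Ring (RestrictedDual k H) := inferInstanceAs (Ring (restrictedDualSubalgebra k H))
instance : Algebra k (RestrictedDual k H) :=
  inferInstanceAs (Algebra k (restrictedDualSubalgebra k H))

/-- Evaluation of an element of `H°`. -/
def evalDual : RestrictedDual k H →ₗ[k] (H →ₗ[k] k) where
  toFun φ := φ.1.ofConv
  map_add' _ _ := rfl
  map_smul' _ _ := rfl

variable {k H}

theorem dual_ext {φ ψ : RestrictedDual k H} (h : ∀ x, evalDual k H φ x = evalDual k H ψ x) :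
    φ = ψ :=
  Subtype.ext (WithConv.ext (LinearMap.ext h))

variable (k H)

/-- The coregular actions `(x ⊗ y, φ) ↦ x ▷ φ ◁ y`, where `(x ▷ φ ◁ y)(h) = φ (y h x)`. -/
def coreg : H ⊗[k] H →ₗ[k] RestrictedDual k H →ₗ[k] RestrictedDual k H :=
  TensorProduct.lift <| LinearMap.mk₂ k
    (fun x y =>
      { toFun := fun φ => ⟨WithConv.toConv (coregFun x y (evalDual k H φ)),
          coregFun_mem x y (φ := evalDual k H φ) φ.2⟩
        map_add' := fun _ _ => rfl
        map_smul' := fun _ _ => rfl })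
    (fun x x' y => LinearMap.ext fun φ => dual_ext fun h => by
      change evalDual k H φ (y * (h * (x + x'))) =
        evalDual k H φ (y * (h * x)) + evalDual k H φ (y * (h * x'))
      simp [mul_add])
    (fun c x y => LinearMap.ext fun φ => dual_ext fun h => by
      change evalDual k H φ (y * (h * (c • x))) = c • evalDual k H φ (y * (h * x))
      simp)
    (fun x y y' => LinearMap.ext fun φ => dual_ext fun h => by
      change evalDual k H φ ((y + y') * (h * x)) =
        evalDual k H φ (y * (h * x)) + evalDual k H φ (y' * (h * x))
      simp [add_mul])
    (fun c x y => LinearMap.ext fun φ => dual_ext fun h => by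
      change evalDual k H φ ((c • y) * (h * x)) = c • evalDual k H φ (y * (h * x))
      simp)

variable {k H}

@[simp]
theorem evalDual_coreg (x y : H) (φ : RestrictedDual k H) (h : H) :
    evalDual k H (coreg k H (x ⊗ₜ y) φ) h = evalDual k H φ (y * (h * x)) := rfl

theorem evalDual_mul {ι : Type*} (φ ψ : RestrictedDual k H) (h : H) (r : Coalgebra.Repr k h ι) :
    evalDual k H (φ * ψ) h =
      ∑ i ∈ r.index, evalDual k H φ (r.left i) * evalDual k H ψ (r.right i) :=
  r.convMul_apply φ.1 ψ.1

theorem evalDual_mul' (φ ψ : RestrictedDual k H) (h : H) :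
    evalDual k H (φ * ψ) h = LinearMap.mul' k k
      (TensorProduct.map (evalDual k H φ) (evalDual k H ψ) (Coalgebra.comul h)) := rfl

@[simp]
theorem evalDual_one (h : H) : evalDual k H 1 h = Coalgebra.counit (R := k) h := rfl

end RestrictedDual

section Antipode
variable (k : Type u) (H : Type v) [Field k] [Ring H] [HopfAlgebra k H]

/-- The antipode of `H` is invertible. -/
class BijectiveAntipode : Prop where
  bijective : Function.Bijective (HopfAlgebra.antipode k : H →ₗ[k] H)

theorem comul_comp_antipode : (Coalgebra.comul ∘ₗ HopfAlgebra.antipode k : H →ₗ[k] H ⊗[k] H) =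
    TensorProduct.map (HopfAlgebra.antipode k) (HopfAlgebra.antipode k) ∘ₗ
      (TensorProduct.comm k H H).toLinearMap ∘ₗ Coalgebra.comul := by
  let i₁ : H →ₐ[k] H ⊗[k] H := Algebra.TensorProduct.includeLeft
  let i₂ : H →ₐ[k] H ⊗[k] H := Algebra.TensorProduct.includeRight
  let c : (H →ₗ[k] H ⊗[k] H) → WithConv (H →ₗ[k] H ⊗[k] H) := WithConv.toConv
  have hδ : c Coalgebra.comul = c i₁.toLinearMap * c i₂.toLinearMap := by
    ext h
    let r := Coalgebra.Repr.arbitrary k h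
    simp [c, r.convMul_apply, i₁, i₂, r.eq]
  have hG : c (TensorProduct.map (HopfAlgebra.antipode k) (HopfAlgebra.antipode k) ∘ₗ
      (TensorProduct.comm k H H).toLinearMap ∘ₗ Coalgebra.comul) =
      c (i₂.toLinearMap ∘ₗ HopfAlgebra.antipode k) *
        c (i₁.toLinearMap ∘ₗ HopfAlgebra.antipode k) := by
    ext h
    let r := Coalgebra.Repr.arbitrary k h
    rw [r.convMul_apply]
    simp [c, i₁, i₂, ← r.eq]
  have hi : ∀ i : H →ₐ[k] H ⊗[k] H,
      c (i.toLinearMap ∘ₗ HopfAlgebra.antipode k) * c i.toLinearMap = 1 := by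
    intro i
    have h1 := LinearMap.algHom_comp_convMul_distrib i
      (WithConv.toConv (HopfAlgebra.antipode k : H →ₗ[k] H)) (WithConv.toConv LinearMap.id)
    rw [LinearMap.antipode_mul_id] at h1
    apply WithConv.ext
    refine Eq.trans h1.symm ?_
    ext h
    simp
  have hl : c (TensorProduct.map (HopfAlgebra.antipode k) (HopfAlgebra.antipode k) ∘ₗ
      (TensorProduct.comm k H H).toLinearMap ∘ₗ Coalgebra.comul) * c Coalgebra.comul = 1 := by
    rw [hG, hδ, mul_assoc, ← mul_assoc (c (i₁.toLinearMap ∘ₗ _)), hi, one_mul, hi]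
  have := left_inv_eq_right_inv hl (LinearMap.comul_right_inv (R := k) (C := H))
  exact (WithConv.toConv_injective this).symm

variable [hS : BijectiveAntipode k H]

/-- The inverse of the antipode. -/
def antipodeInv : H →ₗ[k] H :=
  (LinearEquiv.ofBijective (HopfAlgebra.antipode k) hS.bijective).symm.toLinearMap

variable {k H}

theorem antipode_antipodeInv (x : H) : HopfAlgebra.antipode k (antipodeInv k H x) = x :=
  (LinearEquiv.ofBijective (HopfAlgebra.antipode k) hS.bijective).apply_symm_apply x

theorem antipodeInv_antipode (x : H) : antipodeInv k H (HopfAlgebra.antipode k x) = x :=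
  (LinearEquiv.ofBijective (HopfAlgebra.antipode k) hS.bijective).symm_apply_apply x

theorem antipodeInv_mul (x y : H) :
    antipodeInv k H (x * y) = antipodeInv k H y * antipodeInv k H x := by
  apply hS.bijective.1
  rw [HopfAlgebra.antipode_mul_antidistrib]
  simp only [antipode_antipodeInv]

theorem antipodeInv_one : antipodeInv k H 1 = 1 := by
  apply hS.bijective.1
  rw [antipode_antipodeInv, HopfAlgebra.antipode_one]

theorem counit_antipodeInv (x : H) :
    Coalgebra.counit (R := k) (antipodeInv k H x) = Coalgebra.counit (R := k) x := by
  rw [← HopfAlgebra.counit_antipode (R := k) (antipodeInv k H x), antipode_antipodeInv]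

theorem comul_antipodeInv (x : H) : (Coalgebra.comul (antipodeInv k H x) : H ⊗[k] H) =
    TensorProduct.map (antipodeInv k H) (antipodeInv k H)
      (TensorProduct.comm k H H (Coalgebra.comul x)) := by
  have h := LinearMap.congr_fun (comul_comp_antipode k H) (antipodeInv k H x)
  simp only [LinearMap.comp_apply, antipode_antipodeInv, LinearEquiv.coe_coe] at h
  rw [h]
  induction (Coalgebra.comul (antipodeInv k H x) : H ⊗[k] H) with
  | zero => simp
  | add a b ha hb => simp only [map_add, ← ha, ← hb]
  | tmul a b => simp [antipodeInv_antipode]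

end Antipode

section TwoSidedHeisenberg
variable (k : Type u) (H : Type v) [Field k] [Ring H] [HopfAlgebra k H] [BijectiveAntipode k H]

/-- The action `(x ⊗ y) → φ = x ▷ φ ◁ S⁻¹(y)` of `H ⊗ H^cop` on `H°`. -/
def heisAct : H ⊗[k] Cop H →ₗ[k] RestrictedDual k H →ₗ[k] RestrictedDual k H :=
  coreg k H ∘ₗ (antipodeInv k H ∘ₗ (toCop (k := k) (H := H)).symm.toLinearMap).lTensor H

variable {k H}

@[simp]
theorem evalDual_heisAct (x y : H) (φ : RestrictedDual k H) (h : H) :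
    evalDual k H (heisAct k H (x ⊗ₜ[k] toCop (k := k) y) φ) h =
      evalDual k H φ (antipodeInv k H y * (h * x)) := by
  simp [heisAct]

theorem heisAct_one : heisAct k H 1 = LinearMap.id := by
  refine LinearMap.ext fun φ => dual_ext fun h => ?_
  rw [Algebra.TensorProduct.one_def, ← map_one (toCop (k := k) (H := H)), evalDual_heisAct]
  simp [antipodeInv_one]

theorem heisAct_mul (a b : H ⊗[k] Cop H) :
    heisAct k H (a * b) = heisAct k H a ∘ₗ heisAct k H b := by
  induction a with
  | zero => simp
  | add a a' ha ha' => simp only [add_mul, map_add, ha, ha', LinearMap.add_comp]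
  | tmul x y =>
  induction b with
  | zero => simp
  | add a a' ha ha' => simp only [mul_add, map_add, ha, ha', LinearMap.comp_add]
  | tmul x' y' =>
    obtain ⟨y, rfl⟩ := (toCop (k := k) (H := H)).surjective y
    obtain ⟨y', rfl⟩ := (toCop (k := k) (H := H)).surjective y'
    refine LinearMap.ext fun φ => dual_ext fun h => ?_
    rw [Algebra.TensorProduct.tmul_mul_tmul, ← map_mul, LinearMap.comp_apply]
    simp only [evalDual_heisAct, antipodeInv_mul, mul_assoc]

theorem heisAct_apply_one (t : H ⊗[k] Cop H) :
    heisAct k H t 1 = Coalgebra.counit (R := k) t • (1 : RestrictedDual k H) := by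
  induction t with
  | zero => simp
  | add a b ha hb => simp only [map_add, LinearMap.add_apply, ha, hb, add_smul]
  | tmul x y =>
    obtain ⟨y, rfl⟩ := (toCop (k := k) (H := H)).surjective y
    refine dual_ext fun h => ?_
    rw [evalDual_heisAct, evalDual_one, Bialgebra.counit_mul,
      Bialgebra.counit_mul, counit_antipodeInv, map_smul, LinearMap.smul_apply, evalDual_one,
      TensorProduct.counit_tmul, counit_toCop]
    simp only [smul_eq_mul]
    ring

theorem heisAct_apply_mul_repr {ι κ : Type*} (x y : H) (φ ψ : RestrictedDual k H)
    (rx : Coalgebra.Repr k x ι) (ry : Coalgebra.Repr k y κ) :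
    heisAct k H (x ⊗ₜ toCop (k := k) y) (φ * ψ) =
      ∑ i ∈ rx.index, ∑ j ∈ ry.index,
        heisAct k H (rx.left i ⊗ₜ toCop (k := k) (ry.right j)) φ *
          heisAct k H (rx.right i ⊗ₜ toCop (k := k) (ry.left j)) ψ := by
  refine dual_ext fun h => ?_
  let rh := Coalgebra.Repr.arbitrary k h
  rw [evalDual_heisAct, evalDual_mul', Bialgebra.comul_mul,
    Bialgebra.comul_mul, comul_antipodeInv, ← rx.eq, ← ry.eq, ← rh.eq]
  simp only [map_sum, LinearMap.sum_apply, evalDual_mul _ _ h rh, evalDual_heisAct]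
  simp only [map_sum, TensorProduct.comm_tmul, TensorProduct.map_tmul,
    Algebra.TensorProduct.tmul_mul_tmul, LinearMap.mul'_apply, Finset.mul_sum, Finset.sum_mul]
  exact Finset.sum_congr rfl fun _ _ => Finset.sum_comm

theorem heisAct_apply_mul (t : H ⊗[k] Cop H) (φ ψ : RestrictedDual k H) :
    heisAct k H t (φ * ψ) = LinearMap.mul' k (RestrictedDual k H)
      (TensorProduct.map₂ (heisAct k H) (heisAct k H) (Coalgebra.comul t) (φ ⊗ₜ ψ)) := by
  induction t with
  | zero => simp only [map_zero, LinearMap.zero_apply]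
  | add a b ha hb => simp only [map_add, LinearMap.add_apply, ha, hb]
  | tmul x y =>
    obtain ⟨y, rfl⟩ := (toCop (k := k) (H := H)).surjective y
    let rx := Coalgebra.Repr.arbitrary k x
    let ry := Coalgebra.Repr.arbitrary k y
    rw [heisAct_apply_mul_repr x y φ ψ rx ry, TensorProduct.comul_tmul, comul_toCop,
      ← rx.eq, ← ry.eq]
    simp only [map_sum, TensorProduct.comm_tmul, TensorProduct.map_tmul,
      TensorProduct.sum_tmul, TensorProduct.tmul_sum,
      TensorProduct.AlgebraTensorModule.tensorTensorTensorComm_tmul,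
      TensorProduct.map₂_apply_tmul, LinearMap.sum_apply, LinearMap.mul'_apply,
      AlgEquiv.toLinearMap_apply]
    rw [Finset.sum_comm]

variable (k H)

/-- `H°` as a left module algebra over `H ⊗ H^cop`. -/
def heisModuleAlgebra : ModuleAlgebra k (H ⊗[k] Cop H) (RestrictedDual k H) where
  act := AlgHom.ofLinearMap (heisAct k H) heisAct_one heisAct_mul
  act_one := heisAct_apply_one
  act_mul := heisAct_apply_mul

/-- The two-sided Heisenberg double `HH(H°) = H° # (H ⊗ H^cop)`. -/
abbrev HeisenbergDouble : Type (max u v) := Smash (heisModuleAlgebra k H)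

end TwoSidedHeisenberg

section Quasitriangular
variable (k : Type u) (H : Type v) [Field k] [Ring H] [HopfAlgebra k H]

/-- `R ↦ R₂₁ = R'` -/
def flip : H ⊗[k] H →ₐ[k] H ⊗[k] H := (Algebra.TensorProduct.comm k H H).toAlgHom

/-- `R ↦ R₁₂` -/
def leg12 : H ⊗[k] H →ₐ[k] (H ⊗[k] H) ⊗[k] H := Algebra.TensorProduct.includeLeft

/-- `R ↦ R₁₃` -/
def leg13 : H ⊗[k] H →ₐ[k] (H ⊗[k] H) ⊗[k] H :=
  Algebra.TensorProduct.map Algebra.TensorProduct.includeLeft (AlgHom.id k H)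

/-- `R ↦ R₂₃` -/
def leg23 : H ⊗[k] H →ₐ[k] (H ⊗[k] H) ⊗[k] H :=
  Algebra.TensorProduct.map Algebra.TensorProduct.includeRight (AlgHom.id k H)

/-- A quasitriangular structure on the Hopf algebra `H`: a universal `R`-matrix. -/
structure Quasitriangular where
  R : (H ⊗[k] H)ˣ
  /-- `R Δ(h) = Δᵒᵖ(h) R` -/
  R_mul_comul : ∀ h : H, (R : H ⊗[k] H) * Coalgebra.comul h =
    flip k H (Coalgebra.comul h) * (R : H ⊗[k] H)
  /-- `(Δ ⊗ id)(R) = R₁₃ R₂₃` -/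
  comul_left : (Coalgebra.comul : H →ₗ[k] H ⊗[k] H).rTensor H (R : H ⊗[k] H) =
    leg13 k H (R : H ⊗[k] H) * leg23 k H (R : H ⊗[k] H)
  /-- `(id ⊗ Δ)(R) = R₁₃ R₁₂` -/
  comul_right : (TensorProduct.assoc k H H H).symm
    ((Coalgebra.comul : H →ₗ[k] H ⊗[k] H).lTensor H (R : H ⊗[k] H)) =
      leg13 k H (R : H ⊗[k] H) * leg12 k H (R : H ⊗[k] H)

/-- The map `x ⊗ y ↦ xᵢ ⊗ yⱼ` placing `H ⊗ H` into the given slots of `(H ⊗ H) ⊗ (H ⊗ H)`;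
here `(i, j) = (1, 3)`. -/
def slot13 : H ⊗[k] H →ₐ[k] (H ⊗[k] H) ⊗[k] (H ⊗[k] H) :=
  Algebra.TensorProduct.map Algebra.TensorProduct.includeLeft Algebra.TensorProduct.includeLeft

/-- `(i, j) = (1, 4)` -/
def slot14 : H ⊗[k] H →ₐ[k] (H ⊗[k] H) ⊗[k] (H ⊗[k] H) :=
  Algebra.TensorProduct.map Algebra.TensorProduct.includeLeft Algebra.TensorProduct.includeRight

/-- `(i, j) = (2, 3)` -/
def slot23 : H ⊗[k] H →ₐ[k] (H ⊗[k] H) ⊗[k] (H ⊗[k] H) :=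
  Algebra.TensorProduct.map Algebra.TensorProduct.includeRight Algebra.TensorProduct.includeLeft

/-- `(i, j) = (2, 4)` -/
def slot24 : H ⊗[k] H →ₐ[k] (H ⊗[k] H) ⊗[k] (H ⊗[k] H) :=
  Algebra.TensorProduct.map Algebra.TensorProduct.includeRight Algebra.TensorProduct.includeRight

namespace Quasitriangular
variable {k H} (Q : Quasitriangular k H)

/-- `R' = ∑ R₍₂₎ ⊗ R₍₁₎` -/
def R' : H ⊗[k] H := flip k H Q.R

/-- The twist `F = R₃₂ R₄₂`. -/
def F : (H ⊗[k] H) ⊗[k] (H ⊗[k] H) := slot23 k H Q.R' * slot24 k H Q.R'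

/-- The bicharacter `γ = R₃₂ R₃₁ R₄₂ R₁₄⁻¹`. -/
def γ : (H ⊗[k] H) ⊗[k] (H ⊗[k] H) :=
  slot23 k H Q.R' * slot13 k H Q.R' * slot24 k H Q.R' *
    slot14 k H ((Q.R⁻¹ : (H ⊗[k] H)ˣ) : H ⊗[k] H)

end Quasitriangular
end Quasitriangular

section GraphAlgebras
variable {k : Type u} {H : Type v} [Field k] [Ring H] [HopfAlgebra k H]

/-- The data of a vector space with a product, a unit and a right action of `H`
(`act h m` is `m · h`), used to carry along the construction of the graph algebras. -/
structure ModuleAlgebraData (k : Type u) (H : Type v) [Field k] [Ring H] [HopfAlgebra k H] where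
  carrier : Type (max u v)
  [addCommGroup : AddCommGroup carrier]
  [module : Module k carrier]
  mul : carrier →ₗ[k] carrier →ₗ[k] carrier
  one : carrier
  act : H →ₗ[k] carrier →ₗ[k] carrier

attribute [instance] ModuleAlgebraData.addCommGroup ModuleAlgebraData.module

/-- The product of the twisted tensor product `M ⊗^χ N`, for `χ = ∑ χ₁ ⊗ χ₂ ∈ B ⊗ A` acting through
right actions of `A` on `M` and `B` on `N`:
`(m ⊗ n) (m' ⊗ n') = ∑ m (m' · χ₂) ⊗ (n · χ₁) n'`. -/
def twistedMul {A B M N : Type*} [AddCommGroup A] [Module k A] [AddCommGroup B] [Module k B]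
    [AddCommGroup M] [Module k M] [AddCommGroup N] [Module k N]
    (mulM : M →ₗ[k] M →ₗ[k] M) (mulN : N →ₗ[k] N →ₗ[k] N)
    (actM : A →ₗ[k] M →ₗ[k] M) (actN : B →ₗ[k] N →ₗ[k] N) :
    B ⊗[k] A →ₗ[k] M ⊗[k] N →ₗ[k] M ⊗[k] N →ₗ[k] M ⊗[k] N :=
  TensorProduct.lift <| LinearMap.mk₂ k
    (fun b a => TensorProduct.map₂ (mulM.compl₂ (actM a)) (mulN ∘ₗ actN b))
    (fun b b' a => by ext; simp [TensorProduct.tmul_add])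
    (fun c b a => by ext; simp)
    (fun b a a' => by ext; simp [TensorProduct.add_tmul])
    (fun c b a => by ext; simp [TensorProduct.smul_tmul'])

/-- The right action of `H` on `M ⊗ N` through the coproduct. -/
def tensorAct {M N : Type*} [AddCommGroup M] [Module k M] [AddCommGroup N] [Module k N]
    (actM : H →ₗ[k] M →ₗ[k] M) (actN : H →ₗ[k] N →ₗ[k] N) :
    H →ₗ[k] M ⊗[k] N →ₗ[k] M ⊗[k] N :=
  TensorProduct.map₂ actM actN ∘ₗ Coalgebra.comul

/-- The right action `φ · (x ⊗ y) = S(y) ▷ φ ◁ x` on `H°`. -/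
def dualAct : H ⊗[k] H →ₗ[k] RestrictedDual k H →ₗ[k] RestrictedDual k H :=
  coreg k H ∘ₗ (TensorProduct.comm k H H).toLinearMap ∘ₗ (HopfAlgebra.antipode k).lTensor H

/-- The right coadjoint action `coadʳ(h)(φ) = ∑ S(h₂) ▷ φ ◁ h₁` on `H°`. -/
def coad : H →ₗ[k] RestrictedDual k H →ₗ[k] RestrictedDual k H :=
  dualAct ∘ₗ Coalgebra.comul

/-- The base field with its trivial action. -/
def trivialData (k : Type u) (H : Type v) [Field k] [Ring H] [HopfAlgebra k H] :
    ModuleAlgebraData k H where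
  carrier := ULift.{v} k
  mul := LinearMap.mul k (ULift.{v} k)
  one := 1
  act := (LinearMap.lsmul k (ULift.{v} k)) ∘ₗ Coalgebra.counit

namespace Quasitriangular
variable (Q : Quasitriangular k H)

/-- The product of `L_{0,1}(H)`: `φ ψ = ∑ (φ · F₁) ⋆ (ψ · F₂)`. -/
def loopMul : RestrictedDual k H →ₗ[k] RestrictedDual k H →ₗ[k] RestrictedDual k H :=
  TensorProduct.curry
    (LinearMap.mul' k (RestrictedDual k H) ∘ₗ TensorProduct.map₂ dualAct dualAct Q.F)

/-- The loop algebra `L_{0,1}(H)`: the vector space `H°` with the product twisted by `F`, the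
unit `ε` and the action `coadʳ`. -/
def L01 : ModuleAlgebraData k H where
  carrier := RestrictedDual k H
  mul := Q.loopMul
  one := 1
  act := coad

/-- The handle algebra `L_{1,0}(H)`: the twisted tensor product of two copies of `L_{0,1}(H)` by
the bicharacter `γ`. -/
def L10 : ModuleAlgebraData k H where
  carrier := RestrictedDual k H ⊗[k] RestrictedDual k H
  mul := twistedMul Q.loopMul Q.loopMul dualAct dualAct Q.γ
  one := 1 ⊗ₜ 1
  act := tensorAct coad coad

/-- The braided tensor product, `(m ⊗ n) (m' ⊗ n') = ∑ m (m' · R₍₁₎) ⊗ (n · R₍₂₎) n'`. -/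
def braided (M N : ModuleAlgebraData k H) : ModuleAlgebraData k H where
  carrier := M.carrier ⊗[k] N.carrier
  mul := twistedMul M.mul N.mul M.act N.act Q.R'
  one := M.one ⊗ₜ N.one
  act := tensorAct M.act N.act

/-- `L_{0,n}(H)`, the braided tensor product of `n` copies of `L_{0,1}(H)`. -/
def L0 : ℕ → ModuleAlgebraData k H
  | 0 => trivialData k H
  | n + 1 => Q.braided Q.L01 (L0 n)

/-- The graph algebra `L_{g,n}(H)`, the braided tensor product of `g` copies of `L_{1,0}(H)` and
`n` copies of `L_{0,1}(H)`. -/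
def L : ℕ → ℕ → ModuleAlgebraData k H
  | 0, n => Q.L0 n
  | g + 1, n => Q.braided Q.L10 (L g n)

/-- The embedding of `L_{0,1}(H)` as the `l`-th factor of `L_{0,n}(H)`. -/
def jLoop₀ : (n : ℕ) → Fin n → Q.L01.carrier →ₗ[k] (Q.L0 n).carrier
  | n + 1, l => Fin.cases
      ((TensorProduct.mk k Q.L01.carrier (Q.L0 n).carrier).flip (Q.L0 n).one)
      (fun l => TensorProduct.mk k Q.L01.carrier (Q.L0 n).carrier Q.L01.one ∘ₗ jLoop₀ n l) l

/-- The embedding `j_{g+l}` of `L_{0,1}(H)` in `L_{g,n}(H)`. -/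
def jLoop : (g n : ℕ) → Fin n → Q.L01.carrier →ₗ[k] (Q.L g n).carrier
  | 0, n, l => Q.jLoop₀ n l
  | g + 1, n, l => TensorProduct.mk k Q.L10.carrier (Q.L g n).carrier Q.L10.one ∘ₗ jLoop g n l

/-- The embedding `j_i` of `L_{1,0}(H)` in `L_{g,n}(H)`, for `1 ≤ i ≤ g`. -/
def jHandle : (g n : ℕ) → Fin g → Q.L10.carrier →ₗ[k] (Q.L g n).carrier
  | g + 1, n, i => Fin.cases
      ((TensorProduct.mk k Q.L10.carrier (Q.L g n).carrier).flip (Q.L g n).one)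
      (fun i => TensorProduct.mk k Q.L10.carrier (Q.L g n).carrier Q.L10.one ∘ₗ jHandle g n i) i

end Quasitriangular
end GraphAlgebras

section Alekseev
variable (k : Type u) (H : Type v) [Field k] [Ring H] [HopfAlgebra k H]

/-- The tensor product algebra `H^{⊗ n}`. -/
def tensorPow : ℕ → AlgCat.{max u v} k
  | 0 => AlgCat.of k (ULift.{v} k)
  | n + 1 => AlgCat.of k (H ⊗[k] tensorPow n)

/-- `D_{0,n}(h) = ∑ h₁ ⊗ ⋯ ⊗ hₙ` -/
def D₀ : (n : ℕ) → H →ₗ[k] tensorPow k H n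
  | 0 => Algebra.linearMap k (ULift.{v} k) ∘ₗ Coalgebra.counit
  | n + 1 => TensorProduct.map LinearMap.id (D₀ n) ∘ₗ Coalgebra.comul

variable [BijectiveAntipode k H]

/-- The tensor product algebra `HH(H°)^{⊗ g} ⊗ H^{⊗ n}`. -/
def Target : ℕ → ℕ → AlgCat.{max u v} k
  | 0, n => tensorPow k H n
  | g + 1, n => AlgCat.of k (HeisenbergDouble k H ⊗[k] Target g n)

/-- `φ # (h ⊗ 1)`, as a map `H° ⊗ H → HH(H°)`. -/
def heisIncl : RestrictedDual k H ⊗[k] H →ₗ[k] HeisenbergDouble k H :=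
  Smash.ofTensor (heisModuleAlgebra k H) ∘ₗ
    ((TensorProduct.mk k H (Cop H)).flip 1).lTensor (RestrictedDual k H)

/-- `h ↦ h = ε # (h ⊗ 1)` -/
def heisLeft : H →ₗ[k] HeisenbergDouble k H :=
  heisIncl k H ∘ₗ TensorProduct.mk k (RestrictedDual k H) H 1

/-- `h ↦ h̃ = ε # (1 ⊗ h)` -/
def heisTilde : H →ₗ[k] HeisenbergDouble k H :=
  Smash.ofTensor (heisModuleAlgebra k H) ∘ₗ
    TensorProduct.mk k (RestrictedDual k H) (H ⊗[k] Cop H) 1 ∘ₗ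
      TensorProduct.mk k H (Cop H) 1 ∘ₗ (toCop (k := k) (H := H)).toLinearMap

/-- `h ↦ ∑ h̃₁ h₂` -/
def heisDiag : H →ₗ[k] HeisenbergDouble k H :=
  LinearMap.mul' k (HeisenbergDouble k H) ∘ₗ
    TensorProduct.map (heisTilde k H) (heisLeft k H) ∘ₗ Coalgebra.comul

/-- `D_{g,n}(h) = ∑ h̃₁ h₂ ⊗ ⋯ ⊗ h̃_{2g-1} h_{2g} ⊗ h_{2g+1} ⊗ ⋯ ⊗ h_{2g+n}` -/
def D : (g n : ℕ) → H →ₗ[k] Target k H g n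
  | 0, n => D₀ k H n
  | g + 1, n => TensorProduct.map (heisDiag k H) (D g n) ∘ₗ Coalgebra.comul

variable {k H}

namespace Quasitriangular
variable (Q : Quasitriangular k H)

/-- `Φ_{0,1}(φ) = (φ ⊗ id)(R R')` -/
def Φ01 : Q.L01.carrier →ₗ[k] H :=
  (TensorProduct.lid k H).toLinearMap ∘ₗ LinearMap.applyₗ ((Q.R : H ⊗[k] H) * Q.R') ∘ₗ
    LinearMap.rTensorHom H ∘ₗ evalDual k H

/-- `Φ_{1,0}(β ⊗ α) = ∑ (R¹₂ R²₂ ▷ β ◁ R³₁ R¹₁) # (R³₂ R²₁ Φ_{0,1}(α))`, where the sum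
`∑ (R¹₂ R²₂ ⊗ R³₁ R¹₁) ⊗ R³₂ R²₁` is `R₂₃ R₂₁ R₃₁`. -/
def Φ10 : Q.L10.carrier →ₗ[k] HeisenbergDouble k H :=
  heisIncl k H ∘ₗ
    TensorProduct.map₂ (coreg k H) ((LinearMap.mul k H).compl₂ Q.Φ01)
      (leg23 k H Q.R * leg12 k H Q.R' * leg13 k H Q.R')

/-- For linear maps `f : M → X` and `D : H → Y`, the map `x ↦ ∑ f(x · R₍₁₎) ⊗ D(R₍₂₎)`. -/
def spread (M : ModuleAlgebraData k H) {X Y : Type*} [AddCommGroup X] [Module k X]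
    [AddCommGroup Y] [Module k Y] (f : M.carrier →ₗ[k] X) (D : H →ₗ[k] Y) :
    M.carrier →ₗ[k] X ⊗[k] Y :=
  TensorProduct.lift (LinearMap.mk₂ k
    (fun a b => (TensorProduct.mk k X Y).flip (D b) ∘ₗ f ∘ₗ M.act a)
    (fun a a' b => by ext; simp)
    (fun c a b => by ext; simp)
    (fun a b b' => by ext; simp)
    (fun c a b => by ext; simp)) (Q.R : H ⊗[k] H)

/-- `φ ↦ ∑ 1^{⊗ (l-1)} ⊗ Φ_{0,1}(coadʳ(R₍₁₎)(φ)) ⊗ D_{0,n-l}(R₍₂₎)` in `H^{⊗ n}`. -/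
def loopImage₀ : (n : ℕ) → Fin n → Q.L01.carrier →ₗ[k] tensorPow k H n
  | n + 1, l => Fin.cases (Q.spread Q.L01 Q.Φ01 (D₀ k H n))
      (fun l => TensorProduct.mk k H (tensorPow k H n) 1 ∘ₗ loopImage₀ n l) l

/-- `φ ↦ ∑ 1^{⊗ g} ⊗ 1^{⊗ (l-1)} ⊗ Φ_{0,1}(coadʳ(R₍₁₎)(φ)) ⊗ D_{0,n-l}(R₍₂₎)` -/
def loopImage : (g n : ℕ) → Fin n → Q.L01.carrier →ₗ[k] Target k H g n
  | 0, n, l => Q.loopImage₀ n l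
  | g + 1, n, l =>
      TensorProduct.mk k (HeisenbergDouble k H) (Target k H g n) 1 ∘ₗ loopImage g n l

/-- `x ↦ ∑ 1^{⊗ (i-1)} ⊗ Φ_{1,0}(coadʳ(R₍₁₎)(x)) ⊗ D_{g-i,n}(R₍₂₎)` -/
def handleImage : (g n : ℕ) → Fin g → Q.L10.carrier →ₗ[k] Target k H g n
  | g + 1, n, i => Fin.cases (Q.spread Q.L10 Q.Φ10 (D k H g n))
      (fun i =>
        TensorProduct.mk k (HeisenbergDouble k H) (Target k H g n) 1 ∘ₗ handleImage g n i) i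

end Quasitriangular
end Alekseev

end GraphAlgebra

end

open scoped TensorProduct
noncomputable section

namespace GraphAlgebra

universe u v

set_option linter.unusedSectionVars false

/-! ### Evaluating `H ⊗ H` in an algebra: convolution and intertwiners -/

section Calculus
variable {k : Type*} {H : Type*} {E : Type*} [Field k] [Ring H] [HopfAlgebra k H] [Ring E]
  [Algebra k E]

/-! Gluing the factors. A multiplicative map alone cannot be extended over a braided tensor product.
What can be extended is a multiplicative unital `f : M → X` together with a map `D : H → X` such
that `f(m) D(h) = ∑ D(h₁) f(m · h₂)` (`IsMomentHom`). Given such `f` along `DX` and such `g : N → Y`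
along an algebra morphism `D`, put `m ⊗ n ↦ ∑ f(m · R₁) ⊗ D(R₂) g(n)` (`extend`). To multiply two
values, `g(n)` has to pass `D(R₂)`; the condition splits `R₂` by the coproduct, and `(id ⊗ Δ)(R) =
R₁₃R₁₂` turns the outcome into a second `R` acting on `m'` and `n`, which is the braiding. The
relation `R Δ = Δᵒᵖ R` shows that the new map satisfies the condition along `(DX ⊗ D) ∘ Δ`
(`extend_isMomentHom`). Since `D_{g,n}` is an iterated coproduct, induction on `n` and `g` leaves
only `Φ_{0,1}` along `id` and `Φ_{1,0}` along `h ↦ ∑ h̃₁ h₂`.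

The building blocks. `H°` is spanned by the forms `a ∘ ρ` with `ρ` a morphism from `H` to a
finite-dimensional algebra `A`, so a linear map `f : H° → X` is determined by its matrices `mat ρ f`
in `A ⊗ X`. The coregular actions become multiplications by values of `ρ`, and `⋆` becomes passage
to tensor products of representations. Write `R₁₂`, `R₂₁` for `R` in the two matrix spaces.
Multiplicativity for the loop product becomes the fusion relation `M₍₁₂₎ R₂₁ = M₁ R₂₁ M₂`, the
product of the handle algebra becomes an exchange relation, and the moment condition says that the
matrix commutes with the convolution of `D` and `ρ` (`Fusion.mat₂_eq`, `Exchange.mat₂_eq`,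
`moment_of_mat`).

The matrix of `Φ_{0,1}` is `R R'`, and that of `β ↦ Φ_{1,0}(β ⊗ 1)` is `R T R'`, where `T` is the
matrix of the inclusion of `H°` in its Heisenberg double (`mat_loopValue`, `mat_handleValue`). The
relations of the double read `T ∑ ρ(h₁) h₂ = h T` and `T h̃ = ∑ h̃₁ ρ(h₂) T`. Everything then takes
place in one algebra `E` receiving pairwise commuting morphisms from `H`, where the required
identities are consequences of the Yang–Baxter equation and of naturality of `R` (`fusion_relation`,
`exchange_relation`, `dressed_intertwines`).

Uniqueness. In a braided tensor product `m ⊗ n = (m ⊗ 1)(1 ⊗ n)`, so the images of the embeddings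
generate (`L_generated`). Associativity of the graph algebras plays no role. -/

/-- `x ⊗ y ↦ f x * g y`. -/
def evMul (f g : H →ₗ[k] E) : H ⊗[k] H →ₗ[k] E := LinearMap.mul' k E ∘ₗ TensorProduct.map f g

@[simp]
theorem evMul_tmul (f g : H →ₗ[k] E) (x y : H) : evMul f g (x ⊗ₜ y) = f x * g y := by
  simp [evMul]

/-- The convolution product `h ↦ ∑ f(h₁) g(h₂)`. -/
def conv (f g : H →ₗ[k] E) : H →ₗ[k] E := evMul f g ∘ₗ Coalgebra.comul

theorem conv_apply (f g : H →ₗ[k] E) (h : H) : conv f g h = evMul f g (Coalgebra.comul h) := rfl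

/-- `conv` unfolds to the product of `WithConv`, whose ring structure supplies associativity and,
below, the unit laws. -/
theorem conv_assoc (f g l : H →ₗ[k] E) : conv (conv f g) l = conv f (conv g l) :=
  congrArg WithConv.ofConv
    (mul_assoc (WithConv.toConv f) (WithConv.toConv g) (WithConv.toConv l))

/-- The linear map `h ↦ ε(h) 1`. -/
def convUnit (k H E : Type*) [Field k] [Ring H] [HopfAlgebra k H] [Ring E] [Algebra k E] :
    H →ₗ[k] E := Algebra.linearMap k E ∘ₗ Coalgebra.counit

theorem convUnit_apply (h : H) :
    convUnit k H E h = algebraMap k E (Coalgebra.counit (R := k) h) := rfl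

theorem convUnit_conv (f : H →ₗ[k] E) : conv (convUnit k H E) f = f :=
  congrArg WithConv.ofConv (one_mul (WithConv.toConv f))

theorem conv_convUnit (f : H →ₗ[k] E) : conv f (convUnit k H E) = f :=
  congrArg WithConv.ofConv (mul_one (WithConv.toConv f))

/-- The images of `f` and `g` commute. -/
def Commuting (f g : H →ₗ[k] E) : Prop := ∀ x y, Commute (f x) (g y)

theorem Commuting.symm {f g : H →ₗ[k] E} (h : Commuting f g) : Commuting g f :=
  fun x y => (h y x).symm

/-- `x f(h) = g(h) x` for all `h`. -/
def Intertwines (x : E) (f g : H →ₗ[k] E) : Prop := ∀ h, x * f h = g h * x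

theorem Intertwines.mul {x y : E} {f g l : H →ₗ[k] E} (hx : Intertwines x g l)
    (hy : Intertwines y f g) : Intertwines (x * y) f l := fun h => by
  rw [mul_assoc, hy h, ← mul_assoc, hx h, mul_assoc]

theorem Intertwines.evMul {x : E} {f f' g g' : H →ₗ[k] E} (hf : Intertwines x f f')
    (hg : Intertwines x g g') (t : H ⊗[k] H) : x * evMul f g t = evMul f' g' t * x := by
  induction t with
  | zero => simp
  | add a b ha hb => simp only [map_add, mul_add, add_mul, ha, hb]
  | tmul a b => rw [evMul_tmul, evMul_tmul, ← mul_assoc, hf a, mul_assoc, hg b, mul_assoc]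

theorem Intertwines.conv {x : E} {f f' g g' : H →ₗ[k] E} (hf : Intertwines x f f')
    (hg : Intertwines x g g') : Intertwines x (conv f g) (conv f' g') :=
  fun h => hf.evMul hg (Coalgebra.comul h)

theorem evMul_comm {f g : H →ₗ[k] E} (h : Commuting f g) (t : H ⊗[k] H) :
    evMul f g (flip k H t) = evMul g f t := by
  induction t with
  | zero => simp
  | add a b ha hb => simp only [map_add, ha, hb]
  | tmul a b =>
    exact (h b a).eq

/-- On commuting algebra morphisms the evaluation is itself an algebra morphism; this is what
transports products in `H ⊗ H` to `E`. -/
theorem evMul_mul (i j : H →ₐ[k] E) (h : Commuting i.toLinearMap j.toLinearMap)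
    (s t : H ⊗[k] H) : evMul i.toLinearMap j.toLinearMap (s * t) =
      evMul i.toLinearMap j.toLinearMap s * evMul i.toLinearMap j.toLinearMap t := by
  have : ∀ t, evMul i.toLinearMap j.toLinearMap t =
      Algebra.TensorProduct.lift i j h t := fun t => by
    induction t with
    | zero => simp
    | add a b ha hb => simp only [map_add, ha, hb]
    | tmul a b => exact (Algebra.TensorProduct.lift_tmul i j h a b).symm
  rw [this, this, this, map_mul]

theorem evMul_one (i j : H →ₐ[k] E) :
    evMul i.toLinearMap j.toLinearMap (1 : H ⊗[k] H) = 1 := by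
  simp [Algebra.TensorProduct.one_def]

theorem evMul_commute {x : E} {f g : H →ₗ[k] E} (hf : ∀ h, Commute x (f h))
    (hg : ∀ h, Commute x (g h)) (t : H ⊗[k] H) : Commute x (evMul f g t) :=
  Intertwines.evMul (x := x) (f := f) (g := g) hf hg t

/-- The convolution product of two commuting algebra morphisms is an algebra morphism. -/
def convHom (i j : H →ₐ[k] E) (h : Commuting i.toLinearMap j.toLinearMap) : H →ₐ[k] E :=
  (Algebra.TensorProduct.lift i j h).comp (Bialgebra.comulAlgHom k H)

theorem convHom_coe (i j : H →ₐ[k] E) (h : Commuting i.toLinearMap j.toLinearMap) :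
    (convHom i j h).toLinearMap = conv i.toLinearMap j.toLinearMap := by
  refine LinearMap.ext fun x => ?_
  change Algebra.TensorProduct.lift i j h (Coalgebra.comul x) = evMul _ _ (Coalgebra.comul x)
  induction (Coalgebra.comul x : H ⊗[k] H) with
  | zero => simp
  | add a b ha hb => simp only [map_add, ha, hb]
  | tmul a b => exact Algebra.TensorProduct.lift_tmul i j h a b

theorem conv_comp {E' : Type*} [Ring E'] [Algebra k E'] (π : E →ₐ[k] E') (f g : H →ₗ[k] E) :
    π.toLinearMap ∘ₗ conv f g = conv (π.toLinearMap ∘ₗ f) (π.toLinearMap ∘ₗ g) := by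
  refine LinearMap.ext fun x => ?_
  simp only [conv_apply, LinearMap.comp_apply]
  induction (Coalgebra.comul x : H ⊗[k] H) with
  | zero => simp
  | add a b ha hb => simp only [map_add, ha, hb]
  | tmul a b => simp

theorem map_evMul {E' : Type*} [Ring E'] [Algebra k E'] (π : E →ₐ[k] E') (f g : H →ₗ[k] E)
    (t : H ⊗[k] H) :
    π (evMul f g t) = evMul (π.toLinearMap ∘ₗ f) (π.toLinearMap ∘ₗ g) t := by
  induction t with
  | zero => simp
  | add a b ha hb => simp only [map_add, ha, hb]
  | tmul a b => simp

theorem antipode_conv (i : H →ₐ[k] E) :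
    conv (i.toLinearMap ∘ₗ HopfAlgebra.antipode k) i.toLinearMap = convUnit k H E := by
  refine LinearMap.ext fun x => ?_
  have h1 := congrArg i (HopfAlgebra.mul_antipode_rTensor_comul_apply (R := k) x)
  rw [conv_apply, convUnit_apply, ← AlgHom.commutes i, ← h1]
  induction (Coalgebra.comul x : H ⊗[k] H) with
  | zero => simp
  | add a b ha hb => simp only [map_add, ha, hb]
  | tmul a b => simp

theorem conv_antipode (i : H →ₐ[k] E) :
    conv i.toLinearMap (i.toLinearMap ∘ₗ HopfAlgebra.antipode k) = convUnit k H E := by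
  refine LinearMap.ext fun x => ?_
  have h1 := congrArg i (HopfAlgebra.mul_antipode_lTensor_comul_apply (R := k) x)
  rw [conv_apply, convUnit_apply, ← AlgHom.commutes i, ← h1]
  induction (Coalgebra.comul x : H ⊗[k] H) with
  | zero => simp
  | add a b ha hb => simp only [map_add, ha, hb]
  | tmul a b => simp

/-! ### Identities of the `R`-matrix, evaluated on linear maps -/

namespace Quasitriangular
variable (Q : Quasitriangular k H)

/-- The value of the `R`-matrix on two linear maps, `∑ f(R₁) g(R₂)`. -/
def r (f g : H →ₗ[k] E) : E := evMul f g (Q.R : H ⊗[k] H)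

/-- The value of the inverse of the `R`-matrix on two linear maps. -/
def rInv (f g : H →ₗ[k] E) : E := evMul f g ((Q.R⁻¹ : (H ⊗[k] H)ˣ) : H ⊗[k] H)

theorem r_mul_rInv (i j : H →ₐ[k] E) (h : Commuting i.toLinearMap j.toLinearMap) :
    Q.r i.toLinearMap j.toLinearMap * Q.rInv i.toLinearMap j.toLinearMap = 1 := by
  rw [r, rInv, ← evMul_mul i j h, Units.mul_inv, evMul_one]

theorem rInv_mul_r (i j : H →ₐ[k] E) (h : Commuting i.toLinearMap j.toLinearMap) :
    Q.rInv i.toLinearMap j.toLinearMap * Q.r i.toLinearMap j.toLinearMap = 1 := by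
  rw [r, rInv, ← evMul_mul i j h, Units.inv_mul, evMul_one]

theorem r_intertwines (i j : H →ₐ[k] E) (h : Commuting i.toLinearMap j.toLinearMap) :
    Intertwines (Q.r i.toLinearMap j.toLinearMap) (conv i.toLinearMap j.toLinearMap)
      (conv j.toLinearMap i.toLinearMap) := fun x => by
  rw [r, conv_apply, conv_apply, ← evMul_mul i j h, Q.R_mul_comul, evMul_mul i j h,
    evMul_comm h]

theorem rInv_intertwines (i j : H →ₐ[k] E) (h : Commuting i.toLinearMap j.toLinearMap) :
    Intertwines (Q.rInv i.toLinearMap j.toLinearMap) (conv j.toLinearMap i.toLinearMap)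
      (conv i.toLinearMap j.toLinearMap) := fun x => by
  have h1 := Q.r_intertwines i j h x
  calc _ = Q.rInv i.toLinearMap j.toLinearMap *
        (conv j.toLinearMap i.toLinearMap x * Q.r i.toLinearMap j.toLinearMap) *
        Q.rInv i.toLinearMap j.toLinearMap := by
        rw [mul_assoc, mul_assoc, Q.r_mul_rInv i j h, mul_one]
    _ = _ := by rw [← h1, ← mul_assoc, Q.rInv_mul_r i j h, one_mul]

/-- This is `(Δ ⊗ id)(R) = R₁₃R₂₃`. Only the second argument needs to be multiplicative; `f` and `g`
stay linear so that the antipode or an orbit map can be inserted later. -/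
theorem r_conv_left (f g : H →ₗ[k] E) (l : H →ₐ[k] E) (h : Commuting g l.toLinearMap) :
    Q.r (conv f g) l.toLinearMap = Q.r f l.toLinearMap * Q.r g l.toLinearMap := by
  let Ψ : (H ⊗[k] H) ⊗[k] H →ₗ[k] E :=
    LinearMap.mul' k E ∘ₗ TensorProduct.map (evMul f g) l.toLinearMap
  have h1 : ∀ t : H ⊗[k] H, Ψ ((Coalgebra.comul : H →ₗ[k] H ⊗[k] H).rTensor H t) =
      evMul (conv f g) l.toLinearMap t := fun t => by
    induction t with
    | zero => simp
    | add a b ha hb => simp only [map_add, ha, hb]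
    | tmul a b => simp [Ψ, conv]
  have h2 : ∀ s t : H ⊗[k] H, Ψ (leg13 k H s * leg23 k H t) =
      evMul f l.toLinearMap s * evMul g l.toLinearMap t := fun s t => by
    induction s with
    | zero => simp
    | add a b ha hb => simp only [map_add, add_mul, ha, hb]
    | tmul a b =>
    induction t with
    | zero => simp
    | add a b ha hb => simp only [map_add, mul_add, ha, hb]
    | tmul c d =>
      have : g c * l b = l b * g c := h c b
      simp only [leg13, leg23, Algebra.TensorProduct.map_tmul,
        Algebra.TensorProduct.includeLeft_apply, Algebra.TensorProduct.includeRight_apply,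
        AlgHom.coe_id, id_eq, Algebra.TensorProduct.tmul_mul_tmul, mul_one, one_mul,
        LinearMap.comp_apply, TensorProduct.map_tmul, evMul_tmul, LinearMap.mul'_apply,
        AlgHom.toLinearMap_apply, map_mul, Ψ]
      rw [mul_assoc, ← mul_assoc (g c), this]
      simp only [mul_assoc]
  rw [r, ← h1, Q.comul_left, h2, r, r]

/-- The relation `(id ⊗ Δ)(R) = R₁₃ R₁₂`, evaluated on a linear map. -/
theorem comul_right_apply (Ψ : (H ⊗[k] H) ⊗[k] H →ₗ[k] E) (F : H ⊗[k] H →ₗ[k] E)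
    (G : H ⊗[k] H →ₗ[k] H ⊗[k] H →ₗ[k] E)
    (hF : ∀ x y : H, F (x ⊗ₜ y) =
      Ψ ((TensorProduct.assoc k H H H).symm (x ⊗ₜ Coalgebra.comul (R := k) y)))
    (hG : ∀ a b c d : H, G (a ⊗ₜ b) (c ⊗ₜ d) = Ψ (((a * c) ⊗ₜ d) ⊗ₜ b)) :
    F (Q.R : H ⊗[k] H) = G (Q.R : H ⊗[k] H) (Q.R : H ⊗[k] H) := by
  have h1 : ∀ t : H ⊗[k] H, Ψ ((TensorProduct.assoc k H H H).symm
      ((Coalgebra.comul : H →ₗ[k] H ⊗[k] H).lTensor H t)) = F t := fun t => by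
    induction t with
    | zero => simp
    | add a b ha hb => simp only [map_add, ha, hb]
    | tmul a b => rw [hF]; rfl
  have h2 : ∀ s t : H ⊗[k] H, Ψ (leg13 k H s * leg12 k H t) = G s t := fun s t => by
    induction s with
    | zero => simp
    | add a b ha hb => simp only [map_add, add_mul, ha, hb, LinearMap.add_apply]
    | tmul a b =>
    induction t with
    | zero => simp
    | add a b ha hb => simp only [map_add, mul_add, ha, hb]
    | tmul c d =>
      rw [hG]
      simp [leg13, leg12]
  rw [← h1, Q.comul_right, h2]

/-- The linear map `a ↦ ∑ u(a R₁) f(R₂)`. -/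
def rLeft (u f : H →ₗ[k] E) : H →ₗ[k] E where
  toFun a := evMul (u ∘ₗ LinearMap.mulLeft k a) f (Q.R : H ⊗[k] H)
  map_add' a b := by
    induction (Q.R : H ⊗[k] H) with
    | zero => simp
    | add x y hx hy => simp only [map_add, hx, hy]; abel
    | tmul x y => simp [add_mul]
  map_smul' c a := by
    induction (Q.R : H ⊗[k] H) with
    | zero => simp
    | add x y hx hy => simp only [map_add, hx, hy, smul_add]
    | tmul x y => simp

theorem rLeft_apply (u f : H →ₗ[k] E) (a : H) :
    Q.rLeft u f a = Q.r (u ∘ₗ LinearMap.mulLeft k a) f := rfl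

theorem rLeft_algHom (l : H →ₐ[k] E) (f : H →ₗ[k] E) (a : H) :
    Q.rLeft l.toLinearMap f a = l a * Q.r l.toLinearMap f := by
  rw [rLeft_apply, r, r]
  induction (Q.R : H ⊗[k] H) with
  | zero => simp
  | add x y hx hy => simp only [map_add, hx, hy, mul_add]
  | tmul x y => simp [mul_assoc]

/-- `∑ u(R₁) f(R₂₁) g(R₂₂) = ∑ u(R₁ R'₁) f(R'₂) g(R₂)`. -/
theorem r_conv_right' (u f g : H →ₗ[k] E) : Q.r u (conv f g) = Q.r (Q.rLeft u f) g := by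
  let Ψ : (H ⊗[k] H) ⊗[k] H →ₗ[k] E := LinearMap.mul' k E ∘ₗ TensorProduct.map (evMul u f) g
  let G : H ⊗[k] H →ₗ[k] H ⊗[k] H →ₗ[k] E := TensorProduct.lift (LinearMap.mk₂ k
      (fun a b => (LinearMap.mulRight k (g b)) ∘ₗ evMul (u ∘ₗ LinearMap.mulLeft k a) f)
      (fun a a' b => by ext; simp [add_mul])
      (fun c a b => by ext; simp)
      (fun a b b' => by ext; simp [mul_add])
      (fun c a b => by ext; simp))
  refine (Q.comul_right_apply Ψ _ G (fun x y => ?_) (fun a b c d => ?_)).trans ?_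
  · rw [evMul_tmul, conv_apply]
    induction (Coalgebra.comul y : H ⊗[k] H) with
    | zero => simp
    | add a b ha hb => simp only [map_add, mul_add, TensorProduct.tmul_add, ha, hb]
    | tmul a b => simp [Ψ, mul_assoc]
  · simp [G, Ψ]
  · have : ∀ s : H ⊗[k] H, G s (Q.R : H ⊗[k] H) = evMul (Q.rLeft u f) g s := fun s => by
      induction s with
      | zero => simp
      | add a b ha hb => simp only [map_add, LinearMap.add_apply, ha, hb]
      | tmul a b => simp [G, rLeft_apply, r]
    exact this _

/-- When the first argument is multiplicative, the product `R₁ R'₁` inside it splits; the factors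
come out in reversed order because `(id ⊗ Δ)(R)` is `R₁₃R₁₂`. -/
theorem r_conv_right (l : H →ₐ[k] E) (f g : H →ₗ[k] E) (hfg : Commuting f g)
    (hgl : Commuting g l.toLinearMap) :
    Q.r l.toLinearMap (conv f g) = Q.r l.toLinearMap g * Q.r l.toLinearMap f := by
  rw [r_conv_right']
  have hc : ∀ b, Commute (g b) (Q.r l.toLinearMap f) := fun b =>
    evMul_commute (fun h => hgl b h) (fun h => (hfg h b).symm) _
  have : ∀ s : H ⊗[k] H, evMul (Q.rLeft l.toLinearMap f) g s =
      evMul l.toLinearMap g s * Q.r l.toLinearMap f := fun s => by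
    induction s with
    | zero => simp
    | add a b ha hb => simp only [map_add, add_mul, ha, hb]
    | tmul a b => simp [rLeft_algHom, mul_assoc, (hc b).eq]
  exact this _

/-- The counit is neutral for convolution, so `r_conv_left` gives `R = ((ε ⊗ id)(R)) R` inside `H ⊗
H`; invertibility of `R` cancels the last factor, and the resulting identity is pushed to `E`. -/
theorem r_convUnit_left (l : H →ₐ[k] E) : Q.r (convUnit k H E) l.toLinearMap = 1 := by
  let i : H →ₐ[k] H ⊗[k] H := Algebra.TensorProduct.includeLeft
  let j : H →ₐ[k] H ⊗[k] H := Algebra.TensorProduct.includeRight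
  have hij : Commuting i.toLinearMap j.toLinearMap := fun x y => by
    simp [Commute, SemiconjBy, i, j]
  have h1 := Q.r_conv_left (convUnit k H (H ⊗[k] H)) i.toLinearMap j hij
  rw [convUnit_conv] at h1
  have h2 := congrArg (· * Q.rInv i.toLinearMap j.toLinearMap) h1
  simp only [mul_assoc, Q.r_mul_rInv i j hij, mul_one] at h2
  have h3 := congrArg (fun t => l (TensorProduct.lid k H
    ((Coalgebra.counit : H →ₗ[k] k).rTensor H t))) h2
  have h4 : ∀ t : H ⊗[k] H, l (TensorProduct.lid k H ((Coalgebra.counit : H →ₗ[k] k).rTensor H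
      (evMul (convUnit k H (H ⊗[k] H)) j.toLinearMap t))) =
      evMul (convUnit k H E) l.toLinearMap t := fun t => by
    induction t with
    | zero => simp
    | add a b ha hb => simp only [map_add, ha, hb]
    | tmul a b =>
      simp [convUnit_apply, j, Algebra.algebraMap_eq_smul_one]
  refine (h4 _).symm.trans (h3.symm.trans ?_)
  simp [Algebra.TensorProduct.one_def]

theorem r_convUnit_right (l : H →ₐ[k] E) : Q.r l.toLinearMap (convUnit k H E) = 1 := by
  let i : H →ₐ[k] H ⊗[k] H := Algebra.TensorProduct.includeLeft
  let j : H →ₐ[k] H ⊗[k] H := Algebra.TensorProduct.includeRight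
  have hij : Commuting i.toLinearMap j.toLinearMap := fun x y => by
    simp [Commute, SemiconjBy, i, j]
  have hu : Commuting (convUnit k H (H ⊗[k] H)) j.toLinearMap := fun x y => by
    rw [convUnit_apply]
    exact Algebra.commute_algebraMap_left _ _
  have h1 := Q.r_conv_right i (convUnit k H (H ⊗[k] H)) j.toLinearMap hu hij.symm
  rw [convUnit_conv] at h1
  have h2 := congrArg (Q.rInv i.toLinearMap j.toLinearMap * ·) h1
  simp only [← mul_assoc, Q.rInv_mul_r i j hij, one_mul] at h2
  have h3 := congrArg (fun t => l (TensorProduct.rid k H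
    ((Coalgebra.counit : H →ₗ[k] k).lTensor H t))) h2
  have h4 : ∀ t : H ⊗[k] H, l (TensorProduct.rid k H ((Coalgebra.counit : H →ₗ[k] k).lTensor H
      (evMul i.toLinearMap (convUnit k H (H ⊗[k] H)) t))) =
      evMul l.toLinearMap (convUnit k H E) t := fun t => by
    induction t with
    | zero => simp
    | add a b ha hb => simp only [map_add, ha, hb]
    | tmul a b =>
      simp [convUnit_apply, i, Algebra.algebraMap_eq_smul_one]
  refine (h4 _).symm.trans (h3.symm.trans ?_)
  simp [Algebra.TensorProduct.one_def]

/-- The Yang–Baxter equation. -/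
theorem yangBaxter (i j l : H →ₐ[k] E) (hij : Commuting i.toLinearMap j.toLinearMap)
    (hil : Commuting i.toLinearMap l.toLinearMap)
    (hjl : Commuting j.toLinearMap l.toLinearMap) :
    Q.r i.toLinearMap j.toLinearMap * Q.r i.toLinearMap l.toLinearMap *
      Q.r j.toLinearMap l.toLinearMap =
    Q.r j.toLinearMap l.toLinearMap * Q.r i.toLinearMap l.toLinearMap *
      Q.r i.toLinearMap j.toLinearMap := by
  have hl : Intertwines (Q.r i.toLinearMap j.toLinearMap) l.toLinearMap
      l.toLinearMap := fun h =>
    (evMul_commute (x := l h) (fun x => (hil x h).symm) (fun x => (hjl x h).symm) _).symm.eq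
  -- Each side is `R_{ij}` times an `R` whose first argument is a convolution of `i` and `j`, in one
  -- order or the other; `R_{ij}` interchanges the two orders and commutes with `l`.
  rw [mul_assoc, ← Q.r_conv_left _ _ _ hjl, ← Q.r_conv_left _ _ _ hil]
  exact (Q.r_intertwines i j hij).evMul hl _

/-- The antipode is convolution inverse to the identity, so `r_conv_left` makes `(S ⊗ id)(R) · R`
equal to `(ε ⊗ id)(R) = 1`. -/
theorem antipode_rTensor_R :
    (HopfAlgebra.antipode k : H →ₗ[k] H).rTensor H (Q.R : H ⊗[k] H) =
      ((Q.R⁻¹ : (H ⊗[k] H)ˣ) : H ⊗[k] H) := by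
  let i : H →ₐ[k] H ⊗[k] H := Algebra.TensorProduct.includeLeft
  let j : H →ₐ[k] H ⊗[k] H := Algebra.TensorProduct.includeRight
  have hij : Commuting i.toLinearMap j.toLinearMap := fun x y => by
    simp [Commute, SemiconjBy, i, j]
  have h1 := Q.r_conv_left (i.toLinearMap ∘ₗ HopfAlgebra.antipode k) i.toLinearMap j hij
  rw [antipode_conv, r_convUnit_left] at h1
  have h2 : ∀ (f : H →ₗ[k] H) (t : H ⊗[k] H),
      evMul (i.toLinearMap ∘ₗ f) j.toLinearMap t = f.rTensor H t := by
    intro f t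
    induction t with
    | zero => simp
    | add a b ha hb => simp only [map_add, ha, hb]
    | tmul a b => simp [i, j]
  have h3 := h2 LinearMap.id
  simp only [LinearMap.comp_id, LinearMap.rTensor_id, LinearMap.id_apply] at h3
  rw [r, r, h2, h3] at h1
  exact Units.eq_inv_of_mul_eq_one_right h1.symm

/-- The algebra morphism `x ↦ 1 ⊗ S(x)` from `H` to `H ⊗ Hᵒᵖ`. -/
def antipodeOp : H →ₐ[k] H ⊗[k] Hᵐᵒᵖ :=
  (Algebra.TensorProduct.includeRight : Hᵐᵒᵖ →ₐ[k] H ⊗[k] Hᵐᵒᵖ).comp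
    (AlgHom.ofLinearMap ((MulOpposite.opLinearEquiv k).toLinearMap ∘ₗ HopfAlgebra.antipode k)
      (by simp) (fun x y => by simp [HopfAlgebra.antipode_mul_antidistrib]))

theorem antipodeOp_apply (x : H) : antipodeOp (k := k) x =
    (1 : H) ⊗ₜ[k] MulOpposite.op (HopfAlgebra.antipode k x) := rfl

/-- The linear map `x ⊗ (y ⊗ z) ↦ x ⊗ y S(z)` from `H ⊗ H ⊗ H` to `H ⊗ Hᵒᵖ`. -/
def contractOp : (H ⊗[k] H) ⊗[k] H →ₗ[k] H ⊗[k] Hᵐᵒᵖ :=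
  ((MulOpposite.opLinearEquiv k).toLinearMap ∘ₗ LinearMap.mul' k H ∘ₗ
    (HopfAlgebra.antipode k).lTensor H).lTensor H ∘ₗ (TensorProduct.assoc k H H H).toLinearMap

theorem contractOp_tmul (x y z : H) : contractOp (k := k) ((x ⊗ₜ y) ⊗ₜ z) =
    x ⊗ₜ[k] MulOpposite.op (y * HopfAlgebra.antipode k z) := rfl

/-- `S` reverses products, hence is multiplicative only into `Hᵐᵒᵖ`. The identity is `(id ⊗ Δ)(R) =
R₁₃R₁₂` contracted by `x ⊗ y ⊗ z ↦ x ⊗ y S(z)`: one side collapses to `(id ⊗ ε)(R) = 1`, the other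
becomes a product in `H ⊗ Hᵐᵒᵖ`. -/
theorem r_antipodeOp_mul :
    Q.r (Algebra.TensorProduct.includeLeft : H →ₐ[k] H ⊗[k] Hᵐᵒᵖ).toLinearMap
        (antipodeOp : H →ₐ[k] H ⊗[k] Hᵐᵒᵖ).toLinearMap *
      (MulOpposite.opLinearEquiv k).toLinearMap.lTensor H (Q.R : H ⊗[k] H) = 1 := by
  let i : H →ₐ[k] H ⊗[k] Hᵐᵒᵖ := Algebra.TensorProduct.includeLeft
  refine Eq.trans ?_ (Q.r_convUnit_right i)
  refine (Q.comul_right_apply contractOp (evMul i.toLinearMap (convUnit k H _))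
      ((LinearMap.mul k (H ⊗[k] Hᵐᵒᵖ)).compl₁₂ (evMul i.toLinearMap antipodeOp.toLinearMap)
        ((MulOpposite.opLinearEquiv k : H ≃ₗ[k] Hᵐᵒᵖ).toLinearMap.lTensor H))
        (fun x y => ?_) (fun a b c d => ?_)).symm
  · have h2 := HopfAlgebra.mul_antipode_lTensor_comul_apply (R := k) y
    have h3 : evMul i.toLinearMap (convUnit k H _) (x ⊗ₜ y) =
        x ⊗ₜ MulOpposite.op (algebraMap k H (Coalgebra.counit (R := k) y)) := by
      rw [evMul_tmul, convUnit_apply]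
      simp [i, Algebra.algebraMap_eq_smul_one]
    rw [h3, ← h2]
    induction (Coalgebra.comul y : H ⊗[k] H) with
    | zero => simp
    | add a b ha hb =>
      simp only [map_add, MulOpposite.op_add, TensorProduct.tmul_add, ha, hb]
    | tmul a b => rw [TensorProduct.assoc_symm_tmul, contractOp_tmul]; rfl
  · rw [contractOp_tmul, LinearMap.compl₁₂_apply, evMul_tmul, LinearMap.lTensor_tmul]
    change (a ⊗ₜ[k] (1 : Hᵐᵒᵖ) * (1 : H) ⊗ₜ[k] MulOpposite.op (HopfAlgebra.antipode k b)) *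
      c ⊗ₜ[k] MulOpposite.op d = _
    rw [Algebra.TensorProduct.tmul_mul_tmul, Algebra.TensorProduct.tmul_mul_tmul, one_mul,
      mul_one, MulOpposite.op_mul]

/-- In `H ⊗ Hᵐᵒᵖ` the image of `R⁻¹` under `id ⊗ S` and `R` itself are both inverse to `(id ⊗
S)(R)`, so they agree. -/
theorem antipode_lTensor_R_inv :
    (HopfAlgebra.antipode k : H →ₗ[k] H).lTensor H ((Q.R⁻¹ : (H ⊗[k] H)ˣ) : H ⊗[k] H) =
      (Q.R : H ⊗[k] H) := by
  let i : H →ₐ[k] H ⊗[k] Hᵐᵒᵖ := Algebra.TensorProduct.includeLeft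
  have hij : Commuting i.toLinearMap (antipodeOp (k := k) (H := H)).toLinearMap := fun x y => by
    simp [Commute, SemiconjBy, i, antipodeOp_apply]
  have h2 : Q.rInv i.toLinearMap antipodeOp.toLinearMap =
      (MulOpposite.opLinearEquiv k).toLinearMap.lTensor H (Q.R : H ⊗[k] H) := by
    rw [← mul_one (Q.rInv _ _), ← Q.r_antipodeOp_mul, ← mul_assoc]
    exact (congrArg (· * _) (Q.rInv_mul_r i antipodeOp hij)).trans (one_mul _)
  have h4 : ∀ t : H ⊗[k] H, evMul i.toLinearMap antipodeOp.toLinearMap t =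
      (MulOpposite.opLinearEquiv k).toLinearMap.lTensor H
        ((HopfAlgebra.antipode k : H →ₗ[k] H).lTensor H t) := fun t => by
    induction t with
    | zero => simp
    | add a b ha hb => simp only [map_add, ha, hb]
    | tmul a b => simp [i, antipodeOp_apply]
  rw [rInv, h4] at h2
  exact (((MulOpposite.opLinearEquiv k).lTensor H :
    H ⊗[k] H ≃ₗ[k] H ⊗[k] Hᵐᵒᵖ).injective h2)

theorem antipode_map_R :
    TensorProduct.map (HopfAlgebra.antipode k : H →ₗ[k] H) (HopfAlgebra.antipode k : H →ₗ[k] H)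
      (Q.R : H ⊗[k] H) = (Q.R : H ⊗[k] H) := by
  rw [← LinearMap.lTensor_comp_rTensor, LinearMap.comp_apply, antipode_rTensor_R,
    antipode_lTensor_R_inv]

end Quasitriangular
end Calculus

/-! ### Contraction of a tensor with linear forms -/

section Slices
variable {k : Type*} [Field k] {A : Type*} [Ring A] [Algebra k A]
  {X : Type*} [Ring X] [Algebra k X]

/-- The contraction of the first tensor factor with a linear form. -/
def slice (X : Type*) [Ring X] [Algebra k X] (a : Module.Dual k A) : A ⊗[k] X →ₗ[k] X :=
  (TensorProduct.lid k X).toLinearMap ∘ₗ a.rTensor X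

@[simp]
theorem slice_tmul (a : Module.Dual k A) (u : A) (x : X) : slice X a (u ⊗ₜ x) = a u • x := by
  simp [slice]

theorem slice_ext [Module.Finite k A] {s t : A ⊗[k] X} (h : ∀ a, slice X a s = slice X a t) :
    s = t := by
  let b := Module.finBasis k A
  have key : ∀ t : A ⊗[k] X, t = ∑ i, b i ⊗ₜ slice X (b.coord i) t := fun t => by
    induction t with
    | zero => simp
    | add x y hx hy =>
      simp only [map_add, TensorProduct.tmul_add, Finset.sum_add_distrib]
      rw [← hx, ← hy]
    | tmul u x =>
      simp only [slice_tmul, TensorProduct.tmul_smul, Module.Basis.coord_apply]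
      simp only [TensorProduct.smul_tmul', ← TensorProduct.sum_tmul, b.sum_repr]
  rw [key s, key t]
  simp only [h]

/-- The linear form `c ↦ a(u c v)`. -/
def sandwich (a : Module.Dual k A) (u v : A) : Module.Dual k A :=
  a ∘ₗ LinearMap.mulLeft k u ∘ₗ LinearMap.mulRight k v

theorem sandwich_apply (a : Module.Dual k A) (u v c : A) : sandwich a u v c = a (u * (c * v)) :=
  rfl

theorem slice_sandwich (a : Module.Dual k A) (u v : A) (t : A ⊗[k] X) :
    slice X a (u ⊗ₜ 1 * t * v ⊗ₜ 1) = slice X (sandwich a u v) t := by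
  induction t with
  | zero => simp
  | add x y hx hy => simp only [mul_add, add_mul, map_add, hx, hy]
  | tmul c x => simp [sandwich_apply, mul_assoc]

theorem slice_one_tmul (a : Module.Dual k A) (x y : X) (t : A ⊗[k] X) :
    slice X a (1 ⊗ₜ x * t * 1 ⊗ₜ y) = x * slice X a t * y := by
  induction t with
  | zero => simp
  | add x y hx hy => simp only [mul_add, add_mul, map_add, hx, hy]
  | tmul c x => simp

theorem slice_assoc {B : Type*} [Ring B] [Algebra k B] (a : Module.Dual k A)
    (b : Module.Dual k B) (t : (A ⊗[k] B) ⊗[k] X) :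
    slice X b (slice (B ⊗[k] X) a (Algebra.TensorProduct.assoc k k k A B X t)) =
      slice X (LinearMap.mul' k k ∘ₗ TensorProduct.map a b) t := by
  induction t with
  | zero => simp
  | add x y hx hy => simp only [map_add, hx, hy]
  | tmul c x =>
  induction c with
  | zero => simp
  | add y z hy hz => simp only [TensorProduct.add_tmul, map_add, hy, hz]
  | tmul c d => simp [mul_smul]

end Slices

/-! ### Linear maps on `H°` as matrices -/

section Matrices
variable {k : Type u} {H : Type v} [Field k] [Ring H] [HopfAlgebra k H]
  {A : Type*} [Ring A] [Algebra k A] [Module.Finite k A]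
  {B : Type*} [Ring B] [Algebra k B] [Module.Finite k B]
  {X : Type*} [Ring X] [Algebra k X]

/-- The element `a ∘ ρ` of `H°`, for a morphism `ρ` from `H` to a finite-dimensional algebra and
a linear form `a` on this algebra. -/
def coeff (ρ : H →ₐ[k] A) : Module.Dual k A →ₗ[k] RestrictedDual k H where
  toFun a := ⟨WithConv.toConv (a ∘ₗ ρ.toLinearMap), by
    -- The representation is the regular one of `A` pulled back along `ρ`, and the vector is `1`.
    have : a ∘ₗ ρ.toLinearMap = matrixCoeff ((Algebra.lmul k A).comp ρ) a 1 := by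
      ext h; simp [matrixCoeff]
    change (WithConv.toConv (a ∘ₗ ρ.toLinearMap)).ofConv ∈ restrictedDualSubmodule k H
    rw [WithConv.ofConv_toConv, this]
    exact matrixCoeff_mem _ _ _⟩
  map_add' _ _ := rfl
  map_smul' _ _ := rfl

theorem evalDual_coeff (ρ : H →ₐ[k] A) (a : Module.Dual k A) (h : H) :
    evalDual k H (coeff ρ a) h = a (ρ h) := rfl

theorem coreg_coeff (ρ : H →ₐ[k] A) (a : Module.Dual k A) (x y : H) :
    coreg k H (x ⊗ₜ y) (coeff ρ a) = coeff ρ (sandwich a (ρ y) (ρ x)) :=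
  dual_ext fun h => by
    rw [evalDual_coreg, evalDual_coeff, evalDual_coeff, sandwich_apply, map_mul ρ, map_mul ρ]

/-- A matrix coefficient `h ↦ f(ρ(h) x)` is `a ∘ ρ` for the form `a(u) = f(u x)` on endomorphisms,
so matrix algebras already give a spanning set. -/
theorem dual_span (p : Submodule k (RestrictedDual k H))
    (hp : ∀ (n : ℕ) (ρ : H →ₐ[k] Module.End k (Fin n → k)) (a : Module.Dual k _), coeff ρ a ∈ p)
    (φ : RestrictedDual k H) : φ ∈ p := by
  have h : restrictedDualSubmodule k H ≤ p.map (evalDual k H) := by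
    refine Submodule.span_le.2 ?_
    rintro _ ⟨n, ρ, f, x, rfl⟩
    exact ⟨coeff ρ (f ∘ₗ LinearMap.applyₗ x), hp n ρ _, rfl⟩
  obtain ⟨ψ, hψ, h2⟩ := h (show evalDual k H φ ∈ _ from φ.2)
  rwa [← dual_ext fun x => LinearMap.congr_fun h2 x]

/-- The matrix in `A ⊗ X` of a linear map `f : H° → X`. -/
def mat (ρ : H →ₐ[k] A) : (RestrictedDual k H →ₗ[k] X) →ₗ[k] A ⊗[k] X :=
  ∑ i, TensorProduct.mk k A X (Module.finBasis k A i) ∘ₗ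
    LinearMap.applyₗ (coeff ρ ((Module.finBasis k A).coord i))

theorem mat_apply (ρ : H →ₐ[k] A) (f : RestrictedDual k H →ₗ[k] X) : mat ρ f =
    ∑ i, Module.finBasis k A i ⊗ₜ[k] f (coeff ρ ((Module.finBasis k A).coord i)) := by
  simp [mat]

/-- Together with `slice_ext` this characterizes the matrix without reference to the basis, and
matrix identities are checked by slicing. -/
theorem slice_mat (ρ : H →ₐ[k] A) (f : RestrictedDual k H →ₗ[k] X) (a : Module.Dual k A) :
    slice X a (mat ρ f) = f (coeff ρ a) := by
  rw [mat_apply, map_sum]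
  simp only [slice_tmul, ← map_smul, ← map_sum]
  congr 2
  refine (Module.finBasis k A).ext fun j => ?_
  simp

theorem mat_comp {Y : Type*} [Ring Y] [Algebra k Y] (ρ : H →ₐ[k] A) (π : X →ₐ[k] Y)
    (f : RestrictedDual k H →ₗ[k] X) : mat ρ (π.toLinearMap ∘ₗ f) =
      Algebra.TensorProduct.map (AlgHom.id k A) π (mat ρ f) := by
  simp [mat_apply]

/-- Since `(x ▷ φ ◁ y)(h) = φ(y h x)`, the argument `y` multiplies the matrix on the left and `x` on
the right. -/
theorem mat_coreg (ρ : H →ₐ[k] A) (f : RestrictedDual k H →ₗ[k] X) (x y : H) :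
    mat ρ (f ∘ₗ coreg k H (x ⊗ₜ y)) = ρ y ⊗ₜ 1 * mat ρ f * ρ x ⊗ₜ 1 :=
  slice_ext fun a => by
    rw [slice_mat, slice_sandwich, slice_mat, LinearMap.comp_apply, coreg_coeff]

theorem ext_of_mat {f g : RestrictedDual k H →ₗ[k] X}
    (h : ∀ (n : ℕ) (ρ : H →ₐ[k] Module.End k (Fin n → k)), mat ρ f = mat ρ g) : f = g := by
  refine LinearMap.ext fun φ => dual_span (LinearMap.eqLocus f g) (fun n ρ a => ?_) φ
  change f _ = g _
  rw [← slice_mat, ← slice_mat, h]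

/-- The matrix in `A ⊗ (B ⊗ X)` of a linear map `H° ⊗ H° → X`. -/
def mat₂ (ρ : H →ₐ[k] A) (σ : H →ₐ[k] B)
    (G : RestrictedDual k H ⊗[k] RestrictedDual k H →ₗ[k] X) : A ⊗[k] (B ⊗[k] X) :=
  mat ρ (mat σ ∘ₗ TensorProduct.curry G)

theorem slice_mat₂ (ρ : H →ₐ[k] A) (σ : H →ₐ[k] B)
    (G : RestrictedDual k H ⊗[k] RestrictedDual k H →ₗ[k] X) (a : Module.Dual k A)
    (b : Module.Dual k B) :
    slice X b (slice (B ⊗[k] X) a (mat₂ ρ σ G)) = G (coeff ρ a ⊗ₜ coeff σ b) := by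
  rw [mat₂, slice_mat, LinearMap.comp_apply, slice_mat, TensorProduct.curry_apply]

theorem slice_ext₂ {s t : A ⊗[k] (B ⊗[k] X)}
    (h : ∀ a b, slice X b (slice (B ⊗[k] X) a s) = slice X b (slice (B ⊗[k] X) a t)) : s = t :=
  slice_ext fun a => slice_ext fun b => h a b

theorem ext_of_mat₂ {f g : RestrictedDual k H ⊗[k] RestrictedDual k H →ₗ[k] X}
    (h : ∀ (n m : ℕ) (ρ : H →ₐ[k] Module.End k (Fin n → k))
      (σ : H →ₐ[k] Module.End k (Fin m → k)), mat₂ ρ σ f = mat₂ ρ σ g) : f = g := by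
  refine TensorProduct.ext (LinearMap.ext fun φ => ?_)
  refine dual_span (LinearMap.eqLocus ((TensorProduct.mk k _ _).compr₂ f)
    ((TensorProduct.mk k _ _).compr₂ g)) (fun n ρ a => ?_) φ
  change _ = _
  refine LinearMap.ext fun ψ => ?_
  refine dual_span (LinearMap.eqLocus ((TensorProduct.mk k _ _).compr₂ f (coeff ρ a))
    ((TensorProduct.mk k _ _).compr₂ g (coeff ρ a))) (fun m σ b => ?_) ψ
  change f (coeff ρ a ⊗ₜ coeff σ b) = g (coeff ρ a ⊗ₜ coeff σ b)
  rw [← slice_mat₂, ← slice_mat₂, h]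

variable (A B X) in
/-- The embedding of `A ⊗ X` in `A ⊗ (B ⊗ X)`. -/
def skipMiddle : A ⊗[k] X →ₐ[k] A ⊗[k] (B ⊗[k] X) :=
  Algebra.TensorProduct.map (AlgHom.id k A) Algebra.TensorProduct.includeRight

variable (A B X) in
/-- The embedding of `B ⊗ X` in `A ⊗ (B ⊗ X)`. -/
def skipFirst : B ⊗[k] X →ₐ[k] A ⊗[k] (B ⊗[k] X) := Algebra.TensorProduct.includeRight

theorem mat₂_mul (ρ : H →ₐ[k] A) (σ : H →ₐ[k] B) (f g : RestrictedDual k H →ₗ[k] X) :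
    mat₂ ρ σ (LinearMap.mul' k X ∘ₗ TensorProduct.map f g) =
      skipMiddle A B X (mat ρ f) * skipFirst A B X (mat σ g) := by
  simp only [mat₂, mat_apply, skipMiddle, skipFirst, map_sum, Algebra.TensorProduct.map_tmul,
    Algebra.TensorProduct.includeRight_apply, AlgHom.id_apply, LinearMap.comp_apply,
    TensorProduct.tmul_sum, Finset.sum_mul_sum, Algebra.TensorProduct.tmul_mul_tmul,
    TensorProduct.curry_apply, TensorProduct.map_tmul, LinearMap.mul'_apply, one_mul, mul_one]

/-- The two matrices sit in different matrix spaces, so the order of the factors records only the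
order of multiplication in `X`. -/
theorem mat₂_mul_comm (ρ : H →ₐ[k] A) (σ : H →ₐ[k] B) (f g : RestrictedDual k H →ₗ[k] X) :
    mat₂ ρ σ (LinearMap.mul' k X ∘ₗ TensorProduct.map g f ∘ₗ
      (TensorProduct.comm k _ _).toLinearMap) =
      skipFirst A B X (mat σ g) * skipMiddle A B X (mat ρ f) := by
  rw [mat_apply ρ f, mat_apply σ g]
  simp only [mat₂, mat_apply, skipMiddle, skipFirst, map_sum, Algebra.TensorProduct.map_tmul,
    Algebra.TensorProduct.includeRight_apply, AlgHom.id_apply, LinearMap.comp_apply,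
    TensorProduct.tmul_sum, Finset.sum_mul_sum, Algebra.TensorProduct.tmul_mul_tmul,
    TensorProduct.curry_apply, LinearEquiv.coe_coe, TensorProduct.comm_tmul,
    TensorProduct.map_tmul, LinearMap.mul'_apply, one_mul, mul_one]
  exact Finset.sum_comm

variable (B X) in
/-- `H` acting through the first tensor factor of `A ⊗ (B ⊗ X)`. -/
def inFirst (ρ : H →ₐ[k] A) : H →ₐ[k] A ⊗[k] (B ⊗[k] X) :=
  (Algebra.TensorProduct.includeLeft : A →ₐ[k] A ⊗[k] (B ⊗[k] X)).comp ρ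

variable (A X) in
/-- `H` acting through the second tensor factor of `A ⊗ (B ⊗ X)`. -/
def inSecond (σ : H →ₐ[k] B) : H →ₐ[k] A ⊗[k] (B ⊗[k] X) :=
  (skipFirst A B X).comp ((Algebra.TensorProduct.includeLeft : B →ₐ[k] B ⊗[k] X).comp σ)

theorem inFirst_apply (ρ : H →ₐ[k] A) (h : H) : inFirst B X ρ h = ρ h ⊗ₜ 1 := rfl

theorem inSecond_apply (σ : H →ₐ[k] B) (h : H) : inSecond A X σ h = 1 ⊗ₜ (σ h ⊗ₜ 1) := rfl

theorem commuting_inFirst_inSecond (ρ : H →ₐ[k] A) (σ : H →ₐ[k] B) :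
    Commuting (inFirst B X ρ).toLinearMap (inSecond A X σ).toLinearMap := fun x y => by
  simp [Commute, SemiconjBy, inFirst_apply, inSecond_apply]

theorem inFirst_commute_skipFirst (ρ : H →ₐ[k] A) (t : B ⊗[k] X) (h : H) :
    Commute (skipFirst A B X t) (inFirst B X ρ h) := by
  simp [Commute, SemiconjBy, inFirst_apply, skipFirst]

theorem inSecond_commute_skipMiddle (σ : H →ₐ[k] B) (t : A ⊗[k] X) (h : H) :
    Commute (skipMiddle A B X t) (inSecond A X σ h) := by
  induction t with
  | zero => simp
  | add x y hx hy => rw [map_add]; exact hx.add_left hy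
  | tmul c x => simp [Commute, SemiconjBy, inSecond_apply, skipMiddle]

/-- The convolution of two morphisms to finite-dimensional algebras, with values in the tensor
product. -/
def tensorRep (ρ : H →ₐ[k] A) (σ : H →ₐ[k] B) : H →ₐ[k] A ⊗[k] B :=
  (Algebra.TensorProduct.map ρ σ).comp (Bialgebra.comulAlgHom k H)

theorem coeff_tensorRep (ρ : H →ₐ[k] A) (σ : H →ₐ[k] B) (a : Module.Dual k A)
    (b : Module.Dual k B) :
    coeff (tensorRep ρ σ) (LinearMap.mul' k k ∘ₗ TensorProduct.map a b) =
      coeff ρ a * coeff σ b := dual_ext fun h => by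
  rw [evalDual_coeff, evalDual_mul']
  simp only [tensorRep, AlgHom.comp_apply, LinearMap.comp_apply, Bialgebra.comulAlgHom_apply]
  congr 1
  induction (Coalgebra.comul h : H ⊗[k] H) with
  | zero => simp
  | add x y hx hy => simp only [map_add, hx, hy]
  | tmul x y => simp [evalDual_coeff]

/-- The product `⋆` of coefficients of `ρ` and `σ` is a coefficient of their tensor product. Its
target is `A ⊗ B`, which is why matrices are allowed in arbitrary finite-dimensional algebras. -/
theorem mat₂_comp_mul (ρ : H →ₐ[k] A) (σ : H →ₐ[k] B) (f : RestrictedDual k H →ₗ[k] X) :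
    mat₂ ρ σ (f ∘ₗ LinearMap.mul' k (RestrictedDual k H)) =
      Algebra.TensorProduct.assoc k k k A B X (mat (tensorRep ρ σ) f) := by
  refine slice_ext₂ fun a b => ?_
  rw [slice_mat₂, slice_assoc, slice_mat, coeff_tensorRep, LinearMap.comp_apply,
    LinearMap.mul'_apply]

theorem assoc_comp_tensorRep (ρ : H →ₐ[k] A) (σ : H →ₐ[k] B) (h : H) :
    Algebra.TensorProduct.assoc k k k A B X (tensorRep ρ σ h ⊗ₜ 1) =
      conv (inFirst B X ρ).toLinearMap (inSecond A X σ).toLinearMap h := by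
  rw [conv_apply, tensorRep, AlgHom.comp_apply, Bialgebra.comulAlgHom_apply]
  induction (Coalgebra.comul h : H ⊗[k] H) with
  | zero => simp
  | add x y hx hy => simp only [map_add, TensorProduct.add_tmul, hx, hy]
  | tmul x y => simp [inFirst_apply, inSecond_apply, Algebra.TensorProduct.one_def]

end Matrices

/-! ### Left and right multiplications as morphisms from `H` -/

section Operators
variable {k : Type*} {H : Type*} {E : Type*} [Field k] [Ring H] [HopfAlgebra k H] [Ring E]
  [Algebra k E]

/-- Left multiplication by `i(x)`. -/
def leftHom (i : H →ₐ[k] E) : H →ₐ[k] Module.End k E := (Algebra.lmul k E).comp i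

/-- Right multiplication by `i(S(x))`. -/
def rightHom (i : H →ₐ[k] E) : H →ₐ[k] Module.End k E :=
  AlgHom.ofLinearMap ((LinearMap.mul k E).flip ∘ₗ i.toLinearMap ∘ₗ HopfAlgebra.antipode k)
    (by ext; simp) (fun x y => by
      ext; simp [HopfAlgebra.antipode_mul_antidistrib, mul_assoc])

theorem leftHom_apply (i : H →ₐ[k] E) (h : H) (x : E) : leftHom i h x = i h * x := rfl

theorem rightHom_apply (i : H →ₐ[k] E) (h : H) (x : E) :
    rightHom i h x = x * i (HopfAlgebra.antipode k h) := rfl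

theorem commuting_leftHom_rightHom (i j : H →ₐ[k] E) :
    Commuting (leftHom i).toLinearMap (rightHom j).toLinearMap := fun x y => by
  ext
  simp [leftHom_apply, rightHom_apply, mul_assoc]

theorem commuting_leftHom {i j : H →ₐ[k] E} (h : Commuting i.toLinearMap j.toLinearMap) :
    Commuting (leftHom i).toLinearMap (leftHom j).toLinearMap := fun x y => by
  ext z
  have : i x * j y = j y * i x := h x y
  simp only [AlgHom.toLinearMap_apply, Module.End.mul_apply, leftHom_apply, ← mul_assoc, this]

theorem commuting_rightHom {i j : H →ₐ[k] E} (h : Commuting i.toLinearMap j.toLinearMap) :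
    Commuting (rightHom i).toLinearMap (rightHom j).toLinearMap := fun x y => by
  ext z
  have : i (HopfAlgebra.antipode k x) * j (HopfAlgebra.antipode k y) =
    j (HopfAlgebra.antipode k y) * i (HopfAlgebra.antipode k x) := h _ _
  simp only [AlgHom.toLinearMap_apply, Module.End.mul_apply, rightHom_apply, mul_assoc, this]

namespace Quasitriangular
variable (Q : Quasitriangular k H)

theorem r_leftHom (i j : H →ₐ[k] E) (x : E) :
    Q.r (leftHom i).toLinearMap (leftHom j).toLinearMap x =
      Q.r i.toLinearMap j.toLinearMap * x := by
  rw [r, r]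
  induction (Q.R : H ⊗[k] H) with
  | zero => simp
  | add a b ha hb => simp only [map_add, LinearMap.add_apply, add_mul, ha, hb]
  | tmul a b => simp [leftHom_apply, mul_assoc]

/-- The two antipodes contained in `rightHom` disappear because `(S ⊗ S)(R) = R`. -/
theorem r_rightHom (i j : H →ₐ[k] E) (h : Commuting i.toLinearMap j.toLinearMap) (x : E) :
    Q.r (rightHom i).toLinearMap (rightHom j).toLinearMap x =
      x * Q.r i.toLinearMap j.toLinearMap := by
  conv_rhs => rw [r, ← Q.antipode_map_R]
  rw [r]
  induction (Q.R : H ⊗[k] H) with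
  | zero => simp
  | add a b ha hb => simp only [map_add, LinearMap.add_apply, mul_add, ha, hb]
  | tmul a b =>
    have : i (HopfAlgebra.antipode k a) * j (HopfAlgebra.antipode k b) =
      j (HopfAlgebra.antipode k b) * i (HopfAlgebra.antipode k a) := h _ _
    simp [rightHom_apply, mul_assoc, this]

/-- The operator sends `x y` to `i(a) x y j(S(b))`, summed over `R⁻¹ = a ⊗ b`. The commutation
hypotheses bring both factors to the middle, where `(id ⊗ S)(R⁻¹) = R` applies: the operator inserts
an `R` between `x` and `y`. -/
theorem rInv_leftHom_rightHom (i j : H →ₐ[k] E) {x y : E} (hx : ∀ h, Commute x (i h))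
    (hy : ∀ h, Commute y (j h)) :
    Q.rInv (leftHom i).toLinearMap (rightHom j).toLinearMap (x * y) =
      x * Q.r i.toLinearMap j.toLinearMap * y := by
  rw [r, ← Q.antipode_lTensor_R_inv, rInv]
  induction ((Q.R⁻¹ : (H ⊗[k] H)ˣ) : H ⊗[k] H) with
  | zero => simp
  | add a b ha hb => simp only [map_add, LinearMap.add_apply, mul_add, add_mul, ha, hb]
  | tmul a b =>
    simp only [evMul_tmul, AlgHom.toLinearMap_apply, Module.End.mul_apply, rightHom_apply,
      leftHom_apply, LinearMap.lTensor_tmul, mul_assoc, (hy _).eq]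
    rw [← mul_assoc, ← (hx a).eq, mul_assoc]

theorem r_leftHom_rightHom (i j : H →ₐ[k] E) {x y : E} (hx : ∀ h, Commute x (i h))
    (hy : ∀ h, Commute y (j h)) :
    Q.r (leftHom i).toLinearMap (rightHom j).toLinearMap
      (x * Q.r i.toLinearMap j.toLinearMap * y) = x * y := by
  rw [← Q.rInv_leftHom_rightHom i j hx hy, ← Module.End.mul_apply,
    Q.r_mul_rInv _ _ (commuting_leftHom_rightHom i j), Module.End.one_apply]

end Quasitriangular

/-- The morphism `x ⊗ y ↦ i(x) j(y)`. -/
def pairHom {S T : Type*} [Ring S] [Algebra k S] [Ring T] [Algebra k T] (i : S →ₐ[k] E)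
    (j : T →ₐ[k] E) (h : ∀ x y, Commute (i x) (j y)) : S ⊗[k] T →ₐ[k] E :=
  Algebra.TensorProduct.lift i j h

theorem pairHom_tmul {S T : Type*} [Ring S] [Algebra k S] [Ring T] [Algebra k T] (i : S →ₐ[k] E)
    (j : T →ₐ[k] E) (h : ∀ x y, Commute (i x) (j y)) (x : S) (y : T) :
    pairHom i j h (x ⊗ₜ y) = i x * j y := Algebra.TensorProduct.lift_tmul i j h x y

/-- The action of `H ⊗ H` on `E` by `x ⊗ y ↦ i(x) · i(S(y))`. -/
def twoSidedHom (i : H →ₐ[k] E) : H ⊗[k] H →ₐ[k] Module.End k E :=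
  pairHom (leftHom i) (rightHom i) (commuting_leftHom_rightHom i i)

theorem twoSidedHom_tmul (i : H →ₐ[k] E) (x y : H) :
    twoSidedHom i (x ⊗ₜ y) = leftHom i x * rightHom i y := pairHom_tmul _ _ _ _ _

theorem commute_twoSidedHom (i j : H →ₐ[k] E) (h : Commuting i.toLinearMap j.toLinearMap)
    (s t : H ⊗[k] H) : Commute (twoSidedHom i s) (twoSidedHom j t) := by
  induction s with
  | zero => simp
  | add a b ha hb => rw [map_add]; exact ha.add_left hb
  | tmul a b =>
  induction t with
  | zero => simp
  | add a b ha hb => rw [map_add]; exact ha.add_right hb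
  | tmul c d =>
    rw [twoSidedHom_tmul, twoSidedHom_tmul]
    refine Commute.mul_left (Commute.mul_right ?_ ?_) (Commute.mul_right ?_ ?_)
    · exact commuting_leftHom h _ _
    · exact commuting_leftHom_rightHom _ _ _ _
    · exact (commuting_leftHom_rightHom _ _ _ _).symm
    · exact commuting_rightHom h _ _

/-- The action of `(H ⊗ H) ⊗ (H ⊗ H)` on `E` by
`(x ⊗ y) ⊗ (z ⊗ t) ↦ i(x) j(z) · i(S(y)) j(S(t))`. -/
def slotHom (i j : H →ₐ[k] E) (h : Commuting i.toLinearMap j.toLinearMap) :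
    (H ⊗[k] H) ⊗[k] (H ⊗[k] H) →ₐ[k] Module.End k E :=
  pairHom (twoSidedHom i) (twoSidedHom j) (commute_twoSidedHom i j h)

theorem slotHom_tmul (i j : H →ₐ[k] E) (h : Commuting i.toLinearMap j.toLinearMap)
    (x y z t : H) : slotHom i j h ((x ⊗ₜ y) ⊗ₜ (z ⊗ₜ t)) =
      leftHom i x * rightHom i y * (leftHom j z * rightHom j t) := by
  rw [slotHom, pairHom_tmul, twoSidedHom_tmul, twoSidedHom_tmul]

section Slots
variable (i j : H →ₐ[k] E) (h : Commuting i.toLinearMap j.toLinearMap) (t : H ⊗[k] H)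

theorem slotHom_slot13 : slotHom i j h (slot13 k H t) =
    evMul (leftHom i).toLinearMap (leftHom j).toLinearMap t := by
  induction t with
  | zero => simp
  | add a b ha hb => simp only [map_add, ha, hb]
  | tmul a b => simp [slot13, slotHom_tmul]

theorem slotHom_slot14 : slotHom i j h (slot14 k H t) =
    evMul (leftHom i).toLinearMap (rightHom j).toLinearMap t := by
  induction t with
  | zero => simp
  | add a b ha hb => simp only [map_add, ha, hb]
  | tmul a b => simp [slot14, slotHom_tmul]

theorem slotHom_slot23 : slotHom i j h (slot23 k H t) =
    evMul (rightHom i).toLinearMap (leftHom j).toLinearMap t := by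
  induction t with
  | zero => simp
  | add a b ha hb => simp only [map_add, ha, hb]
  | tmul a b => simp [slot23, slotHom_tmul]

theorem slotHom_slot24 : slotHom i j h (slot24 k H t) =
    evMul (rightHom i).toLinearMap (rightHom j).toLinearMap t := by
  induction t with
  | zero => simp
  | add a b ha hb => simp only [map_add, ha, hb]
  | tmul a b => simp [slot24, slotHom_tmul]

end Slots

/-- Slots `1, 3` act by left and slots `2, 4` by right multiplication, the first pair through `i`,
the second through `j`. Thus `R₃₂` and `R₄₂` become values of `R` on these operators. -/
theorem slotHom_F (Q : Quasitriangular k H) (i j : H →ₐ[k] E)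
    (h : Commuting i.toLinearMap j.toLinearMap) :
    slotHom i j h Q.F = Q.r (leftHom j).toLinearMap (rightHom i).toLinearMap *
      Q.r (rightHom j).toLinearMap (rightHom i).toLinearMap := by
  rw [Quasitriangular.F, map_mul, slotHom_slot23, slotHom_slot24, Quasitriangular.R',
    evMul_comm (commuting_leftHom_rightHom _ _).symm, evMul_comm (commuting_rightHom h)]
  rfl

theorem slotHom_γ (Q : Quasitriangular k H) (i j : H →ₐ[k] E)
    (h : Commuting i.toLinearMap j.toLinearMap) :
    slotHom i j h Q.γ = Q.r (leftHom j).toLinearMap (rightHom i).toLinearMap *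
      Q.r (leftHom j).toLinearMap (leftHom i).toLinearMap *
      Q.r (rightHom j).toLinearMap (rightHom i).toLinearMap *
      Q.rInv (leftHom i).toLinearMap (rightHom j).toLinearMap := by
  rw [Quasitriangular.γ, map_mul, map_mul, map_mul, slotHom_slot23, slotHom_slot24,
    slotHom_slot13, slotHom_slot14, Quasitriangular.R',
    evMul_comm (commuting_leftHom_rightHom _ _).symm, evMul_comm (commuting_rightHom h),
    evMul_comm (commuting_leftHom h)]
  rfl

end Operators

/-! ### Twisting elements acting on matrices -/

section Twists
variable {k : Type u} {H : Type v} [Field k] [Ring H] [HopfAlgebra k H]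
  {A : Type*} [Ring A] [Algebra k A] [Module.Finite k A]
  {B : Type*} [Ring B] [Algebra k B] [Module.Finite k B]
  {X : Type*} [Ring X] [Algebra k X]

theorem dualAct_tmul (x y : H) :
    dualAct (x ⊗ₜ y) = coreg k H (HopfAlgebra.antipode k y ⊗ₜ x) := rfl

theorem mat_dualAct (ρ : H →ₐ[k] A) (f : RestrictedDual k H →ₗ[k] X) (t : H ⊗[k] H) :
    mat ρ (f ∘ₗ dualAct t) =
      evMul (leftHom ((Algebra.TensorProduct.includeLeft : A →ₐ[k] A ⊗[k] X).comp ρ)).toLinearMap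
        (rightHom ((Algebra.TensorProduct.includeLeft : A →ₐ[k] A ⊗[k] X).comp ρ)).toLinearMap t
        (mat ρ f) := by
  induction t with
  | zero => simp
  | add a b ha hb => simp only [map_add, LinearMap.comp_add, LinearMap.add_apply, ha, hb]
  | tmul x y => simp [dualAct_tmul, mat_coreg, leftHom_apply, rightHom_apply, mul_assoc]

/-- The action `φ · (x ⊗ y)` multiplies the matrix by `ρ(x)` on the left and `ρ(S(y))` on the right,
so precomposition with a twist is the operator `slotHom`. -/
theorem mat₂_dualAct (ρ : H →ₐ[k] A) (σ : H →ₐ[k] B)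
    (G : RestrictedDual k H ⊗[k] RestrictedDual k H →ₗ[k] X)
    (τ : (H ⊗[k] H) ⊗[k] (H ⊗[k] H)) :
    mat₂ ρ σ (G ∘ₗ TensorProduct.map₂ dualAct dualAct τ) =
      slotHom (inFirst B X ρ) (inSecond A X σ) (commuting_inFirst_inSecond ρ σ) τ
        (mat₂ ρ σ G) := by
  have hadd : ∀ G G' : RestrictedDual k H ⊗[k] RestrictedDual k H →ₗ[k] X,
      mat₂ ρ σ (G + G') = mat₂ ρ σ G + mat₂ ρ σ G' := fun G G' => slice_ext₂ fun a b => by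
    simp only [map_add, slice_mat₂, LinearMap.add_apply]
  have hzero : mat₂ ρ σ (0 : RestrictedDual k H ⊗[k] RestrictedDual k H →ₗ[k] X) = 0 :=
    slice_ext₂ fun a b => by simp [slice_mat₂]
  induction τ with
  | zero => simp [hzero]
  | add a b ha hb => simp only [map_add, LinearMap.comp_add, LinearMap.add_apply, hadd, ha, hb]
  | tmul s t =>
  induction s with
  | zero => simp [hzero]
  | add a b ha hb =>
    simp only [TensorProduct.add_tmul, map_add, LinearMap.comp_add, LinearMap.add_apply, hadd,
      ha, hb]
  | tmul x y =>
  induction t with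
  | zero => simp [hzero]
  | add a b ha hb =>
    simp only [TensorProduct.tmul_add, map_add, LinearMap.comp_add, LinearMap.add_apply, hadd,
      ha, hb]
  | tmul z t =>
    refine slice_ext₂ fun a b => ?_
    rw [slice_mat₂, slotHom_tmul]
    simp only [Module.End.mul_apply, leftHom_apply, rightHom_apply, inFirst_apply,
      inSecond_apply]
    rw [← mul_assoc, slice_sandwich, ← mul_assoc, slice_one_tmul, slice_sandwich, slice_mat₂,
      LinearMap.comp_apply, TensorProduct.map₂_apply_tmul, TensorProduct.map_tmul,
      dualAct_tmul, dualAct_tmul, coreg_coeff, coreg_coeff]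

end Twists

/-! ### Twisted tensor products of module algebras -/

section ModuleAlgebras
variable {k : Type u} {H : Type v} [Field k] [Ring H] [HopfAlgebra k H]

/-- The axioms of a unital right `H`-module algebra, without associativity. -/
structure IsModuleAlgebra (M : ModuleAlgebraData k H) : Prop where
  one_mul : ∀ x, M.mul M.one x = x
  mul_one : ∀ x, M.mul x M.one = x
  act_one : M.act 1 = LinearMap.id
  act_mul : ∀ a b, M.act (a * b) = M.act b ∘ₗ M.act a
  act_unit : ∀ h, M.act h M.one = Coalgebra.counit (R := k) h • M.one
  act_product : ∀ h x y, M.act h (M.mul x y) =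
    TensorProduct.lift M.mul (tensorAct M.act M.act h (x ⊗ₜ y))

variable {A B : Type*} [Ring A] [Algebra k A] [Ring B] [Algebra k B]

/-- The twisted tensor product of two right module algebras. -/
def twistedData (M N : ModuleAlgebraData k H) (actM : A →ₗ[k] M.carrier →ₗ[k] M.carrier)
    (actN : B →ₗ[k] N.carrier →ₗ[k] N.carrier) (χ : B ⊗[k] A) : ModuleAlgebraData k H where
  carrier := M.carrier ⊗[k] N.carrier
  mul := twistedMul M.mul N.mul actM actN χ
  one := M.one ⊗ₜ N.one
  act := tensorAct M.act N.act

section Slots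
variable (M N : ModuleAlgebraData k H) {K : Type*} [AddCommGroup K] [Module k K]

/-- The opposite of the algebra of endomorphisms of `(M ⊗ M) ⊗ (N ⊗ N)`. -/
def SlotEnd : Type _ :=
  (Module.End k ((M.carrier ⊗[k] M.carrier) ⊗[k] (N.carrier ⊗[k] N.carrier)))ᵐᵒᵖ

instance : Ring (SlotEnd M N) := inferInstanceAs (Ring
  (Module.End k ((M.carrier ⊗[k] M.carrier) ⊗[k] (N.carrier ⊗[k] N.carrier)))ᵐᵒᵖ)

instance : Algebra k (SlotEnd M N) := inferInstanceAs (Algebra k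
  (Module.End k ((M.carrier ⊗[k] M.carrier) ⊗[k] (N.carrier ⊗[k] N.carrier)))ᵐᵒᵖ)

/-- Endomorphisms, as elements of the opposite algebra. -/
def toSlotEnd : Module.End k ((M.carrier ⊗[k] M.carrier) ⊗[k] (N.carrier ⊗[k] N.carrier)) →ₗ[k]
    SlotEnd M N where
  toFun := MulOpposite.op
  map_add' _ _ := rfl
  map_smul' _ _ := rfl

variable {M N} in
/-- Elements of the opposite algebra, as endomorphisms. -/
def ofSlotEnd : SlotEnd M N →ₗ[k]
    Module.End k ((M.carrier ⊗[k] M.carrier) ⊗[k] (N.carrier ⊗[k] N.carrier)) where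
  toFun := MulOpposite.unop
  map_add' _ _ := rfl
  map_smul' _ _ := rfl

variable {M N} in
theorem slotEnd_ext {x y : SlotEnd M N} (h : ofSlotEnd x = ofSlotEnd y) : x = y :=
  MulOpposite.unop_injective h

@[simp]
theorem ofSlotEnd_toSlotEnd
    (f : Module.End k ((M.carrier ⊗[k] M.carrier) ⊗[k] (N.carrier ⊗[k] N.carrier))) :
    ofSlotEnd (toSlotEnd M N f) = f := rfl

@[simp]
theorem ofSlotEnd_mul (x y : SlotEnd M N) : ofSlotEnd (x * y) = ofSlotEnd y ∘ₗ ofSlotEnd x := rfl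

/-- An action on the first tensor factor of `(M ⊗ M) ⊗ (N ⊗ N)`. -/
def actSlot₁ (f : K →ₗ[k] Module.End k M.carrier) : K →ₗ[k] SlotEnd M N :=
  toSlotEnd M N ∘ₗ LinearMap.rTensorHom _ ∘ₗ
    LinearMap.rTensorHom M.carrier ∘ₗ f

/-- An action on the second tensor factor of `(M ⊗ M) ⊗ (N ⊗ N)`. -/
def actSlot₂ (f : K →ₗ[k] Module.End k M.carrier) : K →ₗ[k] SlotEnd M N :=
  toSlotEnd M N ∘ₗ LinearMap.rTensorHom _ ∘ₗ
    LinearMap.lTensorHom M.carrier ∘ₗ f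

/-- An action on the third tensor factor of `(M ⊗ M) ⊗ (N ⊗ N)`. -/
def actSlot₃ (f : K →ₗ[k] Module.End k N.carrier) : K →ₗ[k] SlotEnd M N :=
  toSlotEnd M N ∘ₗ LinearMap.lTensorHom _ ∘ₗ
    LinearMap.rTensorHom N.carrier ∘ₗ f

/-- An action on the fourth tensor factor of `(M ⊗ M) ⊗ (N ⊗ N)`. -/
def actSlot₄ (f : K →ₗ[k] Module.End k N.carrier) : K →ₗ[k] SlotEnd M N :=
  toSlotEnd M N ∘ₗ LinearMap.lTensorHom _ ∘ₗ
    LinearMap.lTensorHom N.carrier ∘ₗ f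

/-- The action of `B ⊗ A` on the third and second tensor factors of `(M ⊗ M) ⊗ (N ⊗ N)`. -/
def actMiddle (actM : A →ₗ[k] Module.End k M.carrier) (actN : B →ₗ[k] Module.End k N.carrier) :
    B ⊗[k] A →ₗ[k] SlotEnd M N :=
  LinearMap.mul' k (SlotEnd M N) ∘ₗ TensorProduct.map (actSlot₃ M N actN) (actSlot₂ M N actM)

/-- The products of `M` and of `N`, as a linear map on `(M ⊗ M) ⊗ (N ⊗ N)`. -/
def mulPair : (M.carrier ⊗[k] M.carrier) ⊗[k] (N.carrier ⊗[k] N.carrier) →ₗ[k]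
    M.carrier ⊗[k] N.carrier :=
  TensorProduct.map (TensorProduct.lift M.mul) (TensorProduct.lift N.mul)

variable (actM : A →ₗ[k] Module.End k M.carrier) (actN : B →ₗ[k] Module.End k N.carrier)

/-- The twisted product factors as the shuffle to `(M ⊗ M) ⊗ (N ⊗ N)`, the action of `χ` on the two
middle factors, and the untwisted products. Equivariance then only concerns the middle step. -/
theorem lift_twistedMul (χ : B ⊗[k] A)
    (z : (M.carrier ⊗[k] N.carrier) ⊗[k] (M.carrier ⊗[k] N.carrier)) :
    TensorProduct.lift (twistedMul M.mul N.mul actM actN χ) z =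
      mulPair M N (ofSlotEnd (actMiddle M N actM actN χ)
        (TensorProduct.tensorTensorTensorComm k _ _ _ _ z)) := by
  have : TensorProduct.lift (twistedMul M.mul N.mul actM actN χ) =
      mulPair M N ∘ₗ ofSlotEnd (actMiddle M N actM actN χ) ∘ₗ
        (TensorProduct.tensorTensorTensorComm k _ _ _ _).toLinearMap := by
    refine TensorProduct.ext_fourfold' fun m n m' n' => ?_
    induction χ with
    | zero => simp
    | add a b ha hb =>
      simp only [map_add, LinearMap.add_apply, LinearMap.comp_add,
        LinearMap.add_comp, TensorProduct.lift.tmul] at ha hb ⊢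
      rw [ha, hb]
    | tmul b a =>
      simp [twistedMul, actMiddle, actSlot₂, actSlot₃, mulPair]
  exact LinearMap.congr_fun this z

theorem actMiddle_mul (hM : ∀ a b, actM (a * b) = actM b ∘ₗ actM a)
    (hN : ∀ a b, actN (a * b) = actN b ∘ₗ actN a) (s t : B ⊗[k] A) :
    actMiddle M N actM actN (s * t) = actMiddle M N actM actN s * actMiddle M N actM actN t := by
  induction s with
  | zero => simp
  | add a b ha hb => simp only [map_add, add_mul, ha, hb]
  | tmul a b =>
  induction t with
  | zero => simp
  | add a b ha hb => simp only [map_add, mul_add, ha, hb]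
  | tmul c d =>
    refine slotEnd_ext ?_
    refine TensorProduct.ext_fourfold' fun m n m' n' => ?_
    simp [actMiddle, actSlot₂, actSlot₃, hM, hN]

variable (f : H →ₗ[k] Module.End k M.carrier) (g : H →ₗ[k] Module.End k N.carrier)

theorem commuting_actSlot₂_actSlot₃ : Commuting (actSlot₂ M N f) (actSlot₃ M N g) :=
  fun x y => slotEnd_ext <| TensorProduct.ext_fourfold' fun m n m' n' => by
    simp [actSlot₂, actSlot₃]

theorem actMiddle_intertwines₁ (χ : B ⊗[k] A) :
    Intertwines (actMiddle M N actM actN χ) (actSlot₁ M N f) (actSlot₁ M N f) := fun h => by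
  induction χ with
  | zero => simp
  | add a b ha hb => simp only [map_add, add_mul, mul_add, ha, hb]
  | tmul b a =>
    refine slotEnd_ext <| TensorProduct.ext_fourfold' fun m n m' n' => ?_
    simp [actMiddle, actSlot₁, actSlot₂, actSlot₃]

theorem actMiddle_intertwines₄ (χ : B ⊗[k] A) :
    Intertwines (actMiddle M N actM actN χ) (actSlot₄ M N g) (actSlot₄ M N g) := fun h => by
  induction χ with
  | zero => simp
  | add a b ha hb => simp only [map_add, add_mul, mul_add, ha, hb]
  | tmul b a =>
    refine slotEnd_ext <| TensorProduct.ext_fourfold' fun m n m' n' => ?_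
    simp [actMiddle, actSlot₄, actSlot₂, actSlot₃]

theorem actMiddle_map (dA : H →ₐ[k] A) (dB : H →ₐ[k] B) (t : H ⊗[k] H) :
    actMiddle M N actM actN (TensorProduct.map dB.toLinearMap dA.toLinearMap t) =
      evMul (actSlot₃ M N (actN ∘ₗ dB.toLinearMap)) (actSlot₂ M N (actM ∘ₗ dA.toLinearMap)) t := by
  induction t with
  | zero => simp
  | add a b ha hb => simp only [map_add, ha, hb]
  | tmul a b => rfl

/-- Acting just before the untwisted products distributes the legs of the iterated coproduct over
the slots in the order `1, 2, 3, 4`. -/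
theorem tensorAct_tensorAct_left (h : H) :
    TensorProduct.map₂ (tensorAct f f) (tensorAct g g) (Coalgebra.comul h) =
      ofSlotEnd (conv (conv (actSlot₁ M N f) (actSlot₂ M N f))
        (conv (actSlot₃ M N g) (actSlot₄ M N g)) h) := by
  rw [conv_apply]
  induction (Coalgebra.comul h : H ⊗[k] H) with
  | zero => simp
  | add a b ha hb => simp only [map_add, ha, hb]
  | tmul x y =>
  rw [TensorProduct.map₂_apply_tmul, evMul_tmul, conv_apply, conv_apply, tensorAct, tensorAct,
    LinearMap.comp_apply, LinearMap.comp_apply]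
  induction (Coalgebra.comul x : H ⊗[k] H) with
  | zero => simp
  | add a b ha hb =>
    simp only [map_add, add_mul, TensorProduct.map_add_left, ha, hb]
  | tmul a b =>
  induction (Coalgebra.comul y : H ⊗[k] H) with
  | zero => simp
  | add a b ha hb =>
    simp only [map_add, mul_add, TensorProduct.map_add_right, ha, hb]
  | tmul c d =>
    refine TensorProduct.ext_fourfold' fun m n m' n' => ?_
    simp [actSlot₁, actSlot₂, actSlot₃, actSlot₄]

/-- Acting before the shuffle distributes the legs in the order `1, 3, 2, 4`, because the shuffle
exchanges the two middle factors. -/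
theorem tensorAct_tensorAct_right (h : H)
    (z : (M.carrier ⊗[k] N.carrier) ⊗[k] (M.carrier ⊗[k] N.carrier)) :
    TensorProduct.tensorTensorTensorComm k _ _ _ _ (tensorAct (tensorAct f g) (tensorAct f g) h z) =
      ofSlotEnd (conv (conv (actSlot₁ M N f) (actSlot₃ M N g))
        (conv (actSlot₂ M N f) (actSlot₄ M N g)) h)
          (TensorProduct.tensorTensorTensorComm k _ _ _ _ z) := by
  rw [conv_apply, tensorAct, LinearMap.comp_apply]
  induction (Coalgebra.comul h : H ⊗[k] H) with
  | zero => simp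
  | add a b ha hb => simp only [map_add, LinearMap.add_apply, ha, hb]
  | tmul x y =>
  rw [TensorProduct.map₂_apply_tmul, evMul_tmul, conv_apply, conv_apply, tensorAct,
    LinearMap.comp_apply, LinearMap.comp_apply]
  induction (Coalgebra.comul x : H ⊗[k] H) with
  | zero => simp
  | add a b ha hb =>
    simp only [map_add, add_mul, TensorProduct.map_add_left,
      LinearMap.add_apply, ha, hb]
  | tmul a b =>
  induction (Coalgebra.comul y : H ⊗[k] H) with
  | zero => simp
  | add a b ha hb =>
    simp only [map_add, mul_add, TensorProduct.map_add_right,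
      LinearMap.add_apply, ha, hb]
  | tmul c d =>
    refine LinearMap.congr_fun (f := (TensorProduct.tensorTensorTensorComm k _ _ _ _).toLinearMap ∘ₗ
      TensorProduct.map (TensorProduct.map₂ f g (a ⊗ₜ b)) (TensorProduct.map₂ f g (c ⊗ₜ d)))
      (g := ofSlotEnd (evMul (actSlot₁ M N f) (actSlot₃ M N g) (a ⊗ₜ b) *
        evMul (actSlot₂ M N f) (actSlot₄ M N g) (c ⊗ₜ d)) ∘ₗ
        (TensorProduct.tensorTensorTensorComm k _ _ _ _).toLinearMap) ?_ z
    refine TensorProduct.ext_fourfold' fun m n m' n' => ?_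
    simp [actSlot₁, actSlot₂, actSlot₃, actSlot₄]

/-- Equivariance of the two untwisted products, which are module algebras by hypothesis. -/
theorem act_mulPair (hM : IsModuleAlgebra M) (hN : IsModuleAlgebra N) (t : H ⊗[k] H)
    (z : (M.carrier ⊗[k] M.carrier) ⊗[k] (N.carrier ⊗[k] N.carrier)) :
    TensorProduct.map₂ M.act N.act t (mulPair M N z) = mulPair M N
      (TensorProduct.map₂ (tensorAct M.act M.act) (tensorAct N.act N.act) t z) := by
  induction t with
  | zero => simp
  | add a b ha hb => simp only [map_add, LinearMap.add_apply, ha, hb]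
  | tmul x y =>
    refine LinearMap.congr_fun (f := TensorProduct.map₂ M.act N.act (x ⊗ₜ y) ∘ₗ mulPair M N)
      (g := mulPair M N ∘ₗ TensorProduct.map₂ (tensorAct M.act M.act) (tensorAct N.act N.act)
        (x ⊗ₜ y)) ?_ z
    refine TensorProduct.ext_fourfold' fun m n m' n' => ?_
    simp [mulPair, hM.act_product, hN.act_product]

theorem tensorAct_one {M N : Type*} [AddCommGroup M] [Module k M] [AddCommGroup N] [Module k N]
    {f : H →ₗ[k] M →ₗ[k] M} {g : H →ₗ[k] N →ₗ[k] N} (hf : f 1 = LinearMap.id)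
    (hg : g 1 = LinearMap.id) : tensorAct f g 1 = LinearMap.id := by
  rw [tensorAct, LinearMap.comp_apply, Bialgebra.comul_one, Algebra.TensorProduct.one_def,
    TensorProduct.map₂_apply_tmul, hf, hg, TensorProduct.map_id]

theorem map₂_mul {M N : Type*} [AddCommGroup M] [Module k M] [AddCommGroup N] [Module k N]
    {f : A →ₗ[k] M →ₗ[k] M} {g : B →ₗ[k] N →ₗ[k] N} (hf : ∀ a b, f (a * b) = f b ∘ₗ f a)
    (hg : ∀ a b, g (a * b) = g b ∘ₗ g a) (s t : A ⊗[k] B) : TensorProduct.map₂ f g (s * t) =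
      TensorProduct.map₂ f g t ∘ₗ TensorProduct.map₂ f g s := by
  induction s with
  | zero => simp
  | add a b ha hb => simp only [map_add, add_mul, LinearMap.comp_add, ha, hb]
  | tmul a b =>
  induction t with
  | zero => simp
  | add a b ha hb => simp only [map_add, mul_add, LinearMap.add_comp, ha, hb]
  | tmul c d => simp [hf, hg, TensorProduct.map_comp]

theorem tensorAct_mul {M N : Type*} [AddCommGroup M] [Module k M] [AddCommGroup N] [Module k N]
    {f : H →ₗ[k] M →ₗ[k] M} {g : H →ₗ[k] N →ₗ[k] N} (hf : ∀ a b, f (a * b) = f b ∘ₗ f a)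
    (hg : ∀ a b, g (a * b) = g b ∘ₗ g a) (a b : H) :
    tensorAct f g (a * b) = tensorAct f g b ∘ₗ tensorAct f g a := by
  rw [tensorAct, LinearMap.comp_apply, Bialgebra.comul_mul, map₂_mul hf hg]
  rfl

theorem map₂_act_unit {M N : Type*} [AddCommGroup M] [Module k M] [AddCommGroup N] [Module k N]
    {f : H →ₗ[k] M →ₗ[k] M} {g : H →ₗ[k] N →ₗ[k] N} {m : M} {n : N}
    (hf : ∀ h, f h m = Coalgebra.counit (R := k) h • m)
    (hg : ∀ h, g h n = Coalgebra.counit (R := k) h • n) (h : H) :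
    tensorAct f g h (m ⊗ₜ n) = Coalgebra.counit (R := k) h • (m ⊗ₜ[k] n) := by
  have h1 : ∀ t : H ⊗[k] H, TensorProduct.map₂ f g t (m ⊗ₜ n) =
      (Coalgebra.counit (R := k) (TensorProduct.lid k H
        ((Coalgebra.counit : H →ₗ[k] k).rTensor H t))) • (m ⊗ₜ[k] n) := fun t => by
    induction t with
    | zero => simp
    | add a b ha hb => simp only [map_add, LinearMap.add_apply, add_smul, ha, hb]
    | tmul a b =>
      rw [TensorProduct.map₂_apply_tmul, TensorProduct.map_tmul, hf, hg,
        TensorProduct.smul_tmul_smul]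
      simp
  rw [tensorAct, LinearMap.comp_apply, h1, Coalgebra.rTensor_counit_comul,
    TensorProduct.lid_tmul, one_smul]

section Counits
variable (εA : A →ₐ[k] k) (εB : B →ₐ[k] k)

theorem map₂_act_unit_left {P Q : Type*} [AddCommGroup P] [Module k P] [AddCommGroup Q]
    [Module k Q] {f : B →ₗ[k] P →ₗ[k] P} {g : A →ₗ[k] Q →ₗ[k] Q} {p : P}
    (hf : ∀ b, f b p = εB b • p) (χ : B ⊗[k] A) (q : Q) : TensorProduct.map₂ f g χ (p ⊗ₜ q) =
      p ⊗ₜ g (TensorProduct.lid k A (εB.toLinearMap.rTensor A χ)) q := by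
  induction χ with
  | zero => simp
  | add a b ha hb =>
    simp only [map_add, LinearMap.add_apply, TensorProduct.tmul_add, ha, hb]
  | tmul b a => simp [hf, TensorProduct.smul_tmul]

theorem map₂_act_unit_right {P Q : Type*} [AddCommGroup P] [Module k P] [AddCommGroup Q]
    [Module k Q] {f : B →ₗ[k] P →ₗ[k] P} {g : A →ₗ[k] Q →ₗ[k] Q} {q : Q}
    (hg : ∀ a, g a q = εA a • q) (χ : B ⊗[k] A) (p : P) : TensorProduct.map₂ f g χ (p ⊗ₜ q) =
      f (TensorProduct.rid k B (εA.toLinearMap.lTensor B χ)) p ⊗ₜ q := by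
  induction χ with
  | zero => simp
  | add a b ha hb =>
    simp only [map_add, LinearMap.add_apply, TensorProduct.add_tmul, ha, hb]
  | tmul b a => simp [hg, TensorProduct.smul_tmul]

end Counits

theorem twistedMul_apply {M N : Type*} [AddCommGroup M] [Module k M] [AddCommGroup N] [Module k N]
    {A B : Type*} [AddCommGroup A] [Module k A] [AddCommGroup B] [Module k B]
    (mulM : M →ₗ[k] M →ₗ[k] M) (mulN : N →ₗ[k] N →ₗ[k] N)
    (actM : A →ₗ[k] M →ₗ[k] M) (actN : B →ₗ[k] N →ₗ[k] N) (χ : B ⊗[k] A) (m m' : M) (n n' : N) :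
    twistedMul mulM mulN actM actN χ (m ⊗ₜ n) (m' ⊗ₜ n') =
      TensorProduct.map (mulM m) (mulN.flip n') (TensorProduct.comm k _ _
        (TensorProduct.map₂ actN actM χ (n ⊗ₜ m'))) := by
  induction χ with
  | zero => simp
  | add a b ha hb => simp only [map_add, LinearMap.add_apply, ha, hb]
  | tmul b a => simp [twistedMul]

/-- Common source for the braided product (`χ = R'`) and for the handle algebra (`χ = γ`). The
counit conditions on `χ` give the unit laws; `hχ`, saying that `χ` carries `Δᵒᵖ` to `Δ`, is exactly
what reorders the two middle slots. -/
theorem twistedData_isModuleAlgebra {M N : ModuleAlgebraData k H} (hM : IsModuleAlgebra M)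
    (hN : IsModuleAlgebra N) {actM : A →ₗ[k] Module.End k M.carrier}
    {actN : B →ₗ[k] Module.End k N.carrier} (χ : B ⊗[k] A) (dA : H →ₐ[k] A) (dB : H →ₐ[k] B)
    (εA : A →ₐ[k] k) (εB : B →ₐ[k] k)
    (hM_one : actM 1 = LinearMap.id) (hN_one : actN 1 = LinearMap.id)
    (hM_mul : ∀ a b, actM (a * b) = actM b ∘ₗ actM a)
    (hN_mul : ∀ a b, actN (a * b) = actN b ∘ₗ actN a)
    (hM_unit : ∀ a, actM a M.one = εA a • M.one) (hN_unit : ∀ a, actN a N.one = εB a • N.one)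
    (hM_act : M.act = actM ∘ₗ dA.toLinearMap) (hN_act : N.act = actN ∘ₗ dB.toLinearMap)
    (hχA : TensorProduct.rid k B (εA.toLinearMap.lTensor B χ) = 1)
    (hχB : TensorProduct.lid k A (εB.toLinearMap.rTensor A χ) = 1)
    (hχ : ∀ h, χ * TensorProduct.map dB.toLinearMap dA.toLinearMap
        (flip k H (Coalgebra.comul h)) =
      TensorProduct.map dB.toLinearMap dA.toLinearMap (Coalgebra.comul h) * χ) :
    IsModuleAlgebra (twistedData M N actM actN χ) where
  one_mul z := by
    change twistedMul M.mul N.mul actM actN χ (M.one ⊗ₜ N.one) z = z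
    induction z using TensorProduct.induction_on with
    | zero => simp
    | add a b ha hb => simp only [map_add, ha, hb]
    | tmul m n =>
      rw [twistedMul_apply, map₂_act_unit_left εB hN_unit, hχB, hM_one]
      simp [hM.one_mul, hN.one_mul]
  mul_one z := by
    change twistedMul M.mul N.mul actM actN χ z (M.one ⊗ₜ N.one) = z
    induction z using TensorProduct.induction_on with
    | zero => simp
    | add a b ha hb => simp only [map_add, LinearMap.add_apply, ha, hb]
    | tmul m n =>
      rw [twistedMul_apply, map₂_act_unit_right εA hM_unit, hχA, hN_one]
      simp [hM.mul_one, hN.mul_one]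
  act_one := tensorAct_one hM.act_one hN.act_one
  act_mul := tensorAct_mul hM.act_mul hN.act_mul
  act_unit := map₂_act_unit hM.act_unit hN.act_unit
  act_product h x y := by
    let s₁ := actSlot₁ M N M.act
    let s₂ := actSlot₂ M N M.act
    let s₃ := actSlot₃ M N N.act
    let s₄ := actSlot₄ M N N.act
    let X := actMiddle M N actM actN χ
    have h₁ : Intertwines X s₁ s₁ := actMiddle_intertwines₁ M N actM actN _ χ
    have h₄ : Intertwines X s₄ s₄ := actMiddle_intertwines₄ M N actM actN _ χ
    -- `actMiddle` is multiplicative because `SlotEnd` is an opposite algebra and the actions are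
    -- right actions; so `hχ` can be read inside `SlotEnd`.
    have h₂₃ : Intertwines X (conv s₂ s₃) (conv s₃ s₂) := fun h => by
      have h0 := congrArg (actMiddle M N actM actN) (hχ h)
      rw [actMiddle_mul M N _ _ hM_mul hN_mul, actMiddle_mul M N _ _ hM_mul hN_mul,
        actMiddle_map, actMiddle_map, ← hM_act, ← hN_act,
        evMul_comm (commuting_actSlot₂_actSlot₃ M N _ _).symm] at h0
      exact h0
    -- By associativity of convolution, both orders have `s₁` and `s₄` at the ends and differ only
    -- in the middle pair.
    have key : Intertwines X (conv (conv s₁ s₂) (conv s₃ s₄)) (conv (conv s₁ s₃) (conv s₂ s₄)) := by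
      have := h₁.conv (h₂₃.conv h₄)
      simpa only [conv_assoc] using this
    have h5 := congrArg (fun e => mulPair M N (ofSlotEnd e
      (TensorProduct.tensorTensorTensorComm k _ _ _ _ (x ⊗ₜ y)))) (key h)
    simp only [ofSlotEnd_mul, LinearMap.comp_apply] at h5
    change TensorProduct.map₂ M.act N.act (Coalgebra.comul h)
      (TensorProduct.lift (twistedMul M.mul N.mul actM actN χ) (x ⊗ₜ y)) =
      TensorProduct.lift (twistedMul M.mul N.mul actM actN χ)
        (tensorAct (tensorAct M.act N.act) (tensorAct M.act N.act) h (x ⊗ₜ y))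
    rw [lift_twistedMul, lift_twistedMul, act_mulPair M N hM hN, tensorAct_tensorAct_left,
      tensorAct_tensorAct_right]
    exact h5

end Slots

end ModuleAlgebras

/-! ### The actions of `H ⊗ H` and of `H` on `H°` -/

section LoopAlgebra
variable {k : Type u} {H : Type v} [Field k] [Ring H] [HopfAlgebra k H]

theorem dualAct_one : dualAct (1 : H ⊗[k] H) = LinearMap.id := by
  refine LinearMap.ext fun φ => dual_ext fun h => ?_
  rw [Algebra.TensorProduct.one_def, dualAct_tmul, evalDual_coreg]
  simp

theorem dualAct_mul (s t : H ⊗[k] H) : dualAct (s * t) = dualAct t ∘ₗ dualAct s := by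
  induction s with
  | zero => simp
  | add a b ha hb => simp only [map_add, add_mul, LinearMap.comp_add, ha, hb]
  | tmul a b =>
  induction t with
  | zero => simp
  | add a b ha hb => simp only [map_add, mul_add, LinearMap.add_comp, ha, hb]
  | tmul c d =>
    refine LinearMap.ext fun φ => dual_ext fun h => ?_
    rw [Algebra.TensorProduct.tmul_mul_tmul, LinearMap.comp_apply]
    simp only [dualAct_tmul, evalDual_coreg, HopfAlgebra.antipode_mul_antidistrib, mul_assoc]

theorem dualAct_unit (t : H ⊗[k] H) : dualAct t (1 : RestrictedDual k H) =
    Bialgebra.counitAlgHom k (H ⊗[k] H) t • (1 : RestrictedDual k H) := by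
  induction t with
  | zero => simp
  | add a b ha hb => simp only [map_add, LinearMap.add_apply, add_smul, ha, hb]
  | tmul a b =>
    refine dual_ext fun h => ?_
    rw [dualAct_tmul, evalDual_coreg, map_smul, LinearMap.smul_apply, evalDual_one, evalDual_one]
    simp only [Bialgebra.counit_mul, HopfAlgebra.counit_antipode, Bialgebra.counitAlgHom_apply,
      TensorProduct.counit_tmul, smul_eq_mul]
    ring

theorem coad_eq : coad (k := k) (H := H) =
    dualAct ∘ₗ (Bialgebra.comulAlgHom k H).toLinearMap := rfl

theorem coad_one : coad (1 : H) = (LinearMap.id : RestrictedDual k H →ₗ[k] _) := by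
  rw [coad_eq, LinearMap.comp_apply, AlgHom.toLinearMap_apply, map_one, dualAct_one]

theorem coad_mul (a b : H) : coad (a * b) =
    (coad b ∘ₗ coad a : RestrictedDual k H →ₗ[k] _) := by
  simp only [coad_eq, LinearMap.comp_apply, AlgHom.toLinearMap_apply, map_mul, dualAct_mul]

theorem coad_unit (h : H) : coad h (1 : RestrictedDual k H) =
    Coalgebra.counit (R := k) h • (1 : RestrictedDual k H) := by
  rw [coad_eq, LinearMap.comp_apply, dualAct_unit]
  have h1 : ∀ t : H ⊗[k] H, Bialgebra.counitAlgHom k (H ⊗[k] H) t = Coalgebra.counit (R := k)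
      (TensorProduct.lid k H ((Coalgebra.counit : H →ₗ[k] k).rTensor H t)) := fun t => by
    induction t with
    | zero => simp
    | add a b ha hb => simp only [map_add, ha, hb]
    | tmul a b => simp [mul_comm]
  rw [h1]
  simp

end LoopAlgebra

/-! ### Counits of the twists, and equivariance of the loop product -/

section Contractions
variable {k : Type u} {H : Type v} [Field k] [Ring H] [HopfAlgebra k H]

variable (k H) in
/-- The contraction of the first two slots with the counit. -/
def counitLeft : (H ⊗[k] H) ⊗[k] (H ⊗[k] H) →ₐ[k] H ⊗[k] H :=
  (Algebra.TensorProduct.lid k (H ⊗[k] H)).toAlgHom.comp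
    (Algebra.TensorProduct.map (Bialgebra.counitAlgHom k (H ⊗[k] H)) (AlgHom.id k _))

variable (k H) in
/-- The contraction of the last two slots with the counit. -/
def counitRight : (H ⊗[k] H) ⊗[k] (H ⊗[k] H) →ₐ[k] H ⊗[k] H :=
  (Algebra.TensorProduct.rid k k (H ⊗[k] H)).toAlgHom.comp
    (Algebra.TensorProduct.map (AlgHom.id k _) (Bialgebra.counitAlgHom k (H ⊗[k] H)))

variable (k H) in
/-- `x ↦ x ⊗ 1` -/
abbrev inl : H →ₐ[k] H ⊗[k] H := Algebra.TensorProduct.includeLeft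

variable (k H) in
/-- `x ↦ 1 ⊗ x` -/
abbrev inr : H →ₐ[k] H ⊗[k] H := Algebra.TensorProduct.includeRight

variable (t : H ⊗[k] H)

theorem counitLeft_slot13 : counitLeft k H (slot13 k H t) =
    evMul (convUnit k H _) (inl k H).toLinearMap t := by
  induction t with
  | zero => simp
  | add a b ha hb => simp only [map_add, ha, hb]
  | tmul a b => simp [slot13, counitLeft, convUnit_apply, Algebra.algebraMap_eq_smul_one]

theorem counitLeft_slot14 : counitLeft k H (slot14 k H t) =
    evMul (convUnit k H _) (inr k H).toLinearMap t := by
  induction t with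
  | zero => simp
  | add a b ha hb => simp only [map_add, ha, hb]
  | tmul a b => simp [slot14, counitLeft, convUnit_apply, Algebra.algebraMap_eq_smul_one]

theorem counitLeft_slot23 : counitLeft k H (slot23 k H t) =
    evMul (convUnit k H _) (inl k H).toLinearMap t := by
  induction t with
  | zero => simp
  | add a b ha hb => simp only [map_add, ha, hb]
  | tmul a b => simp [slot23, counitLeft, convUnit_apply, Algebra.algebraMap_eq_smul_one]

theorem counitLeft_slot24 : counitLeft k H (slot24 k H t) =
    evMul (convUnit k H _) (inr k H).toLinearMap t := by
  induction t with
  | zero => simp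
  | add a b ha hb => simp only [map_add, ha, hb]
  | tmul a b => simp [slot24, counitLeft, convUnit_apply, Algebra.algebraMap_eq_smul_one]

theorem counitRight_slot13 : counitRight k H (slot13 k H t) =
    evMul (inl k H).toLinearMap (convUnit k H _) t := by
  induction t with
  | zero => simp
  | add a b ha hb => simp only [map_add, ha, hb]
  | tmul a b => simp [slot13, counitRight, convUnit_apply, Algebra.algebraMap_eq_smul_one]

theorem counitRight_slot14 : counitRight k H (slot14 k H t) =
    evMul (inl k H).toLinearMap (convUnit k H _) t := by
  induction t with
  | zero => simp
  | add a b ha hb => simp only [map_add, ha, hb]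
  | tmul a b => simp [slot14, counitRight, convUnit_apply, Algebra.algebraMap_eq_smul_one]

theorem counitRight_slot23 : counitRight k H (slot23 k H t) =
    evMul (inr k H).toLinearMap (convUnit k H _) t := by
  induction t with
  | zero => simp
  | add a b ha hb => simp only [map_add, ha, hb]
  | tmul a b => simp [slot23, counitRight, convUnit_apply, Algebra.algebraMap_eq_smul_one]

theorem counitRight_slot24 : counitRight k H (slot24 k H t) =
    evMul (inr k H).toLinearMap (convUnit k H _) t := by
  induction t with
  | zero => simp
  | add a b ha hb => simp only [map_add, ha, hb]
  | tmul a b => simp [slot24, counitRight, convUnit_apply, Algebra.algebraMap_eq_smul_one]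

theorem convUnit_commuting {E : Type*} [Ring E] [Algebra k E] (f : H →ₗ[k] E) :
    Commuting (convUnit k H E) f := fun x y => by
  rw [convUnit_apply]
  exact Algebra.commute_algebraMap_left _ _

namespace Quasitriangular
variable (Q : Quasitriangular k H) {E : Type*} [Ring E] [Algebra k E] (l : H →ₐ[k] E)

theorem evMul_convUnit_R' : evMul (convUnit k H E) l.toLinearMap Q.R' = 1 := by
  rw [R', evMul_comm (convUnit_commuting _)]
  exact Q.r_convUnit_right l

theorem evMul_R'_convUnit : evMul l.toLinearMap (convUnit k H E) Q.R' = 1 := by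
  rw [R', evMul_comm (convUnit_commuting _).symm]
  exact Q.r_convUnit_left l

theorem rInv_convUnit_left : Q.rInv (convUnit k H E) l.toLinearMap = 1 := by
  let e : H →ₐ[k] E := (Algebra.ofId k E).comp (Bialgebra.counitAlgHom k H)
  have h := Q.rInv_mul_r e l (convUnit_commuting _)
  have h2 : Q.r e.toLinearMap l.toLinearMap = 1 := Q.r_convUnit_left l
  rwa [h2, mul_one] at h

theorem rInv_convUnit_right : Q.rInv l.toLinearMap (convUnit k H E) = 1 := by
  let e : H →ₐ[k] E := (Algebra.ofId k E).comp (Bialgebra.counitAlgHom k H)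
  have h := Q.rInv_mul_r l e (convUnit_commuting _).symm
  have h2 : Q.r l.toLinearMap e.toLinearMap = 1 := Q.r_convUnit_right l
  rwa [h2, mul_one] at h

theorem counitLeft_F : counitLeft k H Q.F = 1 := by
  rw [F, map_mul, counitLeft_slot23, counitLeft_slot24, evMul_convUnit_R', evMul_convUnit_R',
    one_mul]

theorem counitRight_F : counitRight k H Q.F = 1 := by
  rw [F, map_mul, counitRight_slot23, counitRight_slot24, evMul_R'_convUnit, one_mul]

theorem counitLeft_γ : counitLeft k H Q.γ = 1 := by
  rw [γ, map_mul, map_mul, map_mul, counitLeft_slot23, counitLeft_slot24, counitLeft_slot13,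
    counitLeft_slot14, evMul_convUnit_R', evMul_convUnit_R', one_mul, one_mul, one_mul]
  exact Q.rInv_convUnit_left _

theorem counitRight_γ : counitRight k H Q.γ = 1 := by
  rw [γ, map_mul, map_mul, map_mul, counitRight_slot23, counitRight_slot24, counitRight_slot13,
    counitRight_slot14, evMul_R'_convUnit, evMul_R'_convUnit, one_mul, one_mul, one_mul]
  exact Q.rInv_convUnit_right _

theorem loopMul_apply (φ ψ : RestrictedDual k H) : Q.loopMul φ ψ =
    LinearMap.mul' k (RestrictedDual k H) (TensorProduct.map₂ dualAct dualAct Q.F (φ ⊗ₜ ψ)) := rfl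

theorem loopMul_one_left (x : RestrictedDual k H) : Q.loopMul 1 x = x := by
  rw [loopMul_apply, map₂_act_unit_left _ dualAct_unit]
  have : TensorProduct.lid k (H ⊗[k] H)
    ((Bialgebra.counitAlgHom k (H ⊗[k] H)).toLinearMap.rTensor (H ⊗[k] H) Q.F) = 1 :=
    Q.counitLeft_F
  rw [this, dualAct_one]
  simp

theorem loopMul_one_right (x : RestrictedDual k H) : Q.loopMul x 1 = x := by
  rw [loopMul_apply, map₂_act_unit_right _ dualAct_unit]
  have : TensorProduct.rid k (H ⊗[k] H)
    ((Bialgebra.counitAlgHom k (H ⊗[k] H)).toLinearMap.lTensor (H ⊗[k] H) Q.F) = 1 :=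
    Q.counitRight_F
  rw [this, dualAct_one]
  simp

theorem lift_loopMul : TensorProduct.lift Q.loopMul =
    LinearMap.mul' k (RestrictedDual k H) ∘ₗ TensorProduct.map₂ dualAct dualAct Q.F :=
  TensorProduct.ext' fun _ _ => rfl

/-- With `L`, `R` for left and right multiplications, `F` moves `Lᵢ Lⱼ Rⱼ Rᵢ` to `Lᵢ Rᵢ Lⱼ Rⱼ` by
two adjacent exchanges, one for each of its factors. The first order is the coadjoint action on a
`⋆`-product, the second the diagonal coadjoint action. -/
theorem slotHom_F_intertwines (i j : H →ₐ[k] E) (h : Commuting i.toLinearMap j.toLinearMap) :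
    Intertwines (slotHom i j h Q.F)
      (conv (conv (leftHom i).toLinearMap (leftHom j).toLinearMap)
        (conv (rightHom j).toLinearMap (rightHom i).toLinearMap))
      (conv (conv (leftHom i).toLinearMap (rightHom i).toLinearMap)
        (conv (leftHom j).toLinearMap (rightHom j).toLinearMap)) := by
  rw [slotHom_F]
  have hLL := commuting_leftHom h
  have hRR := commuting_rightHom h
  have hii := commuting_leftHom_rightHom i i
  have hij := commuting_leftHom_rightHom i j
  have hji := commuting_leftHom_rightHom j i
  have hjj := commuting_leftHom_rightHom j j
  have h1 : Intertwines (Q.r (rightHom j).toLinearMap (rightHom i).toLinearMap)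
      (conv (conv (leftHom i).toLinearMap (leftHom j).toLinearMap)
        (conv (rightHom j).toLinearMap (rightHom i).toLinearMap))
      (conv (conv (leftHom i).toLinearMap (leftHom j).toLinearMap)
        (conv (rightHom i).toLinearMap (rightHom j).toLinearMap)) :=
    (Intertwines.conv (fun x => (evMul_commute (hij x) (hii x) _).symm)
      (fun x => (evMul_commute (hjj x) (hji x) _).symm)).conv
      (Q.r_intertwines _ _ hRR.symm)
  have h2 : Intertwines (Q.r (leftHom j).toLinearMap (rightHom i).toLinearMap)
      (conv (leftHom i).toLinearMap (conv (conv (leftHom j).toLinearMap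
        (rightHom i).toLinearMap) (rightHom j).toLinearMap))
      (conv (leftHom i).toLinearMap (conv (conv (rightHom i).toLinearMap
        (leftHom j).toLinearMap) (rightHom j).toLinearMap)) :=
    Intertwines.conv (fun x => (evMul_commute (hLL x) (hii x) _).symm)
      (Intertwines.conv (Q.r_intertwines _ _ hji)
        (fun x => (evMul_commute (fun y => hjj.symm x y) (fun y => hRR.symm x y) _).symm))
  simp only [conv_assoc] at h1 h2 ⊢
  exact h2.mul h1

end Quasitriangular
end Contractions

/-! ### `L_{0,1}`, `L_{1,0}` and braided products are module algebras -/

section ModuleAlgebraStructures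
variable {k : Type u} {H : Type v} [Field k] [Ring H] [HopfAlgebra k H]

theorem leftHom_convHom {E : Type*} [Ring E] [Algebra k E] (i j : H →ₐ[k] E)
    (h : Commuting i.toLinearMap j.toLinearMap) : (leftHom (convHom i j h)).toLinearMap =
      conv (leftHom i).toLinearMap (leftHom j).toLinearMap := by
  have : (leftHom (convHom i j h)).toLinearMap =
    (Algebra.lmul k E).toLinearMap ∘ₗ (convHom i j h).toLinearMap := rfl
  rw [this, convHom_coe, conv_comp]
  rfl

/-- The order is reversed because the antipode reverses the coproduct. -/
theorem rightHom_convHom {E : Type*} [Ring E] [Algebra k E] (i j : H →ₐ[k] E)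
    (h : Commuting i.toLinearMap j.toLinearMap) : (rightHom (convHom i j h)).toLinearMap =
      conv (rightHom j).toLinearMap (rightHom i).toLinearMap := by
  refine LinearMap.ext fun x => LinearMap.ext fun z => ?_
  have h1 := LinearMap.congr_fun (comul_comp_antipode k H) x
  simp only [LinearMap.comp_apply] at h1
  rw [AlgHom.toLinearMap_apply, rightHom_apply, ← AlgHom.toLinearMap_apply, convHom_coe,
    conv_apply, conv_apply, h1]
  induction (Coalgebra.comul x : H ⊗[k] H) with
  | zero => simp
  | add a b ha hb => simp only [map_add, LinearMap.add_apply, mul_add, ha, hb]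
  | tmul a b => simp [rightHom_apply, mul_assoc]

theorem slotHom_map_comul {E : Type*} [Ring E] [Algebra k E] (i j : H →ₐ[k] E)
    (h : Commuting i.toLinearMap j.toLinearMap) (t : H ⊗[k] H) :
    slotHom i j h (TensorProduct.map Coalgebra.comul Coalgebra.comul t) =
      evMul (conv (leftHom i).toLinearMap (rightHom i).toLinearMap)
        (conv (leftHom j).toLinearMap (rightHom j).toLinearMap) t := by
  induction t with
  | zero => simp
  | add a b ha hb => simp only [map_add, ha, hb]
  | tmul x y =>
  rw [TensorProduct.map_tmul, evMul_tmul, conv_apply, conv_apply]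
  induction (Coalgebra.comul x : H ⊗[k] H) with
  | zero => simp
  | add a b ha hb => simp only [map_add, TensorProduct.add_tmul, add_mul, ha, hb]
  | tmul a b =>
  induction (Coalgebra.comul y : H ⊗[k] H) with
  | zero => simp
  | add a b ha hb => simp only [map_add, TensorProduct.tmul_add, mul_add, ha, hb]
  | tmul c d => simp [slotHom_tmul]

theorem map₂_coad (t : H ⊗[k] H) :
    TensorProduct.map₂ (coad (k := k) (H := H)) (coad (k := k) (H := H)) t =
      TensorProduct.map₂ dualAct dualAct
        (TensorProduct.map Coalgebra.comul Coalgebra.comul t) := by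
  induction t with
  | zero => simp
  | add a b ha hb => simp only [map_add, ha, hb]
  | tmul x y => rfl

variable {A : Type*} [Ring A] [Algebra k A] [Module.Finite k A]
  {B : Type*} [Ring B] [Algebra k B] [Module.Finite k B]
  {X : Type*} [Ring X] [Algebra k X]

theorem map_assoc_evMul (ρ : H →ₐ[k] A) (σ : H →ₐ[k] B) (t : H ⊗[k] H)
    (z : (A ⊗[k] B) ⊗[k] X) :
    Algebra.TensorProduct.assoc k k k A B X (evMul (E := Module.End k ((A ⊗[k] B) ⊗[k] X))
      (leftHom ((Algebra.TensorProduct.includeLeft : A ⊗[k] B →ₐ[k] (A ⊗[k] B) ⊗[k] X).comp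
        (tensorRep ρ σ))).toLinearMap
      (rightHom ((Algebra.TensorProduct.includeLeft : A ⊗[k] B →ₐ[k] (A ⊗[k] B) ⊗[k] X).comp
        (tensorRep ρ σ))).toLinearMap t z) =
    evMul (E := Module.End k (A ⊗[k] (B ⊗[k] X)))
      (leftHom (convHom (inFirst B X ρ) (inSecond A X σ)
        (commuting_inFirst_inSecond ρ σ))).toLinearMap
      (rightHom (convHom (inFirst B X ρ) (inSecond A X σ)
        (commuting_inFirst_inSecond ρ σ))).toLinearMap t
      (Algebra.TensorProduct.assoc k k k A B X z) := by
  have h1 : ∀ x, convHom (inFirst B X ρ) (inSecond A X σ) (commuting_inFirst_inSecond ρ σ) x =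
      Algebra.TensorProduct.assoc k k k A B X (tensorRep ρ σ x ⊗ₜ 1) := fun x => by
    rw [assoc_comp_tensorRep, ← convHom_coe _ _ (commuting_inFirst_inSecond ρ σ)]
    rfl
  induction t with
  | zero => simp
  | add a b ha hb => simp only [map_add, LinearMap.add_apply, ha, hb]
  | tmul x y =>
    simp only [evMul_tmul, AlgHom.toLinearMap_apply, Module.End.mul_apply, leftHom_apply,
      rightHom_apply, map_mul, h1]
    rfl

/-- The `⋆`-product has the matrix of the tensor representation, whose left and right
multiplications are convolutions of those of `ρ` and `σ`. -/
theorem mat₂_coad_mul (ρ : H →ₐ[k] A) (σ : H →ₐ[k] B) (h : H) :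
    mat₂ ρ σ (coad h ∘ₗ LinearMap.mul' k (RestrictedDual k H)) =
      conv (E := Module.End k (A ⊗[k] (B ⊗[k] RestrictedDual k H)))
        (conv (leftHom (inFirst _ _ ρ)).toLinearMap (leftHom (inSecond _ _ σ)).toLinearMap)
        (conv (rightHom (inSecond _ _ σ)).toLinearMap (rightHom (inFirst _ _ ρ)).toLinearMap) h
        (mat₂ ρ σ (LinearMap.mul' k (RestrictedDual k H))) := by
  have hc := commuting_inFirst_inSecond (X := RestrictedDual k H) ρ σ
  have h2 := mat₂_comp_mul ρ σ (LinearMap.id : RestrictedDual k H →ₗ[k] _)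
  rw [LinearMap.id_comp] at h2
  rw [mat₂_comp_mul, h2, ← leftHom_convHom _ _ hc, ← rightHom_convHom _ _ hc, conv_apply,
    ← map_assoc_evMul, ← mat_dualAct]
  rfl

theorem mat₂_coad_loopMul (Q : Quasitriangular k H) (ρ : H →ₐ[k] A) (σ : H →ₐ[k] B) (h : H) :
    mat₂ ρ σ (coad h ∘ₗ LinearMap.mul' k (RestrictedDual k H) ∘ₗ
        TensorProduct.map₂ dualAct dualAct Q.F) =
      mat₂ ρ σ ((LinearMap.mul' k (RestrictedDual k H) ∘ₗ
        TensorProduct.map₂ dualAct dualAct Q.F) ∘ₗ tensorAct coad coad h) := by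
  have hc := commuting_inFirst_inSecond (X := RestrictedDual k H) ρ σ
  have h3 : tensorAct coad coad h = TensorProduct.map₂ dualAct dualAct
      (TensorProduct.map Coalgebra.comul Coalgebra.comul (Coalgebra.comul (R := k) h)) :=
    map₂_coad _
  rw [← LinearMap.comp_assoc, mat₂_dualAct, mat₂_coad_mul, h3, mat₂_dualAct, mat₂_dualAct,
    slotHom_map_comul, ← Module.End.mul_apply, ← Module.End.mul_apply,
    Q.slotHom_F_intertwines _ _ hc h]
  rfl

theorem coad_loopMul (Q : Quasitriangular k H) (h : H) :
    coad h ∘ₗ LinearMap.mul' k (RestrictedDual k H) ∘ₗ TensorProduct.map₂ dualAct dualAct Q.F =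
      (LinearMap.mul' k (RestrictedDual k H) ∘ₗ TensorProduct.map₂ dualAct dualAct Q.F) ∘ₗ
        tensorAct coad coad h :=
  ext_of_mat₂ fun _ _ ρ σ => mat₂_coad_loopMul Q ρ σ h

theorem L01_isModuleAlgebra (Q : Quasitriangular k H) : IsModuleAlgebra Q.L01 where
  one_mul := Q.loopMul_one_left
  mul_one := Q.loopMul_one_right
  act_one := coad_one
  act_mul := coad_mul
  act_unit := coad_unit
  act_product h x y := by
    refine (LinearMap.congr_fun (coad_loopMul Q h) (x ⊗ₜ y)).trans ?_
    rw [← Q.lift_loopMul]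
    rfl

/-- The relation `R Δ = Δᵒᵖ R` with its tensor factors exchanged; it is the hypothesis on `χ` for
the braided product. -/
theorem R'_mul_flip (Q : Quasitriangular k H) (h : H) :
    Q.R' * flip k H (Coalgebra.comul h) = Coalgebra.comul h * Q.R' := by
  have h1 := congrArg (flip k H) (Q.R_mul_comul h)
  rw [map_mul, map_mul] at h1
  refine h1.trans (congrArg (· * Q.R') ?_)
  exact TensorProduct.comm_comm _ _ _ _

theorem rid_counit_R' (Q : Quasitriangular k H) : TensorProduct.rid k H
    ((Bialgebra.counitAlgHom k H).toLinearMap.lTensor H Q.R') = 1 := by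
  have : ∀ t : H ⊗[k] H, TensorProduct.rid k H
      ((Bialgebra.counitAlgHom k H).toLinearMap.lTensor H t) =
      evMul (AlgHom.id k H).toLinearMap (convUnit k H H) t := fun t => by
    induction t with
    | zero => simp
    | add a b ha hb => simp only [map_add, ha, hb]
    | tmul a b => simp [convUnit_apply, Algebra.algebraMap_eq_smul_one]
  rw [this, Q.evMul_R'_convUnit]

theorem lid_counit_R' (Q : Quasitriangular k H) : TensorProduct.lid k H
    ((Bialgebra.counitAlgHom k H).toLinearMap.rTensor H Q.R') = 1 := by
  have : ∀ t : H ⊗[k] H, TensorProduct.lid k H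
      ((Bialgebra.counitAlgHom k H).toLinearMap.rTensor H t) =
      evMul (convUnit k H H) (AlgHom.id k H).toLinearMap t := fun t => by
    induction t with
    | zero => simp
    | add a b ha hb => simp only [map_add, ha, hb]
    | tmul a b => simp [convUnit_apply, Algebra.algebraMap_eq_smul_one]
  rw [this, Q.evMul_convUnit_R']

theorem braided_isModuleAlgebra (Q : Quasitriangular k H) {M N : ModuleAlgebraData k H}
    (hM : IsModuleAlgebra M) (hN : IsModuleAlgebra N) : IsModuleAlgebra (Q.braided M N) := by
  refine twistedData_isModuleAlgebra (actM := M.act) (actN := N.act) hM hN Q.R' (AlgHom.id k H)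
    (AlgHom.id k H) (Bialgebra.counitAlgHom k H) (Bialgebra.counitAlgHom k H) hM.act_one
    hN.act_one hM.act_mul hN.act_mul hM.act_unit hN.act_unit rfl rfl (rid_counit_R' Q)
    (lid_counit_R' Q) fun h => ?_
  have : TensorProduct.map (AlgHom.id k H).toLinearMap (AlgHom.id k H).toLinearMap =
    (LinearMap.id : H ⊗[k] H →ₗ[k] H ⊗[k] H) := TensorProduct.map_id
  rw [this, LinearMap.id_apply, LinearMap.id_apply, R'_mul_flip]

/-! ### The four slots of `γ` -/

section FourSlots

variable (k H) in
/-- The first slot of `(H ⊗ H) ⊗ (H ⊗ H)`. -/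
def place₁ : H →ₐ[k] (H ⊗[k] H) ⊗[k] (H ⊗[k] H) :=
  (Algebra.TensorProduct.includeLeft).comp (inl k H)

variable (k H) in
/-- The second slot of `(H ⊗ H) ⊗ (H ⊗ H)`. -/
def place₂ : H →ₐ[k] (H ⊗[k] H) ⊗[k] (H ⊗[k] H) :=
  (Algebra.TensorProduct.includeLeft).comp (inr k H)

variable (k H) in
/-- The third slot of `(H ⊗ H) ⊗ (H ⊗ H)`. -/
def place₃ : H →ₐ[k] (H ⊗[k] H) ⊗[k] (H ⊗[k] H) :=
  (Algebra.TensorProduct.includeRight).comp (inl k H)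

variable (k H) in
/-- The fourth slot of `(H ⊗ H) ⊗ (H ⊗ H)`. -/
def place₄ : H →ₐ[k] (H ⊗[k] H) ⊗[k] (H ⊗[k] H) :=
  (Algebra.TensorProduct.includeRight).comp (inr k H)

theorem commuting_place₁₂ : Commuting (place₁ k H).toLinearMap (place₂ k H).toLinearMap :=
  fun x y => by simp [Commute, SemiconjBy, place₁, place₂]

theorem commuting_place₁₃ : Commuting (place₁ k H).toLinearMap (place₃ k H).toLinearMap :=
  fun x y => by simp [Commute, SemiconjBy, place₁, place₃]

theorem commuting_place₁₄ : Commuting (place₁ k H).toLinearMap (place₄ k H).toLinearMap :=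
  fun x y => by simp [Commute, SemiconjBy, place₁, place₄]

theorem commuting_place₂₃ : Commuting (place₂ k H).toLinearMap (place₃ k H).toLinearMap :=
  fun x y => by simp [Commute, SemiconjBy, place₂, place₃]

theorem commuting_place₂₄ : Commuting (place₂ k H).toLinearMap (place₄ k H).toLinearMap :=
  fun x y => by simp [Commute, SemiconjBy, place₂, place₄]

theorem commuting_place₃₄ : Commuting (place₃ k H).toLinearMap (place₄ k H).toLinearMap :=
  fun x y => by simp [Commute, SemiconjBy, place₃, place₄]

variable (t : H ⊗[k] H)

theorem slot13_eq : slot13 k H t = evMul (place₁ k H).toLinearMap (place₃ k H).toLinearMap t := by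
  induction t with
  | zero => simp
  | add a b ha hb => simp only [map_add, ha, hb]
  | tmul a b => simp [slot13, place₁, place₃]

theorem slot14_eq : slot14 k H t = evMul (place₁ k H).toLinearMap (place₄ k H).toLinearMap t := by
  induction t with
  | zero => simp
  | add a b ha hb => simp only [map_add, ha, hb]
  | tmul a b => simp [slot14, place₁, place₄]

theorem slot23_eq : slot23 k H t = evMul (place₂ k H).toLinearMap (place₃ k H).toLinearMap t := by
  induction t with
  | zero => simp
  | add a b ha hb => simp only [map_add, ha, hb]
  | tmul a b => simp [slot23, place₂, place₃]

theorem slot24_eq : slot24 k H t = evMul (place₂ k H).toLinearMap (place₄ k H).toLinearMap t := by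
  induction t with
  | zero => simp
  | add a b ha hb => simp only [map_add, ha, hb]
  | tmul a b => simp [slot24, place₂, place₄]

theorem map_comul_eq : TensorProduct.map (Bialgebra.comulAlgHom k H).toLinearMap
      (Bialgebra.comulAlgHom k H).toLinearMap t =
    evMul (conv (place₁ k H).toLinearMap (place₂ k H).toLinearMap)
      (conv (place₃ k H).toLinearMap (place₄ k H).toLinearMap) t := by
  induction t with
  | zero => simp
  | add a b ha hb => simp only [map_add, ha, hb]
  | tmul x y =>
  rw [TensorProduct.map_tmul, evMul_tmul, conv_apply, conv_apply, AlgHom.toLinearMap_apply,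
    AlgHom.toLinearMap_apply, Bialgebra.comulAlgHom_apply, Bialgebra.comulAlgHom_apply]
  induction (Coalgebra.comul x : H ⊗[k] H) with
  | zero => simp
  | add a b ha hb => simp only [map_add, TensorProduct.add_tmul, add_mul, ha, hb]
  | tmul a b =>
  induction (Coalgebra.comul y : H ⊗[k] H) with
  | zero => simp
  | add a b ha hb => simp only [map_add, TensorProduct.tmul_add, mul_add, ha, hb]
  | tmul c d => simp [place₁, place₂, place₃, place₄]

theorem commuting_conv {E : Type*} [Ring E] [Algebra k E] {f g f' g' : H →ₗ[k] E}
    (h1 : Commuting f f') (h2 : Commuting f g') (h3 : Commuting g f') (h4 : Commuting g g') :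
    Commuting (conv f g) (conv f' g') := fun _ _ =>
  (evMul_commute (fun h => (evMul_commute (fun h' => (h1 h' h).symm) (fun h' => (h3 h' h).symm)
      _).symm)
    (fun h => (evMul_commute (fun h' => (h2 h' h).symm) (fun h' => (h4 h' h).symm) _).symm) _)

end FourSlots

/-- Read from right to left, the four factors of `γ` are adjacent exchanges carrying the order `3,
4, 1, 2` to `1, 2, 3, 4`: `R₁₄⁻¹` turns `4, 1` into `1, 4`, then `R₄₂`, `R₃₁` and `R₃₂` do the same
for their pairs. -/
theorem γ_intertwines (Q : Quasitriangular k H) :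
    Intertwines Q.γ
      (conv (conv (place₃ k H).toLinearMap (place₄ k H).toLinearMap)
        (conv (place₁ k H).toLinearMap (place₂ k H).toLinearMap))
      (conv (conv (place₁ k H).toLinearMap (place₂ k H).toLinearMap)
        (conv (place₃ k H).toLinearMap (place₄ k H).toLinearMap)) := by
  have h12 := commuting_place₁₂ (k := k) (H := H)
  have h13 := commuting_place₁₃ (k := k) (H := H)
  have h14 := commuting_place₁₄ (k := k) (H := H)
  have h23 := commuting_place₂₃ (k := k) (H := H)
  have h24 := commuting_place₂₄ (k := k) (H := H)
  have h34 := commuting_place₃₄ (k := k) (H := H)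
  rw [Quasitriangular.γ, slot13_eq, slot14_eq, slot23_eq, slot24_eq, Quasitriangular.R',
    evMul_comm h13, evMul_comm h23, evMul_comm h24]
  set p := (place₁ k H).toLinearMap
  set q := (place₂ k H).toLinearMap
  set r := (place₃ k H).toLinearMap
  set s := (place₄ k H).toLinearMap
  have e1 : Intertwines (Q.rInv p s) (conv r (conv (conv s p) q)) (conv r (conv (conv p s) q)) :=
    Intertwines.conv (fun x => (evMul_commute (h13.symm x) (h34 x) _).symm)
      (Intertwines.conv (Q.rInv_intertwines _ _ h14)
        (fun x => (evMul_commute (h12.symm x) (h24 x) _).symm))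
  have e2 : Intertwines (Q.r s q) (conv r (conv p (conv s q))) (conv r (conv p (conv q s))) :=
    Intertwines.conv (fun x => (evMul_commute (h34 x) (h23.symm x) _).symm)
      (Intertwines.conv (fun x => (evMul_commute (h14 x) (h12 x) _).symm)
        (Q.r_intertwines _ _ h24.symm))
  have e3 : Intertwines (Q.r r p) (conv (conv r p) (conv q s)) (conv (conv p r) (conv q s)) :=
    Intertwines.conv (Q.r_intertwines _ _ h13.symm)
      (Intertwines.conv (fun x => (evMul_commute (h23 x) (h12.symm x) _).symm)
        (fun x => (evMul_commute (h34.symm x) (h14.symm x) _).symm))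
  have e4 : Intertwines (Q.r r q) (conv p (conv (conv r q) s)) (conv p (conv (conv q r) s)) :=
    Intertwines.conv (fun x => (evMul_commute (h13 x) (h12 x) _).symm)
      (Intertwines.conv (Q.r_intertwines _ _ h23.symm)
        (fun x => (evMul_commute (h34.symm x) (h24.symm x) _).symm))
  simp only [conv_assoc] at e1 e2 e3 e4 ⊢
  exact ((e4.mul e3).mul e2).mul e1

theorem L10_isModuleAlgebra (Q : Quasitriangular k H) : IsModuleAlgebra Q.L10 := by
  refine twistedData_isModuleAlgebra (M := Q.L01) (N := Q.L01) (actM := dualAct)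
    (actN := dualAct) (L01_isModuleAlgebra Q) (L01_isModuleAlgebra Q) Q.γ
    (Bialgebra.comulAlgHom k H) (Bialgebra.comulAlgHom k H)
    (Bialgebra.counitAlgHom k (H ⊗[k] H)) (Bialgebra.counitAlgHom k (H ⊗[k] H))
    dualAct_one dualAct_one dualAct_mul dualAct_mul dualAct_unit dualAct_unit rfl rfl
    Q.counitRight_γ Q.counitLeft_γ fun h => ?_
  rw [map_comul_eq, map_comul_eq, evMul_comm]
  · exact γ_intertwines Q h
  · exact (commuting_conv (E := (H ⊗[k] H) ⊗[k] (H ⊗[k] H)) commuting_place₁₃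
      commuting_place₁₄ commuting_place₂₃
      commuting_place₂₄)

end ModuleAlgebraStructures

/-! ### The two legs of `A ⊗ X` -/

section Legs
variable {k : Type u} {H : Type v} [Field k] [Ring H] [HopfAlgebra k H]
  {A : Type*} [Ring A] [Algebra k A] {X : Type*} [Ring X] [Algebra k X]

variable (X) in
/-- `H` acting through the first tensor factor of `A ⊗ X`. -/
def onMat (ρ : H →ₐ[k] A) : H →ₐ[k] A ⊗[k] X :=
  (Algebra.TensorProduct.includeLeft : A →ₐ[k] A ⊗[k] X).comp ρ

variable (A) in
/-- The second tensor factor of `A ⊗ X`. -/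
def onVal {K : Type*} [AddCommGroup K] [Module k K] (f : K →ₗ[k] X) : K →ₗ[k] A ⊗[k] X :=
  (Algebra.TensorProduct.includeRight : X →ₐ[k] A ⊗[k] X).toLinearMap ∘ₗ f

theorem onMat_apply (ρ : H →ₐ[k] A) (h : H) : onMat X ρ h = ρ h ⊗ₜ 1 := rfl

theorem onVal_apply {K : Type*} [AddCommGroup K] [Module k K] (f : K →ₗ[k] X) (x : K) :
    onVal A f x = 1 ⊗ₜ f x := rfl

theorem commuting_onMat_onVal (ρ : H →ₐ[k] A) (f : H →ₗ[k] X) :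
    Commuting (onMat X ρ).toLinearMap (onVal A f) := fun x y => by
  simp [Commute, SemiconjBy, onMat_apply, onVal_apply]

end Legs

/-! ### Matrix criteria for products and for the moment condition -/

section Criteria
variable {k : Type u} {H : Type v} [Field k] [Ring H] [HopfAlgebra k H]
  (Q : Quasitriangular k H)
  {A : Type*} [Ring A] [Algebra k A] [Module.Finite k A]
  {B : Type*} [Ring B] [Algebra k B] [Module.Finite k B]
  {X : Type*} [Ring X] [Algebra k X]

/-- The fusion relation for the matrices of a linear map `f : H° → X`. -/
def Fusion (f : RestrictedDual k H →ₗ[k] X) (ρ : H →ₐ[k] A) (σ : H →ₐ[k] B) : Prop :=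
  mat₂ ρ σ (f ∘ₗ LinearMap.mul' k (RestrictedDual k H)) *
      Q.r (inSecond A X σ).toLinearMap (inFirst B X ρ).toLinearMap =
    skipMiddle A B X (mat ρ f) * Q.r (inSecond A X σ).toLinearMap (inFirst B X ρ).toLinearMap *
      skipFirst A B X (mat σ f)

-- The factor `R₄₂` of `F` multiplies the matrix of the `⋆`-product on the right by `R₂₁`. Fusion
-- rewrites the result as `M₁ R₂₁ M₂`, and the factor `R₃₂` removes the `R₂₁` in the middle.
variable {Q} in
theorem Fusion.mat₂_eq {f : RestrictedDual k H →ₗ[k] X} {ρ : H →ₐ[k] A} {σ : H →ₐ[k] B}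
    (h : Fusion Q f ρ σ) : mat₂ ρ σ (f ∘ₗ TensorProduct.lift Q.loopMul) =
      mat₂ ρ σ (LinearMap.mul' k X ∘ₗ TensorProduct.map f f) := by
  have hc := commuting_inFirst_inSecond (X := X) ρ σ
  rw [Q.lift_loopMul, ← LinearMap.comp_assoc, mat₂_dualAct, slotHom_F, Module.End.mul_apply,
    Q.r_rightHom _ _ hc.symm, h, mat₂_mul]
  exact Q.r_leftHom_rightHom _ _ (inSecond_commute_skipMiddle σ _)
    (inFirst_commute_skipFirst ρ _)

theorem map_loopMul_of_fusion {f : RestrictedDual k H →ₗ[k] X}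
    (h : ∀ (n m : ℕ) (ρ : H →ₐ[k] Module.End k (Fin n → k))
      (σ : H →ₐ[k] Module.End k (Fin m → k)), Fusion Q f ρ σ) (φ ψ : RestrictedDual k H) :
    f (Q.loopMul φ ψ) = f φ * f ψ :=
  LinearMap.congr_fun (ext_of_mat₂ fun n m ρ σ => (h n m ρ σ).mat₂_eq) (φ ⊗ₜ ψ)

/-- The exchange relation for the matrices of two linear maps `f, g : H° → X`. -/
def Exchange (f g : RestrictedDual k H →ₗ[k] X) (ρ : H →ₐ[k] A) (σ : H →ₐ[k] B) : Prop :=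
  Q.r (inSecond A X σ).toLinearMap (inFirst B X ρ).toLinearMap * (skipFirst A B X (mat σ g) *
      Q.r (inFirst B X ρ).toLinearMap (inSecond A X σ).toLinearMap *
      skipMiddle A B X (mat ρ f) *
      Q.r (inSecond A X σ).toLinearMap (inFirst B X ρ).toLinearMap) =
    skipMiddle A B X (mat ρ f) * Q.r (inSecond A X σ).toLinearMap (inFirst B X ρ).toLinearMap *
      skipFirst A B X (mat σ g)

-- The factors of `γ` act in turn on the product `N₂ M₁` of the matrices of `g` and `f`: `R₁₄⁻¹`
-- inserts `R₁₂` in the middle, `R₄₂` and `R₃₁` multiply by `R₂₁` on the right and on the left,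
-- which gives the left side of the exchange relation; `R₃₂` then removes `R₂₁` from `M₁ R₂₁ N₂`.
variable {Q} in
theorem Exchange.mat₂_eq {f g : RestrictedDual k H →ₗ[k] X} {ρ : H →ₐ[k] A} {σ : H →ₐ[k] B}
    (h : Exchange Q f g ρ σ) : mat₂ ρ σ (LinearMap.mul' k X ∘ₗ TensorProduct.map f g) =
      mat₂ ρ σ ((LinearMap.mul' k X ∘ₗ TensorProduct.map g f ∘ₗ
        (TensorProduct.comm k _ _).toLinearMap) ∘ₗ TensorProduct.map₂ dualAct dualAct Q.γ) := by
  have hc := commuting_inFirst_inSecond (X := X) ρ σ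
  rw [mat₂_dualAct, slotHom_γ, Module.End.mul_apply, Module.End.mul_apply, Module.End.mul_apply,
    mat₂_mul_comm, mat₂_mul, Q.rInv_leftHom_rightHom _ _ (inFirst_commute_skipFirst ρ _)
      (inSecond_commute_skipMiddle σ _), Q.r_rightHom _ _ hc.symm, Q.r_leftHom, h]
  exact (Q.r_leftHom_rightHom _ _ (inSecond_commute_skipMiddle σ _)
    (inFirst_commute_skipFirst ρ _)).symm

theorem exchange_of_mat {f g : RestrictedDual k H →ₗ[k] X}
    (h : ∀ (n m : ℕ) (ρ : H →ₐ[k] Module.End k (Fin n → k))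
      (σ : H →ₐ[k] Module.End k (Fin m → k)), Exchange Q f g ρ σ) (φ ψ : RestrictedDual k H) :
    f φ * g ψ = LinearMap.mul' k X (TensorProduct.map g f (TensorProduct.comm k _ _
      (TensorProduct.map₂ dualAct dualAct Q.γ (φ ⊗ₜ ψ)))) :=
  LinearMap.congr_fun (ext_of_mat₂ fun n m ρ σ => (h n m ρ σ).mat₂_eq) (φ ⊗ₜ ψ)

theorem mat_mulRight (ρ : H →ₐ[k] A) (f : RestrictedDual k H →ₗ[k] X) (x : X) :
    mat ρ (LinearMap.mulRight k x ∘ₗ f) = mat ρ f * 1 ⊗ₜ x := by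
  simp [mat_apply, Finset.sum_mul]

theorem mat_mulLeft (ρ : H →ₐ[k] A) (f : RestrictedDual k H →ₗ[k] X) (x : X) :
    mat ρ (LinearMap.mulLeft k x ∘ₗ f) = 1 ⊗ₜ x * mat ρ f := by
  simp [mat_apply, Finset.mul_sum]

/-- The linear map `φ ↦ D(x) f(coadʳ(y)(φ))`, for `x ⊗ y` in `H ⊗ H`. -/
def mulCoad (D : H →ₗ[k] X) (f : RestrictedDual k H →ₗ[k] X) :
    H ⊗[k] H →ₗ[k] RestrictedDual k H →ₗ[k] X :=
  TensorProduct.lift (LinearMap.mk₂ k (fun x y => LinearMap.mulLeft k (D x) ∘ₗ f ∘ₗ coad y)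
    (fun x x' y => by ext; simp [add_mul]) (fun c x y => by ext; simp)
    (fun x y y' => by ext; simp [mul_add]) (fun c x y => by ext; simp))

theorem mulCoad_apply (D : H →ₗ[k] X) (f : RestrictedDual k H →ₗ[k] X) (t : H ⊗[k] H)
    (φ : RestrictedDual k H) :
    mulCoad D f t φ = evMul D (f ∘ₗ (coad (k := k) (H := H)).flip φ) t := by
  induction t with
  | zero => simp
  | add a b ha hb => simp only [map_add, LinearMap.add_apply, ha, hb]
  | tmul x y => simp [mulCoad]

theorem mat_coad (ρ : H →ₐ[k] A) (f : RestrictedDual k H →ₗ[k] X) (h : H) :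
    mat ρ (f ∘ₗ coad h) = conv (E := Module.End k (A ⊗[k] X)) (leftHom (onMat X ρ)).toLinearMap
      (rightHom (onMat X ρ)).toLinearMap h (mat ρ f) :=
  mat_dualAct ρ f _

theorem mat_mulCoad (ρ : H →ₐ[k] A) (D : H →ₗ[k] X) (f : RestrictedDual k H →ₗ[k] X)
    (t : H ⊗[k] H) : mat ρ (mulCoad D f t) =
      evMul (E := Module.End k (A ⊗[k] X)) ((Algebra.lmul k (A ⊗[k] X)).toLinearMap ∘ₗ onVal A D)
        (conv (leftHom (onMat X ρ)).toLinearMap (rightHom (onMat X ρ)).toLinearMap) t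
        (mat ρ f) := by
  induction t with
  | zero => simp
  | add a b ha hb => simp only [map_add, LinearMap.add_apply, ha, hb]
  | tmul x y =>
    rw [mulCoad, TensorProduct.lift.tmul, LinearMap.mk₂_apply, mat_mulLeft, mat_coad, evMul_tmul]
    rfl

theorem evMul_lmul_rightHom {E : Type*} [Ring E] [Algebra k E] (i : H →ₐ[k] E) (f : H →ₗ[k] E)
    {x : E} (hx : Intertwines x f f) (t : H ⊗[k] H) :
    evMul ((Algebra.lmul k E).toLinearMap ∘ₗ f) (rightHom i).toLinearMap t x =
      x * evMul f (i.toLinearMap ∘ₗ HopfAlgebra.antipode k) t := by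
  induction t with
  | zero => simp
  | add a b ha hb => simp only [map_add, LinearMap.add_apply, mul_add, ha, hb]
  | tmul a b => simp [rightHom_apply, ← mul_assoc, hx a]

theorem lmul_comp_conv {E : Type*} [Ring E] [Algebra k E] (f g : H →ₗ[k] E) :
    (Algebra.lmul k E).toLinearMap ∘ₗ conv f g =
      conv ((Algebra.lmul k E).toLinearMap ∘ₗ f) ((Algebra.lmul k E).toLinearMap ∘ₗ g) :=
  conv_comp _ _ _

/-- The left side is `∑ f(h₁) i(h₂) x i(S(h₃))`. By hypothesis `∑ f(h₁) i(h₂)` moves to the right of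
`x`, after which `i(h₂) i(S(h₃))` cancels. -/
theorem conv_lmul_leftHom_rightHom {E : Type*} [Ring E] [Algebra k E] (i : H →ₐ[k] E)
    (f : H →ₗ[k] E) {x : E} (hx : Intertwines x (conv f i.toLinearMap) (conv f i.toLinearMap))
    (h : H) : evMul ((Algebra.lmul k E).toLinearMap ∘ₗ f)
      (conv (leftHom i).toLinearMap (rightHom i).toLinearMap) (Coalgebra.comul h) x = x * f h := by
  have h1 : (leftHom i).toLinearMap = (Algebra.lmul k E).toLinearMap ∘ₗ i.toLinearMap := rfl
  rw [← conv_apply, ← conv_assoc, h1, ← lmul_comp_conv f i.toLinearMap, conv_apply,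
    evMul_lmul_rightHom _ _ hx,
    ← conv_apply, conv_assoc, conv_antipode, conv_convUnit]

theorem mat_mulCoad_of_intertwines {ρ : H →ₐ[k] A} {D : H →ₗ[k] X}
    {f : RestrictedDual k H →ₗ[k] X}
    (h : Intertwines (mat ρ f) (conv (onVal A D) (onMat X ρ).toLinearMap)
      (conv (onVal A D) (onMat X ρ).toLinearMap)) (x : H) :
    mat ρ (LinearMap.mulRight k (D x) ∘ₗ f) = mat ρ (mulCoad D f (Coalgebra.comul x)) := by
  rw [mat_mulCoad, conv_lmul_leftHom_rightHom _ _ h, mat_mulRight, onVal_apply]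

/-- In matrix form the right side is `∑ D(x₁) ρ(x₂) M ρ(S(x₃))`, so commutation of `M` with the
convolution of `D` and `ρ` is enough. -/
theorem moment_of_mat {D : H →ₗ[k] X} {f : RestrictedDual k H →ₗ[k] X}
    (h : ∀ (n : ℕ) (ρ : H →ₐ[k] Module.End k (Fin n → k)),
      Intertwines (mat ρ f) (conv (onVal _ D) (onMat X ρ).toLinearMap)
        (conv (onVal _ D) (onMat X ρ).toLinearMap)) (φ : RestrictedDual k H) (x : H) :
    f φ * D x = conv D (f ∘ₗ (coad (k := k) (H := H)).flip φ) x := by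
  rw [conv_apply, ← mulCoad_apply]
  exact LinearMap.congr_fun (ext_of_mat fun n ρ => mat_mulCoad_of_intertwines (h n ρ) x) φ

end Criteria

/-! ### Universal relations in an algebra with commuting morphisms from `H` -/

section Relations
variable {k : Type*} {H : Type*} [Field k] [Ring H] [HopfAlgebra k H]
  (Q : Quasitriangular k H) {E : Type*} [Ring E] [Algebra k E]

theorem map_r {E' : Type*} [Ring E'] [Algebra k E'] (π : E →ₐ[k] E') (f g : H →ₗ[k] E) :
    π (Q.r f g) = Q.r (π.toLinearMap ∘ₗ f) (π.toLinearMap ∘ₗ g) := map_evMul π f g _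

theorem intertwines_r {x : E} {f f' g g' : H →ₗ[k] E} (hf : Intertwines x f f')
    (hg : Intertwines x g g') : x * Q.r f g = Q.r f' g' * x := hf.evMul hg _

variable {i j l : H →ₐ[k] E}

/-- Here `i`, `j` are the two matrix spaces and `l` the value space. Expanding along the
convolutions leaves two applications of Yang–Baxter. It is the fusion relation for `R R'`. -/
theorem fusion_relation_one (hij : Commuting i.toLinearMap j.toLinearMap)
    (hil : Commuting i.toLinearMap l.toLinearMap) (hjl : Commuting j.toLinearMap l.toLinearMap) :
    Q.r (conv i.toLinearMap j.toLinearMap) l.toLinearMap *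
        Q.r l.toLinearMap (conv i.toLinearMap j.toLinearMap) * Q.r j.toLinearMap i.toLinearMap =
      Q.r i.toLinearMap l.toLinearMap * Q.r l.toLinearMap i.toLinearMap *
        Q.r j.toLinearMap i.toLinearMap *
        (Q.r j.toLinearMap l.toLinearMap * Q.r l.toLinearMap j.toLinearMap) := by
  rw [Q.r_conv_left _ _ _ hjl, Q.r_conv_right _ _ _ hij hjl]
  have y1 := Q.yangBaxter _ _ _ hjl.symm hil.symm hij.symm
  have y2 := Q.yangBaxter _ _ _ hjl hij.symm hil.symm
  calc _ = Q.r i.toLinearMap l.toLinearMap * Q.r j.toLinearMap l.toLinearMap *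
        (Q.r l.toLinearMap j.toLinearMap * Q.r l.toLinearMap i.toLinearMap *
          Q.r j.toLinearMap i.toLinearMap) := by simp only [mul_assoc]
    _ = Q.r i.toLinearMap l.toLinearMap * (Q.r j.toLinearMap l.toLinearMap *
        Q.r j.toLinearMap i.toLinearMap * Q.r l.toLinearMap i.toLinearMap) *
          Q.r l.toLinearMap j.toLinearMap := by rw [y1]; simp only [mul_assoc]
    _ = _ := by rw [y2]; simp only [mul_assoc]

/-- The fusion relation for the dressed matrices `R S R'` and `R T R'`. The intertwining hypotheses
allow `S` and `T` to pass values of `R`, at the price of one factor `R_{ji}` each. -/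
theorem fusion_relation (hij : Commuting i.toLinearMap j.toLinearMap)
    (hil : Commuting i.toLinearMap l.toLinearMap) (hjl : Commuting j.toLinearMap l.toLinearMap)
    {S T : E} (hS : Intertwines S (conv i.toLinearMap l.toLinearMap) l.toLinearMap)
    (hSj : Intertwines S j.toLinearMap j.toLinearMap)
    (hT : Intertwines T (conv j.toLinearMap l.toLinearMap) l.toLinearMap)
    (hTi : Intertwines T i.toLinearMap i.toLinearMap) :
    Q.r (conv i.toLinearMap j.toLinearMap) l.toLinearMap * (S * T) *
        Q.r l.toLinearMap (conv i.toLinearMap j.toLinearMap) * Q.r j.toLinearMap i.toLinearMap =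
      Q.r i.toLinearMap l.toLinearMap * S * Q.r l.toLinearMap i.toLinearMap *
        Q.r j.toLinearMap i.toLinearMap *
        (Q.r j.toLinearMap l.toLinearMap * T * Q.r l.toLinearMap j.toLinearMap) := by
  -- In the letters introduced below: `cde = edc`, `bed = deb`, `S(be) = bS` and `T(ed) = dT`.
  have y1 := Q.yangBaxter _ _ _ hjl.symm hil.symm hij.symm
  have y2 := Q.yangBaxter _ _ _ hjl hij.symm hil.symm
  have e1 := intertwines_r Q hSj hS
  have e2 := intertwines_r Q hT hTi
  rw [Q.r_conv_right _ _ _ hil hjl.symm] at e1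
  rw [Q.r_conv_left _ _ _ hil.symm] at e2
  rw [Q.r_conv_left _ _ _ hjl, Q.r_conv_right _ _ _ hij hjl]
  generalize Q.r i.toLinearMap l.toLinearMap = a at *
  generalize Q.r j.toLinearMap l.toLinearMap = b at *
  generalize Q.r l.toLinearMap j.toLinearMap = c at *
  generalize Q.r l.toLinearMap i.toLinearMap = d at *
  generalize Q.r j.toLinearMap i.toLinearMap = e at *
  calc a * b * (S * T) * (c * d) * e = a * b * S * T * (c * d * e) := by simp only [mul_assoc]
    _ = a * b * S * (T * (e * d)) * c := by rw [y1]; simp only [mul_assoc]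
    _ = a * (b * S) * d * T * c := by rw [e2]; simp only [mul_assoc]
    _ = a * S * (b * e * d) * T * c := by rw [← e1]; simp only [mul_assoc]
    _ = _ := by rw [y2]; simp only [mul_assoc]

/-- The exchange relation between `R R'` in the space `i` and `R T R'` in the space `j`. One copy of
`T` passes an `R` on each side, and four Yang–Baxter moves reorder the rest. -/
theorem exchange_relation (hij : Commuting i.toLinearMap j.toLinearMap)
    (hil : Commuting i.toLinearMap l.toLinearMap) (hjl : Commuting j.toLinearMap l.toLinearMap)
    {T : E} (hT : Intertwines T (conv j.toLinearMap l.toLinearMap) l.toLinearMap)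
    (hTi : Intertwines T i.toLinearMap i.toLinearMap) :
    Q.r j.toLinearMap i.toLinearMap *
        (Q.r j.toLinearMap l.toLinearMap * T * Q.r l.toLinearMap j.toLinearMap *
        Q.r i.toLinearMap j.toLinearMap *
        (Q.r i.toLinearMap l.toLinearMap * Q.r l.toLinearMap i.toLinearMap) *
        Q.r j.toLinearMap i.toLinearMap) =
      Q.r i.toLinearMap l.toLinearMap * Q.r l.toLinearMap i.toLinearMap *
        Q.r j.toLinearMap i.toLinearMap *
        (Q.r j.toLinearMap l.toLinearMap * T * Q.r l.toLinearMap j.toLinearMap) := by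
  -- In the letters introduced below, `e1` reads `T(af) = aT` and `e2` reads `T(ed) = dT`.
  have y1 := Q.yangBaxter _ _ _ hjl.symm hil.symm hij.symm
  have y2 := Q.yangBaxter _ _ _ hjl hij.symm hil.symm
  have y3 := Q.yangBaxter _ _ _ hil hij hjl.symm
  have y4 := Q.yangBaxter _ _ _ hij.symm hjl hil
  have e1 := intertwines_r Q hTi hT
  have e2 := intertwines_r Q hT hTi
  rw [Q.r_conv_right _ _ _ hjl hil.symm] at e1
  rw [Q.r_conv_left _ _ _ hil.symm] at e2
  generalize Q.r i.toLinearMap l.toLinearMap = a at *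
  generalize Q.r j.toLinearMap l.toLinearMap = b at *
  generalize Q.r l.toLinearMap j.toLinearMap = c at *
  generalize Q.r l.toLinearMap i.toLinearMap = d at *
  generalize Q.r j.toLinearMap i.toLinearMap = e at *
  generalize Q.r i.toLinearMap j.toLinearMap = f at *
  calc e * (b * T * c * f * (a * d) * e) = e * b * T * (c * f * a) * d * e := by
        simp only [mul_assoc]
    _ = e * b * (T * (a * f)) * (c * d * e) := by rw [← y3]; simp only [mul_assoc]
    _ = e * b * a * (T * (e * d)) * c := by rw [e1, y1]; simp only [mul_assoc]
    _ = (e * b * a) * d * T * c := by rw [e2]; simp only [mul_assoc]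
    _ = a * (b * e * d) * T * c := by rw [y4]; simp only [mul_assoc]
    _ = _ := by rw [y2]; simp only [mul_assoc]

theorem Commuting.intertwines_r {t f g : H →ₗ[k] E} (hf : Commuting t f) (hg : Commuting t g) :
    Intertwines (Q.r f g) t t := fun h =>
  (evMul_commute (fun x => hf h x) (fun x => hg h x) _ : Commute (t h) (Q.r f g)).symm

theorem double_r_intertwines (hil : Commuting i.toLinearMap l.toLinearMap) :
    Intertwines (Q.r i.toLinearMap l.toLinearMap * Q.r l.toLinearMap i.toLinearMap)
      (conv l.toLinearMap i.toLinearMap) (conv l.toLinearMap i.toLinearMap) :=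
  (Q.r_intertwines i l hil).mul (Q.r_intertwines l i hil.symm)

theorem double_r_intertwines_conv (hil : Commuting i.toLinearMap l.toLinearMap) {t : H →ₗ[k] E}
    (hti : Commuting t i.toLinearMap) (htl : Commuting t l.toLinearMap) :
    Intertwines (Q.r i.toLinearMap l.toLinearMap * Q.r l.toLinearMap i.toLinearMap)
      (conv (conv t l.toLinearMap) i.toLinearMap) (conv (conv t l.toLinearMap) i.toLinearMap) := by
  rw [conv_assoc]
  exact ((hti.intertwines_r Q htl).mul (htl.intertwines_r Q hti)).conv (double_r_intertwines Q hil)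

/-- The right-hand `R` carries the order `t, l, i` to `t, i, l`; this order is preserved by `T`,
whose two relations add and absorb one copy of `i`; the left-hand `R` then restores `t, l, i`.
Without `t` the matrix `T` would not preserve the convolution, which is why `h̃` enters the moment
map of a handle. -/
theorem dressed_intertwines (hil : Commuting i.toLinearMap l.toLinearMap) {t : H →ₗ[k] E}
    (hti : Commuting t i.toLinearMap) (htl : Commuting t l.toLinearMap) {T : E}
    (hT : Intertwines T (conv i.toLinearMap l.toLinearMap) l.toLinearMap)
    (hTt : Intertwines T t (conv t i.toLinearMap)) :
    Intertwines (Q.r i.toLinearMap l.toLinearMap * T * Q.r l.toLinearMap i.toLinearMap)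
      (conv (conv t l.toLinearMap) i.toLinearMap) (conv (conv t l.toLinearMap) i.toLinearMap) := by
  rw [conv_assoc]
  have h1 := (htl.intertwines_r Q hti).conv (Q.r_intertwines l i hil.symm)
  have h2 := hTt.conv hT
  rw [conv_assoc] at h2
  exact (((hti.intertwines_r Q htl).conv (Q.r_intertwines i l hil)).mul h2).mul h1

end Relations

/-! ### The morphism `Φ_{0,1}` -/

section Loop
variable {k : Type u} {H : Type v} [Field k] [Ring H] [HopfAlgebra k H]
  {A : Type*} [Ring A] [Algebra k A] {B : Type*} [Ring B] [Algebra k B]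
  {X : Type*} [Ring X] [Algebra k X]

variable (A) in
/-- `H` acting through the second tensor factor of `A ⊗ X`. -/
def inVal (π : H →ₐ[k] X) : H →ₐ[k] A ⊗[k] X :=
  (Algebra.TensorProduct.includeRight : X →ₐ[k] A ⊗[k] X).comp π

theorem inVal_apply (π : H →ₐ[k] X) (h : H) : inVal A π h = 1 ⊗ₜ π h := rfl

variable (A B) in
/-- `H` acting through the third tensor factor of `A ⊗ (B ⊗ X)`. -/
def inThird (π : H →ₐ[k] X) : H →ₐ[k] A ⊗[k] (B ⊗[k] X) := inVal A (inVal B π)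

theorem inThird_apply (π : H →ₐ[k] X) (h : H) : inThird A B π h = 1 ⊗ₜ (1 ⊗ₜ π h) := rfl

theorem commuting_inVal (ρ : H →ₐ[k] A) (π : H →ₐ[k] X) :
    Commuting (onMat X ρ).toLinearMap (inVal A π).toLinearMap := fun x y =>
  commuting_onMat_onVal ρ π.toLinearMap x y

variable [Module.Finite k A] [Module.Finite k B]

theorem commuting_inFirst_inThird (ρ : H →ₐ[k] A) (π : H →ₐ[k] X) :
    Commuting (inFirst B X ρ).toLinearMap (inThird A B π).toLinearMap := fun x y => by
  simp [Commute, SemiconjBy, inFirst_apply, inThird_apply]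

theorem commuting_inSecond_inThird (σ : H →ₐ[k] B) (π : H →ₐ[k] X) :
    Commuting (inSecond A X σ).toLinearMap (inThird A B π).toLinearMap := fun x y => by
  simp [Commute, SemiconjBy, inSecond_apply, inThird_apply]

theorem skipMiddle_comp_onMat (ρ : H →ₐ[k] A) :
    (skipMiddle (k := k) A B X).toLinearMap ∘ₗ (onMat X ρ).toLinearMap =
      (inFirst B X ρ).toLinearMap := by
  refine LinearMap.ext fun x => ?_
  simp [onMat_apply, inFirst_apply, skipMiddle, Algebra.TensorProduct.one_def]

theorem skipMiddle_comp_inVal (π : H →ₐ[k] X) :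
    (skipMiddle (k := k) A B X).toLinearMap ∘ₗ (inVal A π).toLinearMap =
      (inThird A B π).toLinearMap := by
  refine LinearMap.ext fun x => ?_
  simp [inVal_apply, inThird_apply, skipMiddle]

theorem skipFirst_comp_onMat (σ : H →ₐ[k] B) :
    (skipFirst (k := k) A B X).toLinearMap ∘ₗ (onMat X σ).toLinearMap =
      (inSecond A X σ).toLinearMap := rfl

theorem skipFirst_comp_inVal (π : H →ₐ[k] X) :
    (skipFirst (k := k) A B X).toLinearMap ∘ₗ (inVal B π).toLinearMap =
      (inThird A B π).toLinearMap := rfl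

variable (k A B X) in
/-- The associativity isomorphism, as a morphism of algebras. -/
def assocHom : (A ⊗[k] B) ⊗[k] X →ₐ[k] A ⊗[k] (B ⊗[k] X) :=
  (Algebra.TensorProduct.assoc k k k A B X).toAlgHom

theorem assocHom_comp_onMat (ρ : H →ₐ[k] A) (σ : H →ₐ[k] B) :
    (assocHom k A B X).toLinearMap ∘ₗ (onMat X (tensorRep ρ σ)).toLinearMap =
      conv (inFirst B X ρ).toLinearMap (inSecond A X σ).toLinearMap :=
  LinearMap.ext fun h => assoc_comp_tensorRep ρ σ h

theorem assocHom_comp_inVal (π : H →ₐ[k] X) :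
    (assocHom k A B X).toLinearMap ∘ₗ (inVal (A ⊗[k] B) π).toLinearMap =
      (inThird A B π).toLinearMap := by
  refine LinearMap.ext fun x => ?_
  simp [inVal_apply, inThird_apply, assocHom, Algebra.TensorProduct.one_def]

variable (Q : Quasitriangular k H)

/-- `Φ_{0,1}`, on the vector space `H°`. -/
def loopValue : RestrictedDual k H →ₗ[k] H := Q.Φ01

theorem slice_evMul (ρ : H →ₐ[k] A) (a : Module.Dual k A) (t : H ⊗[k] H) :
    slice H a (evMul (onMat H ρ).toLinearMap (inVal A (AlgHom.id k H)).toLinearMap t) =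
      TensorProduct.lid k H ((evalDual k H (coeff ρ a)).rTensor H t) := by
  induction t with
  | zero => simp
  | add a b ha hb => simp only [map_add, ha, hb]
  | tmul x y => simp [onMat_apply, inVal_apply, evalDual_coeff]

theorem mat_loopValue_id (ρ : H →ₐ[k] A) : mat ρ (loopValue Q) =
    Q.r (onMat H ρ).toLinearMap (inVal A (AlgHom.id k H)).toLinearMap *
      Q.r (inVal A (AlgHom.id k H)).toLinearMap (onMat H ρ).toLinearMap := by
  refine slice_ext fun a => ?_
  have hc := commuting_inVal ρ (AlgHom.id k H)
  rw [slice_mat, Quasitriangular.r, Quasitriangular.r, ← evMul_comm hc, ← evMul_mul _ _ hc,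
    slice_evMul]
  rfl

/-- A general `π` is allowed because `Φ_{0,1}` is used both with values in `H` and with values in
the Heisenberg double. -/
theorem mat_loopValue (ρ : H →ₐ[k] A) (π : H →ₐ[k] X) :
    mat ρ (π.toLinearMap ∘ₗ loopValue Q) =
    Q.r (onMat X ρ).toLinearMap (inVal A π).toLinearMap *
      Q.r (inVal A π).toLinearMap (onMat X ρ).toLinearMap := by
  have h1 : (Algebra.TensorProduct.map (AlgHom.id k A) π).toLinearMap ∘ₗ
      (onMat H ρ).toLinearMap = (onMat X ρ).toLinearMap := by
    refine LinearMap.ext fun x => ?_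
    simp [onMat_apply]
  have h2 : (Algebra.TensorProduct.map (AlgHom.id k A) π).toLinearMap ∘ₗ
      (inVal A (AlgHom.id k H)).toLinearMap = (inVal A π).toLinearMap := by
    refine LinearMap.ext fun x => ?_
    simp [inVal_apply]
  rw [mat_comp, mat_loopValue_id, map_mul, map_r, map_r, h1, h2]

theorem fusion_loopValue (π : H →ₐ[k] X) (ρ : H →ₐ[k] A) (σ : H →ₐ[k] B) :
    Fusion Q (π.toLinearMap ∘ₗ loopValue Q) ρ σ := by
  have h := fusion_relation_one Q (commuting_inFirst_inSecond (X := X) ρ σ)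
    (commuting_inFirst_inThird (B := B) ρ π) (commuting_inSecond_inThird (A := A) σ π)
  have h0 : mat₂ ρ σ ((π.toLinearMap ∘ₗ loopValue Q) ∘ₗ LinearMap.mul' k (RestrictedDual k H)) =
    assocHom k A B X (mat (tensorRep ρ σ) (π.toLinearMap ∘ₗ loopValue Q)) := mat₂_comp_mul _ _ _
  rw [Fusion, h0]
  simp only [mat_loopValue, map_mul, map_r]
  rw [assocHom_comp_onMat, assocHom_comp_inVal, skipMiddle_comp_onMat, skipMiddle_comp_inVal,
    skipFirst_comp_onMat, skipFirst_comp_inVal]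
  exact h

theorem map_loopValue_mul (π : H →ₐ[k] X) (φ ψ : RestrictedDual k H) :
    π (loopValue Q (Q.loopMul φ ψ)) = π (loopValue Q φ) * π (loopValue Q ψ) :=
  map_loopMul_of_fusion Q (f := π.toLinearMap ∘ₗ loopValue Q)
    (fun _ _ ρ σ => fusion_loopValue Q π ρ σ) φ ψ

theorem loopValue_one : loopValue Q 1 = 1 := by
  have h1 := Q.r_convUnit_left (AlgHom.id k H)
  have h2 := Q.r_convUnit_right (AlgHom.id k H)
  have hc : Commuting ((Algebra.ofId k H).comp (Bialgebra.counitAlgHom k H)).toLinearMap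
      (AlgHom.id k H).toLinearMap := fun x y => Algebra.commutes _ _
  have h3 : convUnit k H H =
    ((Algebra.ofId k H).comp (Bialgebra.counitAlgHom k H)).toLinearMap := rfl
  have h4 : ∀ t : H ⊗[k] H, TensorProduct.lid k H ((evalDual k H 1).rTensor H t) =
      evMul (convUnit k H H) (AlgHom.id k H).toLinearMap t := fun t => by
    induction t with
    | zero => simp
    | add a b ha hb => simp only [map_add, ha, hb]
    | tmul x y => simp [evalDual_one, convUnit_apply, Algebra.smul_def]
  refine (h4 ((Q.R : H ⊗[k] H) * Q.R')).trans ?_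
  rw [h3, evMul_mul _ _ hc, Quasitriangular.R', evMul_comm hc, ← h3]
  exact (congrArg₂ (· * ·) h1 h2).trans (mul_one 1)

/-- `R R'` commutes with coproducts, each factor exchanging `Δ` and `Δᵒᵖ`. -/
theorem moment_loopValue (φ : RestrictedDual k H) (x : H) :
    loopValue Q φ * x = conv LinearMap.id (loopValue Q ∘ₗ (coad (k := k) (H := H)).flip φ) x := by
  refine moment_of_mat (D := LinearMap.id) (fun n ρ => ?_) φ x
  rw [mat_loopValue_id]
  exact double_r_intertwines Q (commuting_inVal ρ (AlgHom.id k H))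

end Loop

/-! ### Commutation rules in a smash product -/

namespace Smash
variable {k K A : Type*} [Field k] [Ring K] [Bialgebra k K] [Ring A] [Algebra k A]
  (α : ModuleAlgebra k K A)

theorem ofTensor_mul_repr {ι : Type*} (a b : A) (x y : K) (r : Coalgebra.Repr k x ι) :
    ofTensor α (a ⊗ₜ x) * ofTensor α (b ⊗ₜ y) =
      ∑ i ∈ r.index, ofTensor α ((a * α.act (r.left i) b) ⊗ₜ[k] (r.right i * y)) :=
  (mulLin_repr α a b x y r).trans (map_sum (ofTensor α) _ _).symm

theorem ofTensor_tmul_one_mul (a b : A) (y : K) :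
    ofTensor α (a ⊗ₜ 1) * ofTensor α (b ⊗ₜ y) = ofTensor α ((a * b) ⊗ₜ y) := by
  change mulLin α (a ⊗ₜ 1) (b ⊗ₜ y) = (a * b) ⊗ₜ y
  simp [mulLin, Algebra.TensorProduct.one_def]

theorem ofTensor_mul_one_tmul (a : A) (x y : K) :
    ofTensor α (a ⊗ₜ x) * ofTensor α (1 ⊗ₜ y) = ofTensor α (a ⊗ₜ (x * y)) := by
  rw [ofTensor_mul_repr α a 1 x y (Coalgebra.Repr.arbitrary k x), ← map_sum]
  simp only [α.act_one, mul_smul_comm, mul_one, TensorProduct.smul_tmul, ← smul_mul_assoc,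
    ← TensorProduct.tmul_sum, ← Finset.sum_mul, Coalgebra.sum_counit_smul]

/-- `a ↦ a # 1` -/
def left : A →ₐ[k] Smash α :=
  AlgHom.ofLinearMap (ofTensor α ∘ₗ (TensorProduct.mk k A K).flip 1) rfl
    fun a b => (ofTensor_tmul_one_mul α a b 1).symm

/-- `x ↦ 1 # x` -/
def right : K →ₐ[k] Smash α :=
  AlgHom.ofLinearMap (ofTensor α ∘ₗ TensorProduct.mk k A K 1) rfl
    fun x y => (ofTensor_mul_one_tmul α 1 x y).symm

theorem left_apply (a : A) : left α a = ofTensor α (a ⊗ₜ 1) := rfl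

theorem right_apply (x : K) : right α x = ofTensor α (1 ⊗ₜ x) := rfl

theorem left_mul_right (a : A) (x : K) : left α a * right α x = ofTensor α (a ⊗ₜ x) := by
  rw [left_apply, right_apply, ofTensor_mul_one_tmul, one_mul]

theorem right_mul_left_repr {ι : Type*} (x : K) (b : A) (r : Coalgebra.Repr k x ι) :
    right α x * left α b = ∑ i ∈ r.index, left α (α.act (r.left i) b) * right α (r.right i) := by
  rw [left_apply, right_apply, ofTensor_mul_repr α 1 b x 1 r]
  simp only [left_mul_right, one_mul, mul_one]

theorem right_mul_left (x : K) (b : A) : right α x * left α b =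
    LinearMap.mul' k (Smash α) (TensorProduct.map
      ((left α).toLinearMap ∘ₗ α.act.toLinearMap.flip b) (right α).toLinearMap
      (Coalgebra.comul x)) := by
  let r := Coalgebra.Repr.arbitrary k x
  rw [right_mul_left_repr α x b r, ← r.eq]
  simp

end Smash

/-! ### The matrix `T` of `H°` in the Heisenberg double -/

section Heisenberg
variable {k : Type u} {H : Type v} [Field k] [Ring H] [HopfAlgebra k H] [BijectiveAntipode k H]
  {A : Type*} [Ring A] [Algebra k A] [Module.Finite k A]
  {B : Type*} [Ring B] [Algebra k B] [Module.Finite k B]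

variable (k H) in
/-- `φ ↦ φ # (1 ⊗ 1)` -/
def heisFun : RestrictedDual k H →ₐ[k] HeisenbergDouble k H := Smash.left (heisModuleAlgebra k H)

variable (k H) in
/-- `h ↦ ε # (h ⊗ 1)`, as a morphism of algebras. -/
def heisLeftHom : H →ₐ[k] HeisenbergDouble k H :=
  (Smash.right (heisModuleAlgebra k H)).comp Algebra.TensorProduct.includeLeft

variable (k H) in
/-- `h ↦ ε # (1 ⊗ h)`, as a morphism of algebras. -/
def heisTildeHom : H →ₐ[k] HeisenbergDouble k H :=
  (Smash.right (heisModuleAlgebra k H)).comp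
    ((Algebra.TensorProduct.includeRight : Cop H →ₐ[k] H ⊗[k] Cop H).comp
      (toCop (k := k) (H := H)).toAlgHom)

theorem heisDiag_eq_conv : heisDiag k H =
    conv (heisTildeHom k H).toLinearMap (heisLeftHom k H).toLinearMap := rfl

theorem commuting_heisTilde_heisLeft :
    Commuting (heisTildeHom k H).toLinearMap (heisLeftHom k H).toLinearMap := fun x y => by
  change Smash.right (heisModuleAlgebra k H) (1 ⊗ₜ toCop (k := k) x) *
    Smash.right (heisModuleAlgebra k H) (y ⊗ₜ 1) = Smash.right (heisModuleAlgebra k H) (y ⊗ₜ 1) *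
      Smash.right (heisModuleAlgebra k H) (1 ⊗ₜ toCop (k := k) x)
  rw [← map_mul, ← map_mul, Algebra.TensorProduct.tmul_mul_tmul,
    Algebra.TensorProduct.tmul_mul_tmul, one_mul, mul_one, one_mul, mul_one]

variable (k H) in
/-- `h ↦ ∑ h̃₁ h₂`, as a morphism of algebras. -/
def heisDiagHom : H →ₐ[k] HeisenbergDouble k H :=
  convHom (heisTildeHom k H) (heisLeftHom k H) commuting_heisTilde_heisLeft

theorem heisDiagHom_coe : (heisDiagHom k H).toLinearMap = heisDiag k H := convHom_coe _ _ _

theorem heisIncl_tmul (φ : RestrictedDual k H) (h : H) :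
    heisIncl k H (φ ⊗ₜ h) = heisFun k H φ * heisLeftHom k H h :=
  (Smash.left_mul_right (heisModuleAlgebra k H) φ (h ⊗ₜ 1)).symm

theorem heisLeft_mul_heisFun {ι : Type*} (h : H) (φ : RestrictedDual k H)
    (r : Coalgebra.Repr k h ι) : heisLeftHom k H h * heisFun k H φ =
      ∑ i ∈ r.index, heisFun k H (coreg k H (r.left i ⊗ₜ 1) φ) * heisLeftHom k H (r.right i) := by
  have h1 := Smash.right_mul_left (heisModuleAlgebra k H) (h ⊗ₜ 1) φ
  rw [TensorProduct.comul_tmul, Bialgebra.comul_one, ← r.eq] at h1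
  refine h1.trans ?_
  simp only [TensorProduct.sum_tmul, map_sum, Algebra.TensorProduct.one_def,
    TensorProduct.AlgebraTensorModule.tensorTensorTensorComm_tmul, TensorProduct.map_tmul,
    LinearMap.mul'_apply]
  refine Finset.sum_congr rfl fun i _ => ?_
  refine congrArg (fun ψ => heisFun k H ψ * heisLeftHom k H (r.right i)) ?_
  refine dual_ext fun x => ?_
  change evalDual k H (heisAct k H (r.left i ⊗ₜ toCop (k := k) (1 : H)) φ) x = _
  rw [evalDual_heisAct, antipodeInv_one, evalDual_coreg]

theorem heisTilde_mul_heisFun {ι : Type*} (h : H) (φ : RestrictedDual k H)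
    (r : Coalgebra.Repr k h ι) : heisTildeHom k H h * heisFun k H φ =
      ∑ i ∈ r.index, heisFun k H (coreg k H (1 ⊗ₜ antipodeInv k H (r.right i)) φ) *
        heisTildeHom k H (r.left i) := by
  have h1 := Smash.right_mul_left (heisModuleAlgebra k H) (1 ⊗ₜ toCop (k := k) h) φ
  rw [TensorProduct.comul_tmul, Bialgebra.comul_one, comul_toCop, ← r.eq] at h1
  refine h1.trans ?_
  simp only [TensorProduct.tmul_sum, map_sum, Algebra.TensorProduct.one_def,
    TensorProduct.AlgebraTensorModule.tensorTensorTensorComm_tmul, TensorProduct.map_tmul,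
    LinearMap.mul'_apply, TensorProduct.comm_tmul]
  refine Finset.sum_congr rfl fun i _ => ?_
  refine congrArg (fun ψ => heisFun k H ψ * heisTildeHom k H (r.left i)) ?_
  refine dual_ext fun x => ?_
  refine (evalDual_heisAct _ _ _ _).trans ?_
  rw [evalDual_coreg]

/-- The matrix of the inclusion of `H°` in its Heisenberg double. -/
def heisMat (ρ : H →ₐ[k] A) : A ⊗[k] HeisenbergDouble k H := mat ρ (heisFun k H).toLinearMap

/-- The matrix form of `h φ = ∑ (h₁ ▷ φ) h₂`. -/
theorem heisMat_intertwines (ρ : H →ₐ[k] A) : Intertwines (heisMat ρ)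
    (conv (onMat _ ρ).toLinearMap (inVal A (heisLeftHom k H)).toLinearMap)
    (inVal A (heisLeftHom k H)).toLinearMap := fun h => by
  let r := Coalgebra.Repr.arbitrary k h
  have h1 : LinearMap.mulLeft k (heisLeftHom k H h) ∘ₗ (heisFun k H).toLinearMap =
      ∑ i ∈ r.index, LinearMap.mulRight k (heisLeftHom k H (r.right i)) ∘ₗ
        ((heisFun k H).toLinearMap ∘ₗ coreg k H (r.left i ⊗ₜ 1)) := by
    refine LinearMap.ext fun φ => ?_
    simpa using heisLeft_mul_heisFun h φ r
  have h2 := congrArg (mat ρ) h1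
  simp only [map_sum, mat_mulLeft, mat_mulRight, mat_coreg, map_one,
    ← Algebra.TensorProduct.one_def, one_mul] at h2
  refine Eq.trans ?_ h2.symm
  rw [conv_apply, ← r.eq, map_sum, Finset.mul_sum]
  refine Finset.sum_congr rfl fun i _ => ?_
  rw [evMul_tmul, ← mul_assoc]
  rfl

theorem antipodeInv_mul_rev (x : H) : LinearMap.mul' k H (TensorProduct.comm k H H
    ((antipodeInv k H).rTensor H (Coalgebra.comul x))) =
      algebraMap k H (Coalgebra.counit x) := by
  apply (BijectiveAntipode.bijective (k := k) (H := H)).1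
  have h1 : ∀ t : H ⊗[k] H, HopfAlgebra.antipode k (LinearMap.mul' k H (TensorProduct.comm k H H
      ((antipodeInv k H).rTensor H t))) =
      LinearMap.mul' k H ((HopfAlgebra.antipode k).lTensor H t) := fun t => by
    induction t with
    | zero => simp
    | add a b ha hb => simp only [map_add, ha, hb]
    | tmul a b => simp [HopfAlgebra.antipode_mul_antidistrib, antipode_antipodeInv]
  rw [h1, HopfAlgebra.mul_antipode_lTensor_comul_apply, Algebra.algebraMap_eq_smul_one, map_smul,
    HopfAlgebra.antipode_one]

/-- The hypothesis is `t(x) T = ∑ i(S⁻¹(x₂)) T t(x₁)`. Multiplying by one more leg of the coproduct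
under `i` and using `∑ x₂ S⁻¹(x₁) = ε(x)` solves it for `T t(x)`. -/
theorem intertwines_of_antipodeInv {E : Type*} [Ring E] [Algebra k E] {i t : H →ₐ[k] E}
    (hti : Commuting t.toLinearMap i.toLinearMap) {T : E}
    (h : ∀ x, t x * T = LinearMap.mul' k E (TensorProduct.map
      (LinearMap.mulRight k T ∘ₗ i.toLinearMap ∘ₗ antipodeInv k H) t.toLinearMap
        (TensorProduct.comm k H H (Coalgebra.comul x)))) :
    Intertwines T t.toLinearMap (conv t.toLinearMap i.toLinearMap) := fun x => by
  let Ω : H ⊗[k] (H ⊗[k] H) →ₗ[k] E :=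
    LinearMap.mul' k E ∘ₗ (TensorProduct.comm k E E).toLinearMap ∘ₗ
      TensorProduct.map t.toLinearMap (LinearMap.mulRight k T ∘ₗ i.toLinearMap ∘ₗ
        LinearMap.mul' k H ∘ₗ (TensorProduct.comm k H H).toLinearMap ∘ₗ
          (antipodeInv k H).rTensor H)
  have h1 : ∀ s : H ⊗[k] H, Ω ((Coalgebra.comul : H →ₗ[k] H ⊗[k] H).lTensor H s) =
      T * t (TensorProduct.rid k H ((Coalgebra.counit : H →ₗ[k] k).lTensor H s)) := fun s => by
    induction s with
    | zero => simp
    | add a b ha hb => simp only [map_add, mul_add, ha, hb]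
    | tmul a b =>
      have := antipodeInv_mul_rev (k := k) b
      simp only [Ω, LinearMap.comp_apply, LinearMap.lTensor_tmul, TensorProduct.map_tmul,
        LinearEquiv.coe_coe, TensorProduct.comm_tmul, LinearMap.mul'_apply, this]
      simp [Algebra.algebraMap_eq_smul_one]
  have h2 : ∀ s : H ⊗[k] H, Ω (TensorProduct.assoc k H H H
      ((Coalgebra.comul : H →ₗ[k] H ⊗[k] H).rTensor H s)) =
      evMul t.toLinearMap i.toLinearMap s * T := fun s => by
    induction s with
    | zero => simp
    | add a b ha hb => simp only [map_add, add_mul, ha, hb]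
    | tmul a b =>
      rw [evMul_tmul, hti a b, mul_assoc, AlgHom.toLinearMap_apply, AlgHom.toLinearMap_apply, h,
        LinearMap.rTensor_tmul]
      induction (Coalgebra.comul a : H ⊗[k] H) with
      | zero => simp
      | add x y hx hy => simp only [map_add, mul_add, TensorProduct.add_tmul, hx, hy]
      | tmul x y => simp [Ω, mul_assoc]
  rw [conv_apply, ← h2, Coalgebra.coassoc_apply, h1, Coalgebra.lTensor_counit_comul]
  simp

/-- The matrix form of `h̃ φ = ∑ (φ ◁ S⁻¹(h₂)) h̃₁`, solved for `T h̃`. -/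
theorem heisMat_intertwines_tilde (ρ : H →ₐ[k] A) : Intertwines (heisMat ρ)
    (inVal A (heisTildeHom k H)).toLinearMap
    (conv (inVal A (heisTildeHom k H)).toLinearMap (onMat _ ρ).toLinearMap) := by
  refine intertwines_of_antipodeInv (commuting_inVal ρ (heisTildeHom k H)).symm fun h => ?_
  let r := Coalgebra.Repr.arbitrary k h
  have h1 : LinearMap.mulLeft k (heisTildeHom k H h) ∘ₗ (heisFun k H).toLinearMap =
      ∑ i ∈ r.index, LinearMap.mulRight k (heisTildeHom k H (r.left i)) ∘ₗ
        ((heisFun k H).toLinearMap ∘ₗ coreg k H (1 ⊗ₜ antipodeInv k H (r.right i))) := by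
    refine LinearMap.ext fun φ => ?_
    simpa using heisTilde_mul_heisFun h φ r
  have h2 := congrArg (mat ρ) h1
  simp only [map_sum, mat_mulLeft, mat_mulRight, mat_coreg, map_one,
    ← Algebra.TensorProduct.one_def, mul_one] at h2
  refine h2.trans ?_
  rw [← r.eq]
  simp only [map_sum, TensorProduct.comm_tmul, TensorProduct.map_tmul, LinearMap.mul'_apply]
  rfl

/-- `φ ↦ φ # (1 ⊗ 1)` is multiplicative for `⋆`, so `T` in a tensor product of representations is
`T₁ T₂`. -/
theorem mat₂_heisFun (ρ : H →ₐ[k] A) (σ : H →ₐ[k] B) :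
    assocHom k A B (HeisenbergDouble k H) (heisMat (tensorRep ρ σ)) =
      skipMiddle A B _ (heisMat ρ) * skipFirst A B _ (heisMat σ) := by
  have h := mat₂_mul ρ σ (heisFun k H).toLinearMap (heisFun k H).toLinearMap
  refine Eq.trans ?_ h
  refine (mat₂_comp_mul ρ σ (heisFun k H).toLinearMap).symm.trans ?_
  congr 1
  refine TensorProduct.ext' fun φ ψ => ?_
  simp

end Heisenberg

/-! ### The morphism `Φ_{1,0}`: its values on the two factors -/

section Handle
variable {k : Type u} {H : Type v} [Field k] [Ring H] [HopfAlgebra k H] [BijectiveAntipode k H]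
  (Q : Quasitriangular k H)
  {A : Type*} [Ring A] [Algebra k A] [Module.Finite k A]
  {B : Type*} [Ring B] [Algebra k B] [Module.Finite k B]

/-- The linear map `β ↦ (x ▷ β ◁ y) z`, for `(x ⊗ y) ⊗ z` in `(H ⊗ H) ⊗ H`. -/
def heisCoreg : (H ⊗[k] H) ⊗[k] H →ₗ[k] RestrictedDual k H →ₗ[k] HeisenbergDouble k H :=
  TensorProduct.lift (LinearMap.mk₂ k
    (fun s z => LinearMap.mulRight k (heisLeftHom k H z) ∘ₗ (heisFun k H).toLinearMap ∘ₗ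
      coreg k H s)
    (fun s s' z => by ext; simp [add_mul]) (fun c s z => by ext; simp)
    (fun s z z' => by ext; simp [mul_add]) (fun c s z => by ext; simp))

theorem heisCoreg_tmul (s : H ⊗[k] H) (z : H) : heisCoreg (s ⊗ₜ z) =
    LinearMap.mulRight k (heisLeftHom k H z) ∘ₗ ((heisFun k H).toLinearMap ∘ₗ coreg k H s) := by
  rw [heisCoreg, TensorProduct.lift.tmul]
  rfl

/-- The element `R₂₃ R₂₁ R₃₁`. -/
def handleTensor : (H ⊗[k] H) ⊗[k] H := leg23 k H Q.R * leg12 k H Q.R' * leg13 k H Q.R'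

/-- `β ↦ Φ_{1,0}(β ⊗ 1)` -/
def handleValue : RestrictedDual k H →ₗ[k] HeisenbergDouble k H := heisCoreg (handleTensor Q)

/-- `α ↦ Φ_{0,1}(α)`, with values in the Heisenberg double. -/
def heisLoopValue : RestrictedDual k H →ₗ[k] HeisenbergDouble k H :=
  (heisLeftHom k H).toLinearMap ∘ₗ loopValue Q

theorem heisIncl_map₂_coreg (θ : (H ⊗[k] H) ⊗[k] H) (β α : RestrictedDual k H) :
    heisIncl k H (TensorProduct.map₂ (coreg k H) ((LinearMap.mul k H).compl₂ (loopValue Q)) θ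
      (β ⊗ₜ α)) = heisCoreg θ β * heisLoopValue Q α := by
  induction θ with
  | zero => simp
  | add a b ha hb => simp only [map_add, LinearMap.add_apply, add_mul, ha, hb]
  | tmul s z =>
    rw [TensorProduct.map₂_apply_tmul, TensorProduct.map_tmul, heisIncl_tmul, heisCoreg_tmul]
    simp [heisLoopValue, mul_assoc]

theorem Φ10_tmul (β α : RestrictedDual k H) :
    Q.Φ10 (β ⊗ₜ[k] α : RestrictedDual k H ⊗[k] RestrictedDual k H) =
      handleValue Q β * heisLoopValue Q α :=
  heisIncl_map₂_coreg Q (handleTensor Q) β α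

/-- The linear map `(x ⊗ y) ⊗ z ↦ i(y) T i(x) l(z)`. -/
def dress {E : Type*} [Ring E] [Algebra k E] (i l : H →ₐ[k] E) (T : E) :
    (H ⊗[k] H) ⊗[k] H →ₗ[k] E :=
  LinearMap.mul' k E ∘ₗ TensorProduct.map
    (LinearMap.mul' k E ∘ₗ (TensorProduct.comm k E E).toLinearMap ∘ₗ
      TensorProduct.map (LinearMap.mulLeft k T ∘ₗ i.toLinearMap) i.toLinearMap) l.toLinearMap

theorem dress_tmul {E : Type*} [Ring E] [Algebra k E] (i l : H →ₐ[k] E) (T : E) (x y z : H) :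
    dress i l T ((x ⊗ₜ y) ⊗ₜ z) = i y * (T * i x) * l z := by
  simp [dress]

theorem mat_heisCoreg (ρ : H →ₐ[k] A) (θ : (H ⊗[k] H) ⊗[k] H) :
    mat ρ (heisCoreg θ) = dress (onMat _ ρ) (inVal A (heisLeftHom k H)) (heisMat ρ) θ := by
  induction θ with
  | zero => simp
  | add a b ha hb => simp only [map_add, ha, hb]
  | tmul s z =>
  induction s with
  | zero => simp
  | add a b ha hb => simp only [map_add, TensorProduct.add_tmul, ha, hb]
  | tmul x y =>
    rw [dress_tmul, heisCoreg_tmul, mat_mulRight, mat_coreg, ← mul_assoc]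
    rfl

section Dress
variable {E : Type*} [Ring E] [Algebra k E] {i l : H →ₐ[k] E} {T : E}

/-- The bilinear map `(a ⊗ b, c ⊗ d) ↦ i(ac) T i(d) l(b)`. -/
def dressPair (i l : H →ₐ[k] E) (T : E) : H ⊗[k] H →ₗ[k] H ⊗[k] H →ₗ[k] E :=
  TensorProduct.lift (LinearMap.mk₂ k
    (fun a b => LinearMap.mulLeft k (i a) ∘ₗ LinearMap.mulRight k (l b) ∘ₗ
      evMul i.toLinearMap (LinearMap.mulLeft k T ∘ₗ i.toLinearMap))
    (fun a a' b => by ext; simp [add_mul]) (fun c a b => by ext; simp)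
    (fun a b b' => by ext; simp [mul_add]) (fun c a b => by ext; simp))

theorem dressPair_tmul (a b c d : H) :
    dressPair i l T (a ⊗ₜ b) (c ⊗ₜ d) = i a * (i c * (T * i d) * l b) := by
  simp [dressPair, evMul_tmul]

/-- Separates the third `R` from the first two: its factors can be collected at the far right
because `i` and `l` commute. -/
theorem dress_legs (hil : Commuting i.toLinearMap l.toLinearMap) (s t u : H ⊗[k] H) :
    dress i l T (leg23 k H s * leg12 k H (flip k H t) * leg13 k H (flip k H u)) =
      dressPair i l T s t * evMul l.toLinearMap i.toLinearMap u := by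
  induction s with
  | zero => simp
  | add a b ha hb => simp only [map_add, add_mul, LinearMap.add_apply, ha, hb]
  | tmul a b =>
  induction t with
  | zero => simp
  | add x y hx hy => simp only [map_add, add_mul, mul_add, hx, hy]
  | tmul c d =>
  induction u with
  | zero => simp
  | add x y hx hy => simp only [map_add, mul_add, hx, hy]
  | tmul e f =>
    have h1 : leg23 k H (a ⊗ₜ b) * leg12 k H (flip k H (c ⊗ₜ d)) * leg13 k H (flip k H (e ⊗ₜ f)) =
        ((d * f) ⊗ₜ (a * c)) ⊗ₜ (b * e) := by
      simp [leg23, leg12, leg13, flip]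
    have h2 : i f * l b = l b * i f := hil f b
    have h3 : i f * l e = l e * i f := hil f e
    rw [h1, dress_tmul, dressPair_tmul, evMul_tmul]
    simp only [map_mul, AlgHom.toLinearMap_apply, mul_assoc]
    rw [← mul_assoc (i f), h2, mul_assoc, h3]

/-- By `(id ⊗ Δ)(R) = R₁₃R₁₂` the two copies of `R` merge into one, whose second leg appears as `T ∑
i(y₁) l(y₂)`. The relation of `T` turns this into `l(y) T`. -/
theorem dressPair_R (hT : Intertwines T (conv i.toLinearMap l.toLinearMap) l.toLinearMap) :
    dressPair i l T (Q.R : H ⊗[k] H) (Q.R : H ⊗[k] H) =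
      Q.r i.toLinearMap l.toLinearMap * T := by
  let W : H →ₗ[k] E := LinearMap.mulRight k T ∘ₗ l.toLinearMap
  let Ψ : (H ⊗[k] H) ⊗[k] H →ₗ[k] E :=
    LinearMap.mul' k E ∘ₗ TensorProduct.map (evMul i.toLinearMap
      (LinearMap.mulLeft k T ∘ₗ i.toLinearMap)) l.toLinearMap
  have h1 := Q.comul_right_apply Ψ (evMul i.toLinearMap W) (dressPair i l T) (fun x y => ?_)
    (fun a b c d => ?_)
  · rw [← h1, Quasitriangular.r]
    induction (Q.R : H ⊗[k] H) with
    | zero => simp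
    | add a b ha hb => simp only [map_add, add_mul, ha, hb]
    | tmul a b => simp [evMul_tmul, W, mul_assoc]
  · have h2 : W y = T * conv i.toLinearMap l.toLinearMap y := (hT y).symm
    rw [evMul_tmul, h2, conv_apply]
    induction (Coalgebra.comul y : H ⊗[k] H) with
    | zero => simp
    | add a b ha hb => simp only [map_add, mul_add, TensorProduct.tmul_add, ha, hb]
    | tmul a b => simp [Ψ, evMul_tmul, mul_assoc]
  · rw [dressPair_tmul]
    simp [Ψ, evMul_tmul, mul_assoc]

end Dress

/-- The reason for the three `R`-matrices in `Φ_{1,0}`: two of them produce the `R` before `T` and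
the third the `R'` after it. -/
theorem mat_handleValue (ρ : H →ₐ[k] A) : mat ρ (handleValue Q) =
    Q.r (onMat _ ρ).toLinearMap (inVal A (heisLeftHom k H)).toLinearMap * heisMat ρ *
      Q.r (inVal A (heisLeftHom k H)).toLinearMap (onMat _ ρ).toLinearMap := by
  rw [handleValue, mat_heisCoreg, handleTensor, Quasitriangular.R',
    dress_legs (commuting_inVal ρ _), dressPair_R Q (heisMat_intertwines ρ)]
  rfl

theorem mat_heisLoopValue (ρ : H →ₐ[k] A) : mat ρ (heisLoopValue Q) =
    Q.r (onMat _ ρ).toLinearMap (inVal A (heisLeftHom k H)).toLinearMap *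
      Q.r (inVal A (heisLeftHom k H)).toLinearMap (onMat _ ρ).toLinearMap :=
  mat_loopValue Q ρ _

theorem intertwines_map {X Y : Type*} [Ring X] [Algebra k X] [Ring Y] [Algebra k Y]
    (π : X →ₐ[k] Y) {x : X} {f g : H →ₗ[k] X} (h : Intertwines x f g) :
    Intertwines (π x) (π.toLinearMap ∘ₗ f) (π.toLinearMap ∘ₗ g) := fun y => by
  simpa using congrArg π (h y)

section TwoMatrices
variable (ρ : H →ₐ[k] A) (σ : H →ₐ[k] B)

theorem skipMiddle_heisMat_intertwines : Intertwines (skipMiddle A B _ (heisMat ρ))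
    (conv (inFirst B _ ρ).toLinearMap (inThird A B (heisLeftHom k H)).toLinearMap)
    (inThird A B (heisLeftHom k H)).toLinearMap := by
  have h := intertwines_map (skipMiddle (k := k) A B (HeisenbergDouble k H))
    (heisMat_intertwines ρ)
  rwa [conv_comp, skipMiddle_comp_onMat, skipMiddle_comp_inVal] at h

theorem skipFirst_heisMat_intertwines : Intertwines (skipFirst A B _ (heisMat σ))
    (conv (inSecond A _ σ).toLinearMap (inThird A B (heisLeftHom k H)).toLinearMap)
    (inThird A B (heisLeftHom k H)).toLinearMap := by
  have h := intertwines_map (skipFirst (k := k) A B (HeisenbergDouble k H))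
    (heisMat_intertwines σ)
  rwa [conv_comp, skipFirst_comp_onMat, skipFirst_comp_inVal] at h

theorem fusion_handleValue : Fusion Q (handleValue Q) ρ σ := by
  have h := fusion_relation Q (commuting_inFirst_inSecond (X := HeisenbergDouble k H) ρ σ)
    (commuting_inFirst_inThird (B := B) ρ (heisLeftHom k H))
    (commuting_inSecond_inThird (A := A) σ (heisLeftHom k H))
    (skipMiddle_heisMat_intertwines ρ)
    (fun x => inSecond_commute_skipMiddle σ _ x)
    (skipFirst_heisMat_intertwines σ)
    (fun x => inFirst_commute_skipFirst ρ _ x)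
  have h0 : mat₂ ρ σ (handleValue Q ∘ₗ LinearMap.mul' k (RestrictedDual k H)) =
    assocHom k A B _ (mat (tensorRep ρ σ) (handleValue Q)) := mat₂_comp_mul _ _ _
  rw [Fusion, h0]
  simp only [mat_handleValue, map_mul, map_r]
  rw [assocHom_comp_onMat, assocHom_comp_inVal, skipMiddle_comp_onMat, skipMiddle_comp_inVal,
    skipFirst_comp_onMat, skipFirst_comp_inVal, mat₂_heisFun]
  exact h

theorem exchange_handleValue : Exchange Q (heisLoopValue Q) (handleValue Q) ρ σ := by
  have h := exchange_relation Q (commuting_inFirst_inSecond (X := HeisenbergDouble k H) ρ σ)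
    (commuting_inFirst_inThird (B := B) ρ (heisLeftHom k H))
    (commuting_inSecond_inThird (A := A) σ (heisLeftHom k H))
    (skipFirst_heisMat_intertwines σ)
    (fun x => inFirst_commute_skipFirst ρ _ x)
  rw [Exchange]
  simp only [mat_handleValue, mat_heisLoopValue, map_mul, map_r]
  rw [skipMiddle_comp_onMat, skipMiddle_comp_inVal,
    skipFirst_comp_onMat, skipFirst_comp_inVal]
  exact h

end TwoMatrices

theorem handleValue_loopMul (φ ψ : RestrictedDual k H) :
    handleValue Q (Q.loopMul φ ψ) = handleValue Q φ * handleValue Q ψ :=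
  map_loopMul_of_fusion Q (fun _ _ ρ σ => fusion_handleValue Q ρ σ) φ ψ

theorem heisLoopValue_loopMul (φ ψ : RestrictedDual k H) :
    heisLoopValue Q (Q.loopMul φ ψ) = heisLoopValue Q φ * heisLoopValue Q ψ :=
  map_loopValue_mul Q (heisLeftHom k H) φ ψ

theorem heisLoopValue_mul_handleValue (φ ψ : RestrictedDual k H) :
    heisLoopValue Q φ * handleValue Q ψ = LinearMap.mul' k _
      (TensorProduct.map (handleValue Q) (heisLoopValue Q) (TensorProduct.comm k _ _
        (TensorProduct.map₂ dualAct dualAct Q.γ (φ ⊗ₜ ψ)))) :=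
  exchange_of_mat Q (fun _ _ ρ σ => exchange_handleValue Q ρ σ) φ ψ

theorem heisLoopValue_one : heisLoopValue Q 1 = 1 := by
  rw [heisLoopValue, LinearMap.comp_apply, loopValue_one, AlgHom.toLinearMap_apply, map_one]

theorem coreg_unit (s : H ⊗[k] H) : coreg k H s (1 : RestrictedDual k H) =
    Bialgebra.counitAlgHom k (H ⊗[k] H) s • (1 : RestrictedDual k H) := by
  induction s with
  | zero => simp
  | add a b ha hb => simp only [map_add, LinearMap.add_apply, add_smul, ha, hb]
  | tmul a b =>
    refine dual_ext fun h => ?_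
    rw [evalDual_coreg, map_smul, LinearMap.smul_apply, evalDual_one, evalDual_one]
    simp only [Bialgebra.counit_mul, Bialgebra.counitAlgHom_apply,
      TensorProduct.counit_tmul, smul_eq_mul]
    ring

variable (k H) in
/-- `(x ⊗ y) ⊗ z ↦ ε(x) ε(y) z` -/
def counitFirstTwo : (H ⊗[k] H) ⊗[k] H →ₐ[k] H :=
  (Algebra.TensorProduct.lid k H).toAlgHom.comp
    (Algebra.TensorProduct.map (Bialgebra.counitAlgHom k (H ⊗[k] H)) (AlgHom.id k H))

theorem counitFirstTwo_tmul (x y z : H) : counitFirstTwo k H ((x ⊗ₜ y) ⊗ₜ z) =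
    (Coalgebra.counit (R := k) y * Coalgebra.counit (R := k) x) • z := by
  simp [counitFirstTwo]

theorem heisCoreg_one (θ : (H ⊗[k] H) ⊗[k] H) :
    heisCoreg θ 1 = heisLeftHom k H (counitFirstTwo k H θ) := by
  induction θ with
  | zero => simp
  | add a b ha hb => simp only [map_add, LinearMap.add_apply, ha, hb]
  | tmul s z =>
    rw [heisCoreg_tmul, LinearMap.comp_apply, LinearMap.comp_apply, coreg_unit]
    simp [counitFirstTwo]

/-- The contraction is an algebra morphism, so each of the three factors collapses separately to `1`
by a counit identity of `R`. -/
theorem counitFirstTwo_handleTensor : counitFirstTwo k H (handleTensor Q) = 1 := by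
  have hl := Q.r_convUnit_left (AlgHom.id k H)
  have hr := Q.r_convUnit_right (AlgHom.id k H)
  have hc : Commuting (convUnit k H H) (AlgHom.id k H).toLinearMap :=
    fun x y => Algebra.commutes _ _
  have h23 : ∀ t, counitFirstTwo k H (leg23 k H t) =
      evMul (convUnit k H H) (AlgHom.id k H).toLinearMap t := fun t => by
    induction t with
    | zero => simp
    | add a b ha hb => simp only [map_add, ha, hb]
    | tmul x y => simp [leg23, counitFirstTwo_tmul, convUnit_apply, Algebra.smul_def]
  have h13 : ∀ t, counitFirstTwo k H (leg13 k H t) =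
      evMul (convUnit k H H) (AlgHom.id k H).toLinearMap t := fun t => by
    induction t with
    | zero => simp
    | add a b ha hb => simp only [map_add, ha, hb]
    | tmul x y => simp [leg13, counitFirstTwo_tmul, convUnit_apply, Algebra.smul_def]
  have h12 : ∀ t, counitFirstTwo k H (leg12 k H t) = algebraMap k H
      (Coalgebra.counit (evMul (convUnit k H H) (AlgHom.id k H).toLinearMap t)) := fun t => by
    induction t with
    | zero => simp
    | add a b ha hb => simp only [map_add, ha, hb]
    | tmul x y =>
      refine (counitFirstTwo_tmul x y 1).trans ?_
      rw [evMul_tmul, convUnit_apply, Bialgebra.counit_mul, mul_comm, Algebra.smul_def, mul_one]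
      congr 2
      simp
  rw [Quasitriangular.r] at hl hr
  rw [handleTensor, map_mul, map_mul, h23, h12, h13, Quasitriangular.R', evMul_comm hc, hl, hr]
  simp

theorem handleValue_one : handleValue Q 1 = 1 := by
  rw [handleValue, heisCoreg_one, counitFirstTwo_handleTensor, map_one]

theorem moment_heisLoopValue (φ : RestrictedDual k H) (x : H) :
    heisLoopValue Q φ * heisDiag k H x =
      conv (heisDiag k H) (heisLoopValue Q ∘ₗ (coad (k := k) (H := H)).flip φ) x := by
  refine moment_of_mat (D := heisDiag k H) (fun n ρ => ?_) φ x
  rw [mat_heisLoopValue, heisDiag_eq_conv]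
  have h := double_r_intertwines_conv Q (commuting_inVal ρ (heisLeftHom k H))
    (commuting_inVal ρ (heisTildeHom k H)).symm (fun x y => ?_)
  · rwa [onVal, conv_comp]
  · exact (commuting_heisTilde_heisLeft x y).map Algebra.TensorProduct.includeRight

theorem moment_handleValue (φ : RestrictedDual k H) (x : H) :
    handleValue Q φ * heisDiag k H x =
      conv (heisDiag k H) (handleValue Q ∘ₗ (coad (k := k) (H := H)).flip φ) x := by
  refine moment_of_mat (D := heisDiag k H) (fun n ρ => ?_) φ x
  rw [mat_handleValue, heisDiag_eq_conv]
  have h := dressed_intertwines Q (commuting_inVal ρ (heisLeftHom k H))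
    (commuting_inVal ρ (heisTildeHom k H)).symm (fun x y => ?_)
    (heisMat_intertwines ρ) (heisMat_intertwines_tilde ρ)
  · rwa [onVal, conv_comp]
  · exact (commuting_heisTilde_heisLeft x y).map Algebra.TensorProduct.includeRight

end Handle

/-! ### `Φ_{0,1}` and `Φ_{1,0}` satisfy the moment condition -/

section MomentHom
variable {k : Type u} {H : Type v} [Field k] [Ring H] [HopfAlgebra k H]

/-- A morphism of algebras `f : M → X` is equivariant along `D : H → X` if
`f(m) D(h) = ∑ D(h₁) f(m · h₂)`. -/
structure IsMomentHom (M : ModuleAlgebraData k H) {X : Type*} [Ring X] [Algebra k X]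
    (D : H →ₗ[k] X) (f : M.carrier →ₗ[k] X) : Prop where
  map_one : f M.one = 1
  map_mul : ∀ x y, f (M.mul x y) = f x * f y
  moment : ∀ x h, f x * D h = conv D (f ∘ₗ M.act.flip x) h

theorem loop_isMomentHom (Q : Quasitriangular k H) :
    IsMomentHom Q.L01 (AlgHom.id k H).toLinearMap Q.Φ01 where
  map_one := loopValue_one Q
  map_mul := map_loopValue_mul Q (AlgHom.id k H)
  moment := moment_loopValue Q

theorem mul_conv {E : Type*} [Ring E] [Algebra k E] (x : E) (f g : H →ₗ[k] E) (h : H) :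
    x * conv f g h = conv (LinearMap.mulLeft k x ∘ₗ f) g h := by
  rw [conv_apply, conv_apply]
  induction (Coalgebra.comul h : H ⊗[k] H) with
  | zero => simp
  | add a b ha hb => simp only [map_add, mul_add, ha, hb]
  | tmul a b => simp [mul_assoc]

/-- If `x D = D * f` and `y D = D * g` for the convolution product, then
`x y D = D * (f * g)`. -/
theorem moment_mul {E : Type*} [Ring E] [Algebra k E] {D f g : H →ₗ[k] E} {x y : E}
    (hx : ∀ h, x * D h = conv D f h) (hy : ∀ h, y * D h = conv D g h) (h : H) :
    x * y * D h = conv D (conv f g) h := by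
  have h1 : LinearMap.mulLeft k x ∘ₗ D = conv D f := LinearMap.ext hx
  rw [mul_assoc, hy, mul_conv, h1, conv_assoc]

section Handle
variable [BijectiveAntipode k H] (Q : Quasitriangular k H)

/-- `Φ_{1,0}`, on the vector space `H° ⊗ H°`. -/
def fullHandleValue : RestrictedDual k H ⊗[k] RestrictedDual k H →ₗ[k] HeisenbergDouble k H :=
  LinearMap.mul' k _ ∘ₗ TensorProduct.map (handleValue Q) (heisLoopValue Q)

theorem fullHandleValue_tmul (β α : RestrictedDual k H) :
    fullHandleValue Q (β ⊗ₜ α) = handleValue Q β * heisLoopValue Q α := by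
  simp [fullHandleValue]

theorem Φ10_eq : (Q.Φ10 : RestrictedDual k H ⊗[k] RestrictedDual k H →ₗ[k] _) =
    fullHandleValue Q :=
  TensorProduct.ext' fun β α => (Φ10_tmul Q β α).trans (fullHandleValue_tmul Q β α).symm

theorem mul'_map_mul {X : Type*} [Ring X] [Algebra k X] {V W : Type*} [AddCommGroup V]
    [Module k V] [AddCommGroup W] [Module k W] {f : V →ₗ[k] X} {g : W →ₗ[k] X}
    {F : V →ₗ[k] V} {G : W →ₗ[k] W} {x y : X} (hF : ∀ v, f (F v) = x * f v)
    (hG : ∀ w, g (G w) = g w * y) (t : V ⊗[k] W) :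
    LinearMap.mul' k X (TensorProduct.map f g (TensorProduct.map F G t)) =
      x * LinearMap.mul' k X (TensorProduct.map f g t) * y := by
  induction t with
  | zero => simp
  | add a b ha hb => simp only [map_add, mul_add, add_mul, ha, hb]
  | tmul v w => simp [hF, hG, mul_assoc]

/-- In the product of two values, the inner factors, the loop value of `α` and the handle value of
`β'`, stand in the wrong order; the exchange relation reorders them and produces `γ`. -/
theorem fullHandleValue_mul (x y : RestrictedDual k H ⊗[k] RestrictedDual k H) :
    fullHandleValue Q (twistedMul Q.loopMul Q.loopMul dualAct dualAct Q.γ x y) =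
      fullHandleValue Q x * fullHandleValue Q y := by
  induction x with
  | zero => simp
  | add a b ha hb => simp only [map_add, LinearMap.add_apply, add_mul, ha, hb]
  | tmul β α =>
  induction y with
  | zero => simp
  | add a b ha hb => simp only [map_add, mul_add, ha, hb]
  | tmul β' α' =>
    rw [twistedMul_apply, fullHandleValue, LinearMap.comp_apply,
      mul'_map_mul (x := handleValue Q β) (y := heisLoopValue Q α')
        (fun v => handleValue_loopMul Q β v) (fun w => heisLoopValue_loopMul Q w α'),
      ← heisLoopValue_mul_handleValue, ← fullHandleValue, fullHandleValue_tmul,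
      fullHandleValue_tmul]
    simp only [mul_assoc]

theorem fullHandleValue_tensorAct (β α : RestrictedDual k H) :
    fullHandleValue Q ∘ₗ (tensorAct coad coad).flip (β ⊗ₜ α) =
      conv (handleValue Q ∘ₗ (coad (k := k) (H := H)).flip β)
        (heisLoopValue Q ∘ₗ (coad (k := k) (H := H)).flip α) := by
  refine LinearMap.ext fun h => ?_
  rw [conv_apply, LinearMap.comp_apply, LinearMap.flip_apply, tensorAct, LinearMap.comp_apply]
  induction (Coalgebra.comul h : H ⊗[k] H) with
  | zero => simp
  | add a b ha hb => simp only [map_add, LinearMap.add_apply, ha, hb]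
  | tmul a b => simp [fullHandleValue_tmul]

theorem moment_fullHandleValue (x : RestrictedDual k H ⊗[k] RestrictedDual k H) (h : H) :
    fullHandleValue Q x * heisDiag k H h =
      conv (heisDiag k H) (fullHandleValue Q ∘ₗ (tensorAct coad coad).flip x) h := by
  induction x with
  | zero => simp [conv_apply, evMul]
  | add a b ha hb =>
    rw [map_add, add_mul, ha, hb, map_add, LinearMap.comp_add]
    simp only [conv_apply, evMul, TensorProduct.map_add_right, LinearMap.comp_add,
      LinearMap.add_apply]
  | tmul β α =>
    rw [fullHandleValue_tensorAct, fullHandleValue_tmul]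
    exact moment_mul (moment_handleValue Q β) (moment_heisLoopValue Q α) h

theorem handle_isMomentHom : IsMomentHom Q.L10 (heisDiag k H) Q.Φ10 := by
  have h : Q.Φ10 = fullHandleValue Q := Φ10_eq Q
  rw [h]
  refine ⟨?_, fullHandleValue_mul Q, moment_fullHandleValue Q⟩
  refine (fullHandleValue_tmul Q 1 1).trans ?_
  rw [handleValue_one, heisLoopValue_one, mul_one]

end Handle
end MomentHom

/-! ### Moving values past `R` under the moment condition -/

section Exchange
variable {k : Type*} {H : Type*} [Field k] [Ring H] [HopfAlgebra k H] (Q : Quasitriangular k H)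
  {E : Type*} [Ring E] [Algebra k E] {d : H →ₐ[k] E} {p u v : H →ₗ[k] E} {w : E}

/-- `w` passes `u(R₁)` freely and splits `d(R₂)` into `d(R₂₁) v(R₂₂)`; then `(id ⊗ Δ)(R) = R₁₃R₁₂`
gives two copies of `R`. This is the origin of the braiding in `extend_mul`. -/
theorem mul_r_of_moment (hwu : ∀ h, Commute w (u h)) (hw : ∀ h, w * d h = conv d.toLinearMap v h) :
    w * Q.r u d.toLinearMap = Q.r (Q.rLeft u d.toLinearMap) v := by
  have hd : LinearMap.mulLeft k w ∘ₗ d.toLinearMap = conv d.toLinearMap v := LinearMap.ext hw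
  rw [← Q.r_conv_right', ← hd, Quasitriangular.r, Quasitriangular.r]
  induction (Q.R : H ⊗[k] H) with
  | zero => simp
  | add a b ha hb => simp only [map_add, mul_add, ha, hb]
  | tmul a b =>
    rw [evMul_tmul, evMul_tmul, ← mul_assoc, hwu a, mul_assoc]
    rfl

theorem mul_conv_of_moment (hwp : ∀ h, Commute w (p h))
    (hw : ∀ h, w * d h = conv d.toLinearMap v h) (h : H) :
    w * conv p d.toLinearMap h = conv (conv p d.toLinearMap) v h := by
  have hd : LinearMap.mulLeft k w ∘ₗ d.toLinearMap = conv d.toLinearMap v := LinearMap.ext hw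
  rw [conv_assoc, ← hd, conv_apply, conv_apply]
  induction (Coalgebra.comul h : H ⊗[k] H) with
  | zero => simp
  | add a b ha hb => simp only [map_add, mul_add, ha, hb]
  | tmul a b =>
    rw [evMul_tmul, evMul_tmul, ← mul_assoc, hwp a, mul_assoc]
    rfl

theorem evMul_tmul_mul (hud : Commuting u d.toLinearMap) (y z : H) (t : H ⊗[k] H) :
    evMul u d.toLinearMap (z ⊗ₜ y * t) =
      d y * evMul (u ∘ₗ LinearMap.mulLeft k z) d.toLinearMap t := by
  induction t with
  | zero => simp
  | add a b ha hb => simp only [map_add, mul_add, ha, hb]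
  | tmul a b =>
    have h1 : u (z * a) * d y = d y * u (z * a) := hud _ _
    simp [evMul_tmul, ← mul_assoc, h1]

theorem evMul_mul_tmul (hpd : Commuting p d.toLinearMap)
    (hup : ∀ a h, u a * p h = conv p (u ∘ₗ LinearMap.mulLeft k a) h) (x y : H) (t : H ⊗[k] H) :
    evMul u d.toLinearMap t * (p x * d y) = LinearMap.mul' k E (TensorProduct.map p
      (evMul u d.toLinearMap ∘ₗ LinearMap.mulLeft k t ∘ₗ (TensorProduct.mk k H H).flip y)
        (Coalgebra.comul x)) := by
  induction t with
  | zero => simp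
  | add a b ha hb =>
    have h1 : LinearMap.mulLeft k (a + b) = LinearMap.mulLeft k a + LinearMap.mulLeft k b := by
      ext; simp [add_mul]
    simp only [map_add, add_mul, ha, hb, h1, LinearMap.add_comp, LinearMap.comp_add,
      TensorProduct.map_add_right, LinearMap.add_apply]
  | tmul a b =>
    have h3 : p x * d b = d b * p x := hpd x b
    rw [evMul_tmul, AlgHom.toLinearMap_apply, ← mul_assoc, mul_assoc (u a), ← h3,
      ← mul_assoc (u a), hup, mul_assoc, ← map_mul, conv_apply]
    induction (Coalgebra.comul x : H ⊗[k] H) with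
    | zero => simp
    | add c e hc he => simp only [map_add, add_mul, hc, he]
    | tmul c e => simp [evMul_tmul, mul_assoc]

/-- Moving `p(h₁)` to the front leaves `R` times the coproduct of the remaining leg inside `u` and
`d`. The relation `R Δ = Δᵒᵖ R` puts `R` on the other side, which is `rLeft` with the leg order `p,
d, u`. -/
theorem r_mul_conv_of_moment (hud : Commuting u d.toLinearMap) (hpd : Commuting p d.toLinearMap)
    (hup : ∀ a h, u a * p h = conv p (u ∘ₗ LinearMap.mulLeft k a) h) (h : H) :
    Q.r u d.toLinearMap * conv p d.toLinearMap h =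
      conv (conv p d.toLinearMap) (Q.rLeft u d.toLinearMap) h := by
  let Ψ : H ⊗[k] (H ⊗[k] H) →ₗ[k] E := LinearMap.mul' k E ∘ₗ TensorProduct.map p
    (evMul u d.toLinearMap ∘ₗ LinearMap.mulLeft k (Q.R : H ⊗[k] H))
  have h1 : ∀ s : H ⊗[k] H, Q.r u d.toLinearMap * evMul p d.toLinearMap s =
      Ψ (TensorProduct.assoc k H H H ((Coalgebra.comul : H →ₗ[k] H ⊗[k] H).rTensor H s)) :=
    fun s => by
    induction s with
    | zero => simp
    | add a b ha hb => simp only [map_add, mul_add, ha, hb]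
    | tmul x y =>
      refine (evMul_mul_tmul hpd hup x y (Q.R : H ⊗[k] H)).trans ?_
      rw [LinearMap.rTensor_tmul]
      induction (Coalgebra.comul x : H ⊗[k] H) with
      | zero => simp
      | add c e hc he => simp only [map_add, TensorProduct.add_tmul, hc, he]
      | tmul c e => simp [Ψ]
  have h2 : ∀ s : H ⊗[k] H, evMul u d.toLinearMap (flip k H s * (Q.R : H ⊗[k] H)) =
      evMul d.toLinearMap (Q.rLeft u d.toLinearMap) s := fun s => by
    induction s with
    | zero => simp
    | add a b ha hb => simp only [map_add, add_mul, ha, hb]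
    | tmul y z => exact evMul_tmul_mul hud y z _
  rw [conv_assoc, conv_apply, h1, Coalgebra.coassoc_apply, conv_apply p]
  induction (Coalgebra.comul h : H ⊗[k] H) with
  | zero => simp
  | add a b ha hb => simp only [map_add, ha, hb]
  | tmul x y =>
    rw [evMul_tmul, conv_apply, ← h2, ← Q.R_mul_comul]
    simp [Ψ]

end Exchange

/-! ### Extending moment morphisms to a braided tensor product -/

section Extension
variable {k : Type u} {H : Type v} [Field k] [Ring H] [HopfAlgebra k H] (Q : Quasitriangular k H)
  {X Y : Type*} [Ring X] [Algebra k X] [Ring Y] [Algebra k Y]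
  {M N : ModuleAlgebraData k H}

/-- The linear map `h ↦ f(m · h) ⊗ 1`. -/
def orbitLeft (Y : Type*) [Ring Y] [Algebra k Y] (f : M.carrier →ₗ[k] X) (m : M.carrier) :
    H →ₗ[k] X ⊗[k] Y :=
  (Algebra.TensorProduct.includeLeft : X →ₐ[k] X ⊗[k] Y).toLinearMap ∘ₗ f ∘ₗ M.act.flip m

/-- The linear map `h ↦ 1 ⊗ g(n · h)`. -/
def orbitRight (X : Type*) [Ring X] [Algebra k X] (g : N.carrier →ₗ[k] Y) (n : N.carrier) :
    H →ₗ[k] X ⊗[k] Y :=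
  (Algebra.TensorProduct.includeRight : Y →ₐ[k] X ⊗[k] Y).toLinearMap ∘ₗ g ∘ₗ N.act.flip n

theorem orbitLeft_apply (f : M.carrier →ₗ[k] X) (m : M.carrier) (h : H) :
    orbitLeft Y f m h = f (M.act h m) ⊗ₜ 1 := rfl

theorem spread_eq_r (f : M.carrier →ₗ[k] X) (d : H →ₐ[k] Y) (m : M.carrier) :
    Q.spread M f d.toLinearMap m = Q.r (orbitLeft Y f m) (inVal X d).toLinearMap := by
  rw [Quasitriangular.spread, Quasitriangular.r]
  induction (Q.R : H ⊗[k] H) with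
  | zero => simp
  | add a b ha hb => simp only [map_add, LinearMap.add_apply, ha, hb]
  | tmul a b => simp [evMul_tmul, orbitLeft_apply, inVal_apply]

theorem orbitLeft_act (hM : IsModuleAlgebra M) (f : M.carrier →ₗ[k] X) (m : M.carrier) (a : H) :
    orbitLeft Y f (M.act a m) = orbitLeft Y f m ∘ₗ LinearMap.mulLeft k a := by
  refine LinearMap.ext fun h => ?_
  simp [orbitLeft_apply, hM.act_mul]

theorem rLeft_orbitLeft (hM : IsModuleAlgebra M) (f : M.carrier →ₗ[k] X) (d : H →ₐ[k] Y)
    (m : M.carrier) (a : H) : Q.rLeft (orbitLeft Y f m) (inVal X d).toLinearMap a =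
      Q.spread M f d.toLinearMap (M.act a m) := by
  rw [spread_eq_r, orbitLeft_act hM, Quasitriangular.rLeft_apply]

theorem commuting_orbitLeft (f : M.carrier →ₗ[k] X) (d : H →ₐ[k] Y) (m : M.carrier) :
    Commuting (orbitLeft Y f m) (inVal X d).toLinearMap := fun x y => by
  simp [Commute, SemiconjBy, orbitLeft_apply, inVal_apply]

theorem orbitLeft_one (hM : IsModuleAlgebra M) {f : M.carrier →ₗ[k] X} (hf : f M.one = 1) :
    orbitLeft Y f M.one = convUnit k H (X ⊗[k] Y) := by
  refine LinearMap.ext fun h => ?_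
  rw [orbitLeft_apply, hM.act_unit, map_smul, hf, convUnit_apply, Algebra.algebraMap_eq_smul_one]
  rfl

theorem orbitLeft_mul (hM : IsModuleAlgebra M) {f : M.carrier →ₗ[k] X}
    (hf : ∀ x y, f (M.mul x y) = f x * f y) (m m' : M.carrier) :
    orbitLeft Y f (M.mul m m') = conv (orbitLeft Y f m) (orbitLeft Y f m') := by
  refine LinearMap.ext fun h => ?_
  rw [orbitLeft_apply, hM.act_product, tensorAct, LinearMap.comp_apply, conv_apply]
  induction (Coalgebra.comul h : H ⊗[k] H) with
  | zero => simp
  | add a b ha hb => simp only [map_add, LinearMap.add_apply, TensorProduct.add_tmul, ha, hb]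
  | tmul a b => simp [evMul_tmul, orbitLeft_apply, hf]

/-- The map `m ⊗ n ↦ ∑ f(m · R₁) ⊗ D(R₂) g(n)`. -/
def extend (f : M.carrier →ₗ[k] X) (D : H →ₗ[k] Y) (g : N.carrier →ₗ[k] Y) :
    M.carrier ⊗[k] N.carrier →ₗ[k] X ⊗[k] Y :=
  LinearMap.mul' k (X ⊗[k] Y) ∘ₗ TensorProduct.map (Q.spread M f D)
    ((Algebra.TensorProduct.includeRight : Y →ₐ[k] X ⊗[k] Y).toLinearMap ∘ₗ g)

theorem extend_tmul (f : M.carrier →ₗ[k] X) (D : H →ₗ[k] Y) (g : N.carrier →ₗ[k] Y)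
    (m : M.carrier) (n : N.carrier) : extend Q f D g (m ⊗ₜ n : M.carrier ⊗[k] N.carrier) =
      Q.spread M f D m * 1 ⊗ₜ g n := rfl

/-- The orbit map of a product is the convolution of the orbit maps, so this is `(Δ ⊗ id)(R) =
R₁₃R₂₃`. -/
theorem spread_mul (hM : IsModuleAlgebra M) {f : M.carrier →ₗ[k] X}
    (hf : ∀ x y, f (M.mul x y) = f x * f y) (d : H →ₐ[k] Y) (m m' : M.carrier) :
    Q.spread M f d.toLinearMap (M.mul m m') =
      Q.spread M f d.toLinearMap m * Q.spread M f d.toLinearMap m' := by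
  rw [spread_eq_r, spread_eq_r, spread_eq_r, orbitLeft_mul hM hf,
    Q.r_conv_left _ _ _ (commuting_orbitLeft f d m')]

theorem extend_map₂_flip (hM : IsModuleAlgebra M) (f : M.carrier →ₗ[k] X) (d : H →ₐ[k] Y)
    (g : N.carrier →ₗ[k] Y) (m : M.carrier) (n : N.carrier) (t : H ⊗[k] H) :
    extend Q f d.toLinearMap g (TensorProduct.comm k _ _
      (TensorProduct.map₂ N.act M.act (flip k H t) (n ⊗ₜ m))) =
      evMul (Q.rLeft (orbitLeft Y f m) (inVal X d).toLinearMap) (orbitRight X g n) t := by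
  induction t with
  | zero => simp only [map_zero, LinearMap.zero_apply]
  | add a b ha hb => simp only [map_add, LinearMap.add_apply, ha, hb]
  | tmul a b => exact congrArg (· * _) (rLeft_orbitLeft Q hM f d m a).symm

theorem mul_map_includeLeft (D : H →ₗ[k] X) (d : H →ₐ[k] Y) :
    TensorProduct.map D d.toLinearMap ∘ₗ Coalgebra.comul =
      conv ((Algebra.TensorProduct.includeLeft : X →ₐ[k] X ⊗[k] Y).toLinearMap ∘ₗ D)
        (inVal X d).toLinearMap := by
  refine LinearMap.ext fun h => ?_
  rw [conv_apply, LinearMap.comp_apply]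
  induction (Coalgebra.comul h : H ⊗[k] H) with
  | zero => simp
  | add a b ha hb => simp only [map_add, ha, hb]
  | tmul a b => simp [evMul_tmul, inVal_apply]

theorem extend_tensorAct (hM : IsModuleAlgebra M) (f : M.carrier →ₗ[k] X) (d : H →ₐ[k] Y)
    (g : N.carrier →ₗ[k] Y) (m : M.carrier) (n : N.carrier) :
    extend Q f d.toLinearMap g ∘ₗ
        (tensorAct M.act N.act).flip (m ⊗ₜ n : M.carrier ⊗[k] N.carrier) =
      conv (Q.rLeft (orbitLeft Y f m) (inVal X d).toLinearMap) (orbitRight X g n) := by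
  refine LinearMap.ext fun h => ?_
  rw [conv_apply]
  change extend Q f d.toLinearMap g (TensorProduct.map₂ M.act N.act (Coalgebra.comul h)
    (m ⊗ₜ n)) = _
  induction (Coalgebra.comul h : H ⊗[k] H) with
  | zero => simp only [map_zero, LinearMap.zero_apply]
  | add a b ha hb => simp only [map_add, LinearMap.add_apply, ha, hb]
  | tmul a b => exact congrArg (· * _) (rLeft_orbitLeft Q hM f d m a).symm

section Moment
variable {DX : H →ₗ[k] X} {d : H →ₐ[k] Y} {f : M.carrier →ₗ[k] X} {g : N.carrier →ₗ[k] Y}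

theorem moment_orbitRight (hg : IsMomentHom N d.toLinearMap g) (n : N.carrier) (h : H) :
    (1 ⊗ₜ[k] g n : X ⊗[k] Y) * inVal X d h =
      conv (inVal X d).toLinearMap (orbitRight X g n) h := by
  have h1 := congrArg (Algebra.TensorProduct.includeRight : Y →ₐ[k] X ⊗[k] Y) (hg.moment n h)
  have h2 := LinearMap.congr_fun (conv_comp
    (Algebra.TensorProduct.includeRight : Y →ₐ[k] X ⊗[k] Y) d.toLinearMap (g ∘ₗ N.act.flip n)) h
  rw [map_mul] at h1
  exact h1.trans h2

theorem moment_orbitLeft (hM : IsModuleAlgebra M) (hf : IsMomentHom M DX f) (m : M.carrier)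
    (a h : H) : orbitLeft Y f m a *
      ((Algebra.TensorProduct.includeLeft : X →ₐ[k] X ⊗[k] Y).toLinearMap ∘ₗ DX) h =
      conv ((Algebra.TensorProduct.includeLeft : X →ₐ[k] X ⊗[k] Y).toLinearMap ∘ₗ DX)
        (orbitLeft Y f m ∘ₗ LinearMap.mulLeft k a) h := by
  have h1 := congrArg (Algebra.TensorProduct.includeLeft : X →ₐ[k] X ⊗[k] Y)
    (hf.moment (M.act a m) h)
  have h2 := LinearMap.congr_fun (conv_comp
    (Algebra.TensorProduct.includeLeft : X →ₐ[k] X ⊗[k] Y) DX (f ∘ₗ M.act.flip (M.act a m))) h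
  rw [map_mul] at h1
  rw [← orbitLeft_act hM]
  exact h1.trans h2

theorem extend_one (hM : IsModuleAlgebra M) (hf : IsMomentHom M DX f)
    (hg : IsMomentHom N d.toLinearMap g) :
    extend Q f d.toLinearMap g (M.one ⊗ₜ N.one : M.carrier ⊗[k] N.carrier) = 1 := by
  rw [extend_tmul, spread_eq_r, orbitLeft_one hM hf.map_one, Q.r_convUnit_left, hg.map_one,
    one_mul]
  rfl

theorem extend_mul (hM : IsModuleAlgebra M) (hf : IsMomentHom M DX f)
    (hg : IsMomentHom N d.toLinearMap g) (x y : M.carrier ⊗[k] N.carrier) :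
    extend Q f d.toLinearMap g (twistedMul M.mul N.mul M.act N.act Q.R' x y) =
      extend Q f d.toLinearMap g x * extend Q f d.toLinearMap g y := by
  induction x with
  | zero => simp only [map_zero, LinearMap.zero_apply, zero_mul]
  | add a b ha hb => simp only [map_add, LinearMap.add_apply, add_mul, ha, hb]
  | tmul m n =>
  induction y with
  | zero => simp only [map_zero, mul_zero]
  | add a b ha hb => simp only [map_add, mul_add, ha, hb]
  | tmul m' n' =>
    have h1 := mul'_map_mul (f := Q.spread M f d.toLinearMap)
      (g := (Algebra.TensorProduct.includeRight : Y →ₐ[k] X ⊗[k] Y).toLinearMap ∘ₗ g)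
      (F := M.mul m) (G := N.mul.flip n') (x := Q.spread M f d.toLinearMap m)
      (y := 1 ⊗ₜ g n') (fun v => spread_mul Q hM hf.map_mul d m v)
      (fun w => by simp [hg.map_mul])
    -- `1 ⊗ g(n)` passes the spread of `m'`: the result is the sum of the spreads of `m' · R₁` times
    -- `1 ⊗ g(n · R₂)`.
    have h2 := mul_r_of_moment Q (w := (1 ⊗ₜ[k] g n : X ⊗[k] Y)) (u := orbitLeft Y f m')
      (fun h => by simp [Commute, SemiconjBy, orbitLeft_apply]) (moment_orbitRight hg n)
    rw [twistedMul_apply]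
    refine (h1 _).trans ?_
    rw [extend_tmul, extend_tmul, mul_assoc _ (1 ⊗ₜ[k] g n), ← mul_assoc (1 ⊗ₜ[k] g n),
      spread_eq_r Q f d m', h2, mul_assoc]
    exact congrArg (fun z => _ * (z * _)) (extend_map₂_flip Q hM f d g m' n (Q.R : H ⊗[k] H))

/-- For `m ⊗ n` the value is the spread of `m` times `1 ⊗ g(n)`. Each factor satisfies a moment
relation along `(DX ⊗ D) ∘ Δ`, and these relations compose by `moment_mul`. -/
theorem extend_moment (hM : IsModuleAlgebra M) (hf : IsMomentHom M DX f)
    (hg : IsMomentHom N d.toLinearMap g) (x : M.carrier ⊗[k] N.carrier) (h : H) :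
    extend Q f d.toLinearMap g x * (TensorProduct.map DX d.toLinearMap ∘ₗ Coalgebra.comul) h =
      conv (TensorProduct.map DX d.toLinearMap ∘ₗ Coalgebra.comul)
        (extend Q f d.toLinearMap g ∘ₗ (tensorAct M.act N.act).flip x) h := by
  induction x with
  | zero => simp [conv_apply, evMul]
  | add a b ha hb =>
    rw [map_add, add_mul, ha, hb, map_add, LinearMap.comp_add]
    simp only [conv_apply, evMul, TensorProduct.map_add_right, LinearMap.comp_add,
      LinearMap.add_apply]
  | tmul m n =>
    rw [extend_tensorAct Q hM, mul_map_includeLeft, extend_tmul, spread_eq_r]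
    refine moment_mul (fun h => ?_) (fun h => ?_) h
    · exact r_mul_conv_of_moment Q (commuting_orbitLeft f d m)
        (fun x y => by simp [Commute, SemiconjBy, inVal_apply])
        (fun a h => moment_orbitLeft hM hf m a h) h
    · exact mul_conv_of_moment (fun h => by simp [Commute, SemiconjBy])
        (moment_orbitRight hg n) h

theorem extend_isMomentHom (hM : IsModuleAlgebra M) (hf : IsMomentHom M DX f)
    (hg : IsMomentHom N d.toLinearMap g) : IsMomentHom (Q.braided M N)
      (TensorProduct.map DX d.toLinearMap ∘ₗ Coalgebra.comul) (extend Q f d.toLinearMap g) :=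
  ⟨extend_one Q hM hf hg, extend_mul Q hM hf hg, extend_moment Q hM hf hg⟩

end Moment

theorem spread_one (hM : IsModuleAlgebra M) {f : M.carrier →ₗ[k] X} (hf : f M.one = 1)
    (d : H →ₐ[k] Y) : Q.spread M f d.toLinearMap M.one = 1 := by
  rw [spread_eq_r, orbitLeft_one hM hf, Q.r_convUnit_left]

end Extension

/-! ### The embedded factors generate the graph algebras -/

section Generation
variable {k : Type u} {H : Type v} [Field k] [Ring H] [HopfAlgebra k H] (Q : Quasitriangular k H)
  {M N : ModuleAlgebraData k H}

/-- Against a unit the braiding is trivial, since a counit applied to one leg of `R'` gives `1`. -/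
theorem braided_mul_tmul_one (hM : IsModuleAlgebra M) (hN : IsModuleAlgebra N) (m : M.carrier)
    (n : N.carrier) : twistedMul M.mul N.mul M.act N.act Q.R' (m ⊗ₜ N.one) (M.one ⊗ₜ n) =
      m ⊗ₜ n := by
  rw [twistedMul_apply, map₂_act_unit_left (Bialgebra.counitAlgHom k H) hN.act_unit,
    lid_counit_R', hM.act_one]
  simp [hM.mul_one, hN.one_mul]

theorem braided_mul_one_tmul (hM : IsModuleAlgebra M) (hN : IsModuleAlgebra N)
    (n n' : N.carrier) : twistedMul M.mul N.mul M.act N.act Q.R' (M.one ⊗ₜ n) (M.one ⊗ₜ n') =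
      M.one ⊗ₜ N.mul n n' := by
  rw [twistedMul_apply, map₂_act_unit_right (Bialgebra.counitAlgHom k H) hM.act_unit,
    rid_counit_R', hN.act_one]
  simp [hM.mul_one]

/-- The subspace `p` contains the unit and is closed under the product. -/
structure IsSubalgebra (M : ModuleAlgebraData k H) (p : Submodule k M.carrier) : Prop where
  one_mem : M.one ∈ p
  mul_mem : ∀ {x y}, x ∈ p → y ∈ p → M.mul x y ∈ p

theorem IsSubalgebra.comap (hM : IsModuleAlgebra M) (hN : IsModuleAlgebra N)
    {p : Submodule k (Q.braided M N).carrier} (hp : IsSubalgebra (Q.braided M N) p) :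
    IsSubalgebra N (p.comap (TensorProduct.mk k M.carrier N.carrier M.one)) where
  one_mem := hp.one_mem
  mul_mem {x y} hx hy := by
    have h : twistedMul M.mul N.mul M.act N.act Q.R' (M.one ⊗ₜ x) (M.one ⊗ₜ y) ∈ p :=
      hp.mul_mem hx hy
    rw [braided_mul_one_tmul Q hM hN] at h
    exact h

theorem IsSubalgebra.eq_top (hM : IsModuleAlgebra M) (hN : IsModuleAlgebra N)
    {p : Submodule k (Q.braided M N).carrier} (hp : IsSubalgebra (Q.braided M N) p)
    (h₁ : ∀ m : M.carrier, TensorProduct.mk k M.carrier N.carrier m N.one ∈ p)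
    (h₂ : p.comap (TensorProduct.mk k M.carrier N.carrier M.one) = ⊤) : p = ⊤ := by
  refine Submodule.eq_top_iff'.2 fun x => ?_
  refine TensorProduct.induction_on (motive := fun x => x ∈ p) x p.zero_mem (fun m n => ?_)
    (fun x y hx hy => p.add_mem hx hy)
  have h : twistedMul M.mul N.mul M.act N.act Q.R' (m ⊗ₜ N.one) (M.one ⊗ₜ n) ∈ p :=
    hp.mul_mem (h₁ m) (Submodule.eq_top_iff'.1 h₂ n)
  rwa [braided_mul_tmul_one Q hM hN] at h

theorem trivialData_isModuleAlgebra : IsModuleAlgebra (trivialData k H) where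
  one_mul := one_mul (M := ULift.{v} k)
  mul_one := mul_one (M := ULift.{v} k)
  act_one := LinearMap.ext fun x => by
    change Coalgebra.counit (R := k) (1 : H) • x = x
    rw [Bialgebra.counit_one, one_smul]
  act_mul a b := LinearMap.ext fun x => by
    change Coalgebra.counit (R := k) (a * b) • x =
      Coalgebra.counit (R := k) b • Coalgebra.counit (R := k) a • x
    rw [Bialgebra.counit_mul, mul_comm, mul_smul]
  act_unit h := rfl
  act_product h x y := by
    have h1 := map₂_act_unit (f := (trivialData k H).act) (g := (trivialData k H).act)
      (m := x) (n := y) (fun _ => rfl) (fun _ => rfl) h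
    rw [h1, map_smul]
    rfl

theorem L0_isModuleAlgebra : ∀ n, IsModuleAlgebra (Q.L0 n)
  | 0 => trivialData_isModuleAlgebra
  | n + 1 => braided_isModuleAlgebra Q (L01_isModuleAlgebra Q) (L0_isModuleAlgebra n)

theorem L_isModuleAlgebra : ∀ g n, IsModuleAlgebra (Q.L g n)
  | 0, n => L0_isModuleAlgebra Q n
  | g + 1, n => braided_isModuleAlgebra Q (L10_isModuleAlgebra Q) (L_isModuleAlgebra g n)

theorem L0_generated : ∀ (n : ℕ) (p : Submodule k (Q.L0 n).carrier), IsSubalgebra (Q.L0 n) p →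
    (∀ l φ, Q.jLoop₀ n l φ ∈ p) → p = ⊤
  | 0, p, hp, _ => Submodule.eq_top_iff'.2 fun x => by
    have h : x.down • (1 : ULift.{v} k) ∈ p := p.smul_mem x.down hp.one_mem
    have hx : x.down • (1 : ULift.{v} k) = x := ULift.ext _ _ (mul_one x.down)
    exact hx ▸ h
  | n + 1, _, hp, hj => hp.eq_top Q (L01_isModuleAlgebra Q) (L0_isModuleAlgebra Q n)
      (fun m => hj 0 m)
      (L0_generated n _ (hp.comap Q (L01_isModuleAlgebra Q) (L0_isModuleAlgebra Q n))
        fun l φ => hj l.succ φ)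

/-- Induction on `g`: the elements `n` with `1 ⊗ n ∈ p` again form a subalgebra, to which the
smaller case applies, and `m ⊗ n = (m ⊗ 1)(1 ⊗ n)`. -/
theorem L_generated : ∀ (g n : ℕ) (p : Submodule k (Q.L g n).carrier), IsSubalgebra (Q.L g n) p →
    (∀ l φ, Q.jLoop g n l φ ∈ p) → (∀ i x, Q.jHandle g n i x ∈ p) → p = ⊤
  | 0, n, p, hp, hj, _ => L0_generated Q n p hp hj
  | g + 1, n, _, hp, hj, hi => hp.eq_top Q (L10_isModuleAlgebra Q) (L_isModuleAlgebra Q g n)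
      (fun m => hi 0 m)
      (L_generated g n _ (hp.comap Q (L10_isModuleAlgebra Q) (L_isModuleAlgebra Q g n)) hj
        fun i x => hi i.succ x)

end Generation

/-! ### Construction of `Φ_{g,n}` by induction -/

section Extension
variable {k : Type u} {H : Type v} [Field k] [Ring H] [HopfAlgebra k H] (Q : Quasitriangular k H)
  {X Y : Type*} [Ring X] [Algebra k X] [Ring Y] [Algebra k Y]
  {M N : ModuleAlgebraData k H} {DX : H →ₗ[k] X} {D : H →ₗ[k] Y}
  {f : M.carrier →ₗ[k] X} {g : N.carrier →ₗ[k] Y}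

/-- The linear map `D` is a morphism of algebras. -/
def IsAlgHom (D : H →ₗ[k] Y) : Prop := ∃ d : H →ₐ[k] Y, d.toLinearMap = D

theorem IsAlgHom.map_comul (hDX : IsAlgHom DX) (hD : IsAlgHom D) :
    IsAlgHom (TensorProduct.map DX D ∘ₗ Coalgebra.comul) := by
  obtain ⟨dX, rfl⟩ := hDX
  obtain ⟨d, rfl⟩ := hD
  exact ⟨(Algebra.TensorProduct.map dX d).comp (Bialgebra.comulAlgHom k H), rfl⟩

theorem IsMomentHom.extend (hM : IsModuleAlgebra M) (hf : IsMomentHom M DX f)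
    (hg : IsMomentHom N D g) (hD : IsAlgHom D) :
    IsMomentHom (Q.braided M N) (TensorProduct.map DX D ∘ₗ Coalgebra.comul)
      (extend Q f D g) := by
  obtain ⟨d, rfl⟩ := hD
  exact extend_isMomentHom Q hM hf hg

theorem extend_tmul_one (f : M.carrier →ₗ[k] X) (hg : IsMomentHom N D g) (m : M.carrier) :
    extend Q f D g (m ⊗ₜ N.one) = Q.spread M f D m := by
  rw [extend_tmul, hg.map_one]
  exact mul_one _

theorem extend_one_tmul (hM : IsModuleAlgebra M) (hf : IsMomentHom M DX f) (hD : IsAlgHom D)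
    (n : N.carrier) : extend Q f D g (M.one ⊗ₜ n) = 1 ⊗ₜ g n := by
  obtain ⟨d, rfl⟩ := hD
  rw [extend_tmul, spread_one Q hM hf.map_one, one_mul]

theorem isAlgHom_convUnit : IsAlgHom (convUnit k H Y) :=
  ⟨(Algebra.ofId k Y).comp (Bialgebra.counitAlgHom k H), rfl⟩

theorem trivial_isMomentHom : IsMomentHom (trivialData k H) (convUnit k H (ULift.{v} k))
    (LinearMap.id : ULift.{v} k →ₗ[k] ULift.{v} k) where
  map_one := rfl
  map_mul _ _ := rfl
  moment x h := by
    rw [convUnit_conv, convUnit_apply, ← Algebra.commutes, ← Algebra.smul_def]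
    rfl

theorem isAlgHom_D₀ : ∀ n, IsAlgHom (D₀ k H n)
  | 0 => isAlgHom_convUnit (k := k) (H := H) (Y := ULift.{v} k)
  | n + 1 => IsAlgHom.map_comul ⟨AlgHom.id k H, rfl⟩ (isAlgHom_D₀ n)

theorem exists_loopHom : ∀ n : ℕ, ∃ Φ : (Q.L0 n).carrier →ₗ[k] tensorPow k H n,
    IsMomentHom (Q.L0 n) (D₀ k H n) Φ ∧ ∀ l φ, Φ (Q.jLoop₀ n l φ) = Q.loopImage₀ n l φ
  | 0 => ⟨LinearMap.id, trivial_isMomentHom, fun l => l.elim0⟩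
  | n + 1 => by
    obtain ⟨Φ, h, hj⟩ := exists_loopHom n
    have hM := L01_isModuleAlgebra Q
    have hf := loop_isMomentHom Q
    have hD := isAlgHom_D₀ (k := k) (H := H) n
    refine ⟨extend Q Q.Φ01 (D₀ k H n) Φ, hf.extend Q hM h hD, fun l φ => ?_⟩
    refine Fin.cases ?_ (fun l => ?_) l
    · exact extend_tmul_one Q Q.Φ01 h φ
    · exact (extend_one_tmul Q hM hf hD _).trans (congrArg _ (hj l φ))

variable [BijectiveAntipode k H]

theorem isAlgHom_D : ∀ g n, IsAlgHom (GraphAlgebra.D k H g n)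
  | 0, n => isAlgHom_D₀ n
  | g + 1, n => IsAlgHom.map_comul ⟨heisDiagHom k H, heisDiagHom_coe⟩ (isAlgHom_D g n)

/-- The moment condition along `D_{g,n}` is carried as part of the induction hypothesis:
multiplicativity alone would not survive the next tensor factor. The first embedding goes to a
spread, the others to `1 ⊗` the smaller map, which matches the recursion of the prescribed images.
-/
theorem exists_alekseevHom : ∀ g n : ℕ, ∃ Φ : (Q.L g n).carrier →ₗ[k] Target k H g n,
    IsMomentHom (Q.L g n) (GraphAlgebra.D k H g n) Φ ∧
      (∀ l φ, Φ (Q.jLoop g n l φ) = Q.loopImage g n l φ) ∧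
      ∀ i x, Φ (Q.jHandle g n i x) = Q.handleImage g n i x
  | 0, n => by
    obtain ⟨Φ, h, hj⟩ := exists_loopHom Q n
    exact ⟨Φ, h, hj, fun i => i.elim0⟩
  | g + 1, n => by
    obtain ⟨Φ, h, hj, hi⟩ := exists_alekseevHom g n
    have hM := L10_isModuleAlgebra Q
    have hf := handle_isMomentHom Q
    have hD := isAlgHom_D (k := k) (H := H) g n
    refine ⟨GraphAlgebra.extend Q Q.Φ10 (GraphAlgebra.D k H g n) Φ, hf.extend Q hM h hD,
      fun l φ => ?_, fun i x => ?_⟩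
    · exact (extend_one_tmul Q hM hf hD _).trans (congrArg _ (hj l φ))
    · refine Fin.cases ?_ (fun i => ?_) i
      · exact extend_tmul_one Q Q.Φ10 h x
      · exact (extend_one_tmul Q hM hf hD _).trans (congrArg _ (hi i x))

end Extension

end GraphAlgebra
end

theorem mainTheorem11 {k : Type*} {H : Type*} [Field k] [Ring H] [HopfAlgebra k H]
    [GraphAlgebra.BijectiveAntipode k H] (Q : GraphAlgebra.Quasitriangular k H) (g n : ℕ) :
    ∃! Φ : (Q.L g n).carrier →ₗ[k] GraphAlgebra.Target k H g n,
      Φ (Q.L g n).one = 1 ∧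
      (∀ x y, Φ ((Q.L g n).mul x y) = Φ x * Φ y) ∧
      (∀ (l : Fin n) (φ : Q.L01.carrier), Φ (Q.jLoop g n l φ) = Q.loopImage g n l φ) ∧
      (∀ (i : Fin g) (x : Q.L10.carrier), Φ (Q.jHandle g n i x) = Q.handleImage g n i x) := by
  obtain ⟨Φ, h, hj, hi⟩ := GraphAlgebra.exists_alekseevHom Q g n
  refine ⟨Φ, ⟨h.map_one, h.map_mul, hj, hi⟩, fun Ψ ⟨h₁, h₂, hj', hi'⟩ => ?_⟩
  -- The locus where two multiplicative unital maps agree is a subalgebra, and it contains the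
  -- generators.
  have hp : LinearMap.eqLocus Ψ Φ = ⊤ := GraphAlgebra.L_generated Q g n _
    ⟨h₁.trans h.map_one.symm, fun {x y} hx hy => by
      have hx' : Ψ x = Φ x := hx
      have hy' : Ψ y = Φ y := hy
      exact (h₂ x y).trans ((hx' ▸ hy' ▸ rfl : Ψ x * Ψ y = Φ x * Φ y).trans
        (h.map_mul x y).symm)⟩
    (fun l φ => (hj' l φ).trans (hj l φ).symm) (fun i x => (hi' i x).trans (hi i x).symm)
  exact LinearMap.ext fun x => (Submodule.eq_top_iff'.1 hp x : _)
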